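/- **Setting.** For $x\in\mathbb C^n$ let $x^*_1\ge x^*_2\ge\dots\ge x^*_n$ be the non-increasing rearrangement of $|x_1|,\dots,|x_n|$ (with $x_0^*:=x_1^*$ and $x_k^*:=0$ for $k>n$). Let $\alpha\ge 1$, let $C_\alpha>0$, and consider $n\in\mathbb N$, $p$, $A$, $z$ such that: * (A1) $C_\alpha n^{-1}\le p\le n^{-7/8}$; * (A2) $A=(a_{ij})$ is a random $n\times n$ matrix with i.i.d. entries $a_{ij}=\delta_{ij}\xi_{ij}$, where $\delta_{ij}$ is Bernoulli with $\mathbb P\{\delta_{ij}=1\}=p$, and $\xi_{ij}$ is a complex random variable independent of $\delta_{ij}$, almost surely non-zero, with zero mean, unit variance and $\sup_{\tau\in\mathbb C}\mathbb P\{|\xi_{ij}-\tau|\le 1/\alpha\}\le 1-1/\alpha$; * (A3) $z\in\mathbb C$, $|z|\le pn$ and $|a_{ij}-z|\ge 1/\alpha$ almost surely for all $i,j$. Put $\widetilde A:=A-z\,\mathrm{Id}$ and $K_0:=pn/(2\alpha)$. For a map $\phi$ on $[n]$ and an $n\times n$ matrix $B$, the matrix $\phi(B)$ has rows $\mathrm{row}_i(\phi(B))=\sum_{v\in\phi^{-1}(i)}\mathrm{row}_v(B)$.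 **Event $\mathcal E_{ap}$.** Given $m\in\mathbb N$ and $c,c_1,c_2>0$, let $M_1:=\lfloor c_1n/\log(pn)\rfloor$. The event $\mathcal E_{ap}(m;c,c_1,c_2)$ occurs for $B$ if for all $\phi:[n]\to\mathbb N$ with $|\{i\le n: |\phi^{-1}(\phi(i))|\ge 2\}|\le cn$ and all unit vectors $x\in\mathbb C^n$ with $x^*_m>e^{-c_1pn}x^*_{\lfloor m/2\rfloor}$ and $x^*_{M_1}\le \frac{c}{pn}x^*_m$ we have $\|\phi(B)x\|_2>c_2\sqrt n\,x_m^*$. **Graphs.** We consider directed bipartite graphs $G$ in which $i\leftarrow j$ implies $i\to j$ ($i$ a left, $j$ a right vertex). For a right vertex $j$ and a set $I$ of right vertices, $\partial_{in}(I)=\{i:\ i\to j' \text{ for some } j'\in I\}$ and $\partial_{out}(j)=\{i:\ i\leftarrow j\}$; for a left vertex $i$, $\partial_{out}(i)=\{j:\ i\to j\}$. The graph $G_B$ of an $n\times n$ matrix $B$ has left and right vertex set $[n]$, with $i\to j$ iff $b_{ij}\ne0$ and $i\leftarrow j$ iff $|b_{ij}|\ge1/\alpha$. A right vertex $j$ is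 of type $(K,\ell)$, $\ell\ge1$, if it is of none of the types $(K,h)$, $h<\ell$, and $|\partial_{out}(j)\setminus\partial_{in}(T_{K,1}\cup\dots\cup T_{K,\ell-1})|\le K$, where $T_{K,h}=T_{K,h}(G)$ is the set of vertices of type $(K,h)$; $T_{K,\infty}$ is the set of right vertices of no type $(K,\ell)$, $\ell\in\mathbb N$. A surjection $\phi:[n]\to[m']$ is $(G,K)$-admissible if its fibres have one or two elements and, whenever $i_1\ne i_2$ and $\phi(i_1)=\phi(i_2)$, the sets $\partial_{out}(i_1),\partial_{out}(i_2)$ (of left vertices) are disjoint and contained in $T_{K,\infty}(G)$. The graph $\phi(G)$ is obtained by gluing left vertices with equal $\phi$-values. A $\phi$-chain of length $k$ is a sequence $(j_1,\dots,j_k)$ of right vertices with $j_\ell\ne j_{\ell+1}$ and $\phi(j_\ell)\to j_{\ell+1}$ in $\phi(G)$ for $\ell<k$; it is cycle-free if its members are distinct, and cyclic if $j_1,\dots,j_{k-1}$ are distinct and $j_k=j_u$ for some $u<k-1$. It is $(K,\phi)$-self-balancing if, for all $\ell\le k$, $j_\ell\notin T_{K,\infty}(\phi(G))$ and every out-neighbour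 of $j_\ell$ in $\phi(G)$ is an in-neighbour in $\phi(G)$ of $\bigcup_{g\ge1}T_{K,g}(\phi(G))\setminus\{j_\ell\}$. **Event $\mathcal E_{good}$.** Given positive parameters $c_S,c_T,c_E$ (and $m,c,c_1,c_2$), let $\mathcal E$ be the event that for a matrix $B$ with graph $G=G_B$: * for every $u=0,1,2,\dots$, at most $e^{-c_S(pn+u)}n$ left vertices $i$ have $|\partial_{out}(i)|\ge 2pn+u$, and at most $e^{-c_S(pn+u)}n$ right vertices $j$ have $|\partial_{in}(j)|\ge2pn+u$; * $|\partial_{in}(\bigcup_{g\ge1}T_{K_0,g}(G))|\le ne^{-c_Tpn}$; and for every $(G,K_0/2)$-admissible $\phi$ there are no $(K_0/2,\phi)$-self-balancing cyclic $\phi$-chains, and for $1\le k\le n^{1/4}$ at most $ne^{-c_Tpnk}$ cycle-free $\phi$-chains of length $k$ are $(K_0/2,\phi)$-self-balancing; * $|\partial_{in}(I)|\ge\sum_{j\in I}|\partial_{in}(j)|-\frac{pn}{512\alpha}|I|$ for every set $I$ of right vertices with $2\le|I|\le c_E/p$; * $\mathcal E_{ap}(m;c,c_1,c_2)$ occurs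 for $B$. Then $\mathcal E_{good}$ is the event that $\mathcal E$ occurs for both $\widetilde A$ and $\widetilde A^\top$ and that, for all $r\ge pn$, at most $n/r^{0.9}$ rows and at most $n/r^{0.9}$ columns of $A$ have $\ell_1$-norm at least $r\,pn$. **Claim.** 1. For every $\alpha\ge1$ there is $C_\alpha>0$ such that for every $\tau\in(0,1)$ there are $C,c,c_1,c_2>0$ (depending only on $\alpha$ and $\tau$) such that, whenever (A1)–(A3) hold and $m$ is an integer with $\tau p^{-1}\le m\le p^{-1}$, $$\mathbb P\big(\mathcal E_{ap}(m;c,c_1,c_2)\text{ occurs for }\widetilde A\big)\ \ge\ 1-e^{-Cn}$$ (in the sense that the complement of the event has outer probability at most $e^{-Cn}$). 2. There is a universal constant $C>0$ such that for every $\alpha\ge1$ and all $c_S,c_T,c_E>0$ there is $\tau_0\in(0,1)$ such that for all $\tau\in(0,\tau_0)$ and $c,c_1,c_2>0$ there are $C_\alpha,c'>0$, depending only on the parameters chosen so far, with the following property. Let (A1)–(A3) hold, let $m$ be an integer with $\tau p^{-1}\le m\le\tau_0p^{-1}$, and put $M:=\lfloor c'n/\log(pn)\rfloor$. Then almost surely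 on $\mathcal E_{good}$, every $x\in\mathbb C^n$ with $\|\widetilde Ax\|_2\le(2\alpha)^{-C\log^3n}\|x\|_\infty$ satisfies $$\|x\|_\infty\le(2\alpha)^{C\log^3n}\,x^*_M .$$ -/

import Mathlib

open MeasureTheory ProbabilityTheory
open scoped Matrix

universe u

noncomputable section

namespace SparseCircular

/-! ### Order statistics, row and column sums -/

/-- `orderStat x k` is `x*_k`, the `k`-th largest (counted from `k = 1`) of the numbers `|x_i|`:
the least `t ≥ 0` such that at most `k - 1` coordinates have absolute value larger than `t`.
It is `0` for `k` larger than the dimension, and `x*_0 = x*_1` by convention. -/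
def orderStat {n : ℕ} (x : Fin n → ℂ) (k : ℕ) : ℝ :=
  sInf {t : ℝ | 0 ≤ t ∧ {i : Fin n | t < ‖x i‖}.ncard ≤ k - 1}

/-- The statistics of large rows and columns (in the `ℓ¹` norm) of the unshifted matrix. -/
def EllOneEvent {n : ℕ} (p : ℝ) (A : Matrix (Fin n) (Fin n) ℂ) : Prop :=
  ∀ r : ℝ, p * n ≤ r →
    (({i : Fin n | r * (p * n) ≤ ∑ j, ‖A i j‖}.ncard : ℝ) ≤ n / r ^ (0.9 : ℝ)) ∧
    (({j : Fin n | r * (p * n) ≤ ∑ i, ‖A i j‖}.ncard : ℝ) ≤ n / r ^ (0.9 : ℝ))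

/-! ### Compressions of matrices and the event on moderately sparse vectors -/

/-- The compression `φ(B)`: rows of `B` whose indices have the same image under `φ` are added. -/
def compress {n : ℕ} {ι : Type*} [DecidableEq ι] (φ : Fin n → ι)
    (B : Matrix (Fin n) (Fin n) ℂ) : Matrix ι (Fin n) ℂ :=
  Matrix.of fun i j => ∑ v ∈ Finset.univ.filter (fun v => φ v = i), B v j

/-- The Euclidean norm of `φ(B) x`; rows outside the range of `φ` vanish. -/
def compressNorm {n : ℕ} (φ : Fin n → ℕ) (B : Matrix (Fin n) (Fin n) ℂ) (x : Fin n → ℂ) : ℝ :=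
  √(∑ i ∈ Finset.univ.image φ, ‖(compress φ B *ᵥ x) i‖ ^ 2)

/-- `spreadIndex c n p = ⌊c n / log (p n)⌋`. -/
def spreadIndex (c : ℝ) (n : ℕ) (p : ℝ) : ℕ := ⌊c * n / Real.log (p * n)⌋₊

/-- The event that for every `φ : [n] → ℕ` which glues at most `c n` indices, every unit vector `x`
with `x*_m > e^{- c₁ p n} x*_{⌊m/2⌋}` and `x*_M ≤ (c / (p n)) x*_m`, where
`M = ⌊c₁ n / log (p n)⌋`, satisfies `‖φ(B) x‖₂ > c₂ √n x*_m`. -/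
def AlmostProportionalEvent {n : ℕ} (p : ℝ) (m : ℕ) (c c₁ c₂ : ℝ)
    (B : Matrix (Fin n) (Fin n) ℂ) : Prop :=
  ∀ φ : Fin n → ℕ,
    (({i : Fin n | 2 ≤ {v : Fin n | φ v = φ i}.ncard}.ncard : ℝ) ≤ c * n) →
    ∀ x : Fin n → ℂ, ‖WithLp.toLp 2 x‖ = 1 →
      Real.exp (-(c₁ * (p * n))) * orderStat x (m / 2) < orderStat x m →
      orderStat x (spreadIndex c₁ n p) ≤ c / (p * n) * orderStat x m →
      c₂ * √n * orderStat x m < compressNorm φ B x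

/-! ### Directed bipartite graphs -/

/-- Directed bipartite graphs on left vertices `L` and right vertices `R` such that `i ← j` only
if `i → j` (for `i` left and `j` right). -/
structure BiDigraph (L R : Type*) where
  /-- `toRight i j` is the edge `i → j`. -/
  toRight : L → R → Prop
  /-- `toLeft i j` is the edge `i ← j`. -/
  toLeft : L → R → Prop
  toRight_of_toLeft : ∀ i j, toLeft i j → toRight i j

namespace BiDigraph

variable {L R : Type*}

/-- In-neighbours (left vertices) of a set of right vertices. -/
def inNbr (G : BiDigraph L R) (I : Set R) : Set L := {i | ∃ j ∈ I, G.toRight i j}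

/-- Out-neighbours (left vertices) of a right vertex. -/
def outNbr (G : BiDigraph L R) (j : R) : Set L := {i | G.toLeft i j}

/-- Out-neighbours (right vertices) of a left vertex. -/
def outNbrLeft (G : BiDigraph L R) (i : L) : Set R := {j | G.toRight i j}

/-- The right vertices of one of the types `(K, 1), …, (K, ℓ)`: a vertex `j` which is of none of
the types `(K, 1), …, (K, ℓ)` is of type `(K, ℓ + 1)` if at most `K` of its out-neighbours are not
in-neighbours of vertices of the types `(K, 1), …, (K, ℓ)`. -/
def typeUpTo (G : BiDigraph L R) (K : ℝ) : ℕ → Set R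
  | 0 => ∅
  | ℓ + 1 => typeUpTo G K ℓ ∪
      {j | ((G.outNbr j \ G.inNbr (typeUpTo G K ℓ)).ncard : ℝ) ≤ K}

/-- The right vertices of some finite type, `⋃_{g ≥ 1} T_{K,g}(G)`. -/
def finType (G : BiDigraph L R) (K : ℝ) : Set R := ⋃ ℓ : ℕ, G.typeUpTo K ℓ

/-- The right vertices of infinite type, `T_{K,∞}(G)`. -/
def infType (G : BiDigraph L R) (K : ℝ) : Set R := (G.finType K)ᶜ

/-- The compressed graph `φ(G)`, in which left vertices with the same image are glued. -/
def glue {L' : Type*} (G : BiDigraph L R) (φ : L → L') : BiDigraph L' R where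
  toRight i j := ∃ v, φ v = i ∧ G.toRight v j
  toLeft i j := ∃ v, φ v = i ∧ G.toLeft v j
  toRight_of_toLeft := fun _ j ⟨v, hv, h⟩ => ⟨v, hv, G.toRight_of_toLeft v j h⟩

/-- `(G, K)`-admissible mappings. -/
def Admissible {n m : ℕ} (G : BiDigraph (Fin n) (Fin n)) (K : ℝ) (φ : Fin n → Fin m) : Prop :=
  Function.Surjective φ ∧
  (∀ i : Fin m, {v | φ v = i}.ncard = 1 ∨ {v | φ v = i}.ncard = 2) ∧
  ∀ i₁ i₂ : Fin n, i₁ ≠ i₂ → φ i₁ = φ i₂ →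
    Disjoint (G.outNbrLeft i₁) (G.outNbrLeft i₂) ∧
    G.outNbrLeft i₁ ∪ G.outNbrLeft i₂ ⊆ G.infType K

/-- `j = (j_1, …, j_k)` is a `φ`-chain of length `k` for `φ(G)`. -/
def IsChain {n m k : ℕ} (G : BiDigraph (Fin n) (Fin n)) (φ : Fin n → Fin m)
    (j : Fin k → Fin n) : Prop :=
  ∀ a b : Fin k, (b : ℕ) = a + 1 → j a ≠ j b ∧ (G.glue φ).toRight (φ (j a)) (j b)

/-- `j_1, …, j_{k-1}` are distinct, but `j_k = j_u` for some `u < k - 1`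
(indices start from `0` in `Fin k`). -/
def IsCyclic {n k : ℕ} (j : Fin k → Fin n) : Prop :=
  (∀ a b : Fin k, (a : ℕ) + 1 < k → (b : ℕ) + 1 < k → j a = j b → a = b) ∧
  ∃ u l : Fin k, (u : ℕ) + 2 < k ∧ (l : ℕ) + 1 = k ∧ j l = j u

/-- `(K, φ)`-self-balancing sequences of right vertices. -/
def SelfBalancing {n m k : ℕ} (G : BiDigraph (Fin n) (Fin n)) (K : ℝ) (φ : Fin n → Fin m)
    (j : Fin k → Fin n) : Prop :=
  ∀ a : Fin k, j a ∉ (G.glue φ).infType K ∧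
    (G.glue φ).outNbr (j a) ⊆ (G.glue φ).inNbr ((G.glue φ).finType K \ {j a})

/-- Statistics of the degrees. -/
def SupportEvent {n : ℕ} (p cS : ℝ) (G : BiDigraph (Fin n) (Fin n)) : Prop :=
  ∀ w : ℕ,
    (({i : Fin n | 2 * (p * n) + w ≤ ((G.outNbrLeft i).ncard : ℝ)}.ncard : ℝ)
      ≤ Real.exp (-(cS * (p * n + w))) * n) ∧
    (({j : Fin n | 2 * (p * n) + w ≤ ((G.inNbr {j}).ncard : ℝ)}.ncard : ℝ)
      ≤ Real.exp (-(cS * (p * n + w))) * n)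

/-- Expansion of sets of right vertices of cardinality between `2` and `cE / p`. -/
def ExpansionEvent {n : ℕ} (p ε cE : ℝ) (G : BiDigraph (Fin n) (Fin n)) : Prop :=
  ∀ I : Finset (Fin n), 2 ≤ I.card → (I.card : ℝ) ≤ cE / p →
    ∑ j ∈ I, ((G.inNbr {j}).ncard : ℝ) - ε * (p * n) * I.card ≤ ((G.inNbr (I : Set (Fin n))).ncard : ℝ)

/-- Statistics of chains, with `K₀ = p n / (2 α)`: few left vertices are in-neighbours of right
vertices of finite `K₀`-type; for every `(G, K₀ / 2)`-admissible mapping `φ` there is no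
`(K₀ / 2, φ)`-self-balancing cyclic `φ`-chain, and for `1 ≤ k ≤ n^{1/4}` there are at most
`n e^{- cT p n k}` cycle-free `(K₀ / 2, φ)`-self-balancing `φ`-chains of length `k`. -/
def ChainEvent {n : ℕ} (α p cT : ℝ) (G : BiDigraph (Fin n) (Fin n)) : Prop :=
  ((G.inNbr (G.finType (p * n / (2 * α)))).ncard : ℝ) ≤ n * Real.exp (-(cT * (p * n))) ∧
  (∀ (m : ℕ) (φ : Fin n → Fin m), G.Admissible (p * n / (2 * α) / 2) φ →
    ∀ (k : ℕ) (j : Fin k → Fin n), G.IsChain φ j → IsCyclic j →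
      ¬ G.SelfBalancing (p * n / (2 * α) / 2) φ j) ∧
  (∀ (m : ℕ) (φ : Fin n → Fin m), G.Admissible (p * n / (2 * α) / 2) φ →
    ∀ k : ℕ, 1 ≤ k → (k : ℝ) ≤ (n : ℝ) ^ (1 / 4 : ℝ) →
      ({j : Fin k → Fin n | G.IsChain φ j ∧ Function.Injective j ∧
        G.SelfBalancing (p * n / (2 * α) / 2) φ j}.ncard : ℝ)
      ≤ n * Real.exp (-(cT * (p * n) * k)))

end BiDigraph

/-- The graph `G_B` of a matrix: `i → j` iff `b_ij ≠ 0`, and `i ← j` iff `|b_ij| ≥ 1 / α`.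
(For `α > 0` the first clause in `toLeft` is implied by the second one.) -/
def matrixGraph {n : ℕ} (α : ℝ) (B : Matrix (Fin n) (Fin n) ℂ) : BiDigraph (Fin n) (Fin n) where
  toRight i j := B i j ≠ 0
  toLeft i j := B i j ≠ 0 ∧ 1 / α ≤ ‖B i j‖
  toRight_of_toLeft := fun _ _ h => h.1

/-- The good event for one shifted matrix. -/
def GoodOneSide {n : ℕ} (α p cS cT cE : ℝ) (m : ℕ) (c c₁ c₂ : ℝ)
    (B : Matrix (Fin n) (Fin n) ℂ) : Prop :=
  (matrixGraph α B).SupportEvent p cS ∧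
  (matrixGraph α B).ChainEvent α p cT ∧
  (matrixGraph α B).ExpansionEvent p (1 / (512 * α)) cE ∧
  AlmostProportionalEvent p m c c₁ c₂ B

/-- The good event for the matrix `A` and the shift `z`: the event `GoodOneSide` occurs for
`A - z Id` and for its transpose, and the rows and columns of `A` are well behaved. -/
def Good {n : ℕ} (α p cS cT cE : ℝ) (m : ℕ) (c c₁ c₂ : ℝ)
    (A : Matrix (Fin n) (Fin n) ℂ) (z : ℂ) : Prop :=
  GoodOneSide α p cS cT cE m c c₁ c₂ (A - z • (1 : Matrix (Fin n) (Fin n) ℂ)) ∧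
  GoodOneSide α p cS cT cE m c c₁ c₂ (A - z • (1 : Matrix (Fin n) (Fin n) ℂ))ᵀ ∧
  EllOneEvent p A

/-! ### The random matrix -/

/-- The Lévy anti-concentration function `sup_τ P{|ξ - τ| ≤ t}`. -/
def levyConc {Ω : Type*} [MeasurableSpace Ω] (μ : Measure Ω) (ξ : Ω → ℂ) (t : ℝ) : ℝ :=
  ⨆ τ : ℂ, μ.real {ω | ‖ξ ω - τ‖ ≤ t}

/-- `C_α / n ≤ p ≤ n^{-7/8}`. -/
def SparsityRange (Cα : ℝ) (n : ℕ) (p : ℝ) : Prop :=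
  0 < n ∧ Cα / n ≤ p ∧ p ≤ (n : ℝ) ^ (-(7 / 8) : ℝ)

/-- `A` has i.i.d. entries `a_ij = δ_ij ξ_ij`, where `δ_ij` is Bernoulli with parameter `p`, and
`ξ_ij` is a complex variable independent of `δ_ij`, (almost surely) non-zero, of zero mean and unit
variance, with `L(ξ_ij, 1/α) ≤ 1 - 1/α`. -/
structure IsSparseModel {Ω : Type*} [MeasurableSpace Ω] (μ : Measure Ω) {n : ℕ} (α p : ℝ)
    (A : Ω → Matrix (Fin n) (Fin n) ℂ) (δ ξ : Fin n → Fin n → Ω → ℂ) : Prop where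
  entry : ∀ i j ω, A ω i j = δ i j ω * ξ i j ω
  measurable_δ : ∀ i j, Measurable (δ i j)
  measurable_ξ : ∀ i j, Measurable (ξ i j)
  iIndep : iIndepFun (fun (ij : Fin n × Fin n) ω => A ω ij.1 ij.2) μ
  identDistrib : ∀ i j i' j', IdentDistrib (fun ω => A ω i j) (fun ω => A ω i' j') μ μ
  δ_zero_one : ∀ i j ω, δ i j ω = 0 ∨ δ i j ω = 1
  δ_prob : ∀ i j, μ.real {ω | δ i j ω = 1} = p
  indep : ∀ i j, IndepFun (δ i j) (ξ i j) μ
  ξ_ne_zero : ∀ i j, ∀ᵐ ω ∂μ, ξ i j ω ≠ 0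
  ξ_memLp : ∀ i j, MemLp (ξ i j) 2 μ
  ξ_mean : ∀ i j, ∫ ω, ξ i j ω ∂μ = 0
  ξ_variance : ∀ i j, ∫ ω, ‖ξ i j ω‖ ^ 2 ∂μ = 1
  ξ_levy : ∀ i j, levyConc μ (ξ i j) (1 / α) ≤ 1 - 1 / α

/-- `|z| ≤ p n`, and `|a_ij - z| ≥ 1/α` almost surely. -/
def IsShift {Ω : Type*} [MeasurableSpace Ω] (μ : Measure Ω) {n : ℕ} (α p : ℝ)
    (A : Ω → Matrix (Fin n) (Fin n) ℂ) (z : ℂ) : Prop :=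
  ‖z‖ ≤ p * n ∧ ∀ i j, ∀ᵐ ω ∂μ, 1 / α ≤ ‖A ω i j - z‖

end SparseCircular

end

namespace SparseCircular

/-! ### Order statistics -/

section OrderStat

variable {n : ℕ} (x : Fin n → ℂ)

/-! Second claim. Write `B` for the shifted matrix and `P = pn`. If `Bx` is tiny and `|b_ij| ≥ 1/α`,
then row `i` cannot be balanced by `x_j` alone, so it contains another coordinate comparable to
`x_j` up to the factor `D = 2αn³` (`exists_comparable_of_row`). Diagonal entries are edges, so from
the largest coordinate these rows trace a chain with `φ = id`. Were every large coordinate of finite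
type, the chain would be self-balancing, and the good event excludes both a repetition and a chain
of length `⌊log n⌋ + 1` (`exists_notMem_finType_of_chains`). Hence some large coordinate has
infinite type. Sets of such coordinates have many out-neighbours that avoid all finite types; by
expansion some of these rows would meet the next set only once if it grew by a factor at most 4,
contradicting balance. So the sets reach size `cE/p ≥ m` (`lt_card_of_expansion`), and `‖x‖` is at
most `D^{O(log n)} x*_m`. A drop by `e^{c₁P}` between `m/2` and `m` would, by the same
unique-neighbour count, force at least of order `mP ≥ τn` heavy rows (`exists_heavy_rows`), more
than the `ℓ¹` statistics allow. Without that drop the almost proportional event applies and passes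
from `x*_m` to `x*_M`.

First claim. This is a union bound over a net. Normalise `x*_m = 1`: the top `⌊m/2⌋` coordinates are
left undescribed, the next ones up to `m` have size between `1` and `e^{c₁P}`, those up to `M` have
size at most `1`, and the rest are negligible. Since `mp` lies between `τ` and `1`, a row of `A`
vanishes on the undescribed positions and has exactly one non-zero entry on the second layer with
probability at least of order `τ`; the spread of that entry makes the row sum large
(`le_measure_spread`). Rows are independent, so a proportion of them is good except with probability
`e^{-qn/8}`, where `q = τ/(16α)`. The net is smaller than this because `m·c₁P` and `M log P` are
both at most `c₁n`. Rows of large `ℓ¹` norm and glued rows are discarded. -/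

lemma orderStat_nonneg (k : ℕ) : 0 ≤ orderStat x k :=
  Real.sInf_nonneg fun _ h => h.1

lemma orderStat_le {k : ℕ} {t : ℝ} (ht : 0 ≤ t)
    (h : {i : Fin n | t < ‖x i‖}.ncard ≤ k - 1) : orderStat x k ≤ t :=
  csInf_le ⟨0, fun _ h => h.1⟩ ⟨ht, h⟩

/-- The infimum is attained: a feasible `t` below the smallest coordinate exceeding `orderStat x k`
already counts all coordinates exceeding it. -/
lemma ncard_orderStat_lt_le (k : ℕ) : {i : Fin n | orderStat x k < ‖x i‖}.ncard ≤ k - 1 := by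
  set a := orderStat x k with ha
  by_cases hS : (Finset.univ.filter fun i : Fin n => a < ‖x i‖).Nonempty
  · obtain ⟨i₀, hi₀, hmin⟩ := Finset.exists_min_image _ (fun i => ‖x i‖) hS
    have hi₀' : a < ‖x i₀‖ := (Finset.mem_filter.1 hi₀).2
    have hne : {t : ℝ | 0 ≤ t ∧ {i : Fin n | t < ‖x i‖}.ncard ≤ k - 1}.Nonempty := by
      refine ⟨‖x‖, norm_nonneg _, ?_⟩
      have : {i : Fin n | ‖x‖ < ‖x i‖} = ∅ := by
        ext i
        simpa using norm_le_pi_norm x i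
      simp [this]
    obtain ⟨t, ht, hta⟩ := exists_lt_of_csInf_lt hne hi₀'
    refine le_trans (Set.ncard_le_ncard ?_ (Set.toFinite _)) ht.2
    intro i hi
    exact lt_of_lt_of_le hta (hmin i (by simpa using hi))
  · have : {i : Fin n | a < ‖x i‖} = ∅ := by
      ext i
      simp only [Finset.not_nonempty_iff_eq_empty, Finset.filter_eq_empty_iff] at hS
      simpa using hS (Finset.mem_univ i)
    simp [this]

lemma le_orderStat {k : ℕ} {t : ℝ} (hk : k - 1 < {i : Fin n | t ≤ ‖x i‖}.ncard) :
    t ≤ orderStat x k := by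
  by_contra! h
  have h₁ := ncard_orderStat_lt_le x k
  have h₂ : {i : Fin n | t ≤ ‖x i‖}.ncard ≤ {i : Fin n | orderStat x k < ‖x i‖}.ncard :=
    Set.ncard_le_ncard (fun i hi => lt_of_lt_of_le h hi) (Set.toFinite _)
  omega

lemma orderStat_anti {k l : ℕ} (h : k ≤ l) : orderStat x l ≤ orderStat x k :=
  orderStat_le x (orderStat_nonneg x k) ((ncard_orderStat_lt_le x k).trans (by omega))

lemma orderStat_smul_le {c : ℝ} (hc : 0 < c) (k : ℕ) :
    orderStat ((c : ℂ) • x) k ≤ c * orderStat x k := by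
  refine orderStat_le _ (mul_nonneg hc.le (orderStat_nonneg x k)) ?_
  refine le_trans (le_of_eq ?_) (ncard_orderStat_lt_le x k)
  congr 1
  ext i
  simp [abs_of_pos hc, hc]

lemma orderStat_smul {c : ℝ} (hc : 0 < c) (k : ℕ) :
    orderStat ((c : ℂ) • x) k = c * orderStat x k := by
  refine le_antisymm (orderStat_smul_le x hc k) ?_
  have h := orderStat_smul_le ((c : ℂ) • x) (inv_pos.2 hc) k
  have hc' : (c : ℂ) ≠ 0 := by exact_mod_cast hc.ne'
  rw [smul_smul, Complex.ofReal_inv, inv_mul_cancel₀ hc', one_smul] at h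
  calc c * orderStat x k ≤ c * (c⁻¹ * orderStat ((c : ℂ) • x) k) := by gcongr
    _ = orderStat ((c : ℂ) • x) k := by field_simp

/-- There are nested sets of largest coordinates. -/
lemma exists_top_sets : ∃ s : ℕ → Finset (Fin n), Monotone s ∧ (∀ k ≤ n, (s k).card = k) ∧
    (∀ k, ∀ j ∈ s k, orderStat x k ≤ ‖x j‖) ∧ ∀ k, ∀ j ∉ s k, ‖x j‖ ≤ orderStat x k := by
  set σ := Tuple.sort (fun i => -‖x i‖) with hσ
  have hmono : ∀ a b : Fin n, a ≤ b → ‖x (σ b)‖ ≤ ‖x (σ a)‖ := by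
    intro a b hab
    have := Tuple.monotone_sort (fun i => -‖x i‖) hab
    simpa using this
  have hmono' : ∀ i j : Fin n, ‖x i‖ < ‖x j‖ → σ.symm j < σ.symm i := by
    intro i j hij
    by_contra! h
    have := hmono _ _ h
    simp only [Equiv.apply_symm_apply] at this
    linarith
  have hcard : ∀ k ≤ n, (Finset.univ.filter fun j : Fin n => (σ.symm j : ℕ) < k).card = k := by
    intro k hk
    have h₁ : (Finset.univ.filter fun j : Fin n => (σ.symm j : ℕ) < k).card
        = (Finset.univ.filter fun j : Fin n => (j : ℕ) < k).card := by
      refine Finset.card_bij (fun a _ => σ.symm a) ?_ ?_ ?_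
      · intro a ha
        simpa using ha
      · intro a _ b _ h
        exact σ.symm.injective h
      · intro b hb
        exact ⟨σ b, by simpa using hb, by simp⟩
    rw [h₁, Fin.card_filter_val_lt]
    exact min_eq_right hk
  refine ⟨fun k => Finset.univ.filter fun j => (σ.symm j : ℕ) < k, ?_, hcard, ?_, ?_⟩
  · intro k l hkl j hj
    simp only [Finset.mem_filter, Finset.mem_univ, true_and] at hj ⊢
    omega
  · intro k j hj
    simp only [Finset.mem_filter, Finset.mem_univ, true_and] at hj
    refine orderStat_le x (norm_nonneg _) ?_
    have h₁ : {i : Fin n | ‖x j‖ < ‖x i‖}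
        ⊆ (Finset.univ.filter fun i : Fin n => (σ.symm i : ℕ) < (σ.symm j : ℕ) : Finset (Fin n)) := by
      intro i hi
      simpa using hmono' j i hi
    have h₂ := Set.ncard_le_ncard h₁ (Set.toFinite _)
    rw [Set.ncard_coe_finset, hcard _ (σ.symm j).2.le] at h₂
    omega
  · intro k j hj
    simp only [Finset.mem_filter, Finset.mem_univ, true_and, not_lt] at hj
    refine le_orderStat x ?_
    have h₁ : ((Finset.univ.filter fun i : Fin n => (σ.symm i : ℕ) < (σ.symm j : ℕ) + 1 :
        Finset (Fin n)) : Set (Fin n)) ⊆ {i : Fin n | ‖x j‖ ≤ ‖x i‖} := by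
      intro i hi
      simp only [Finset.coe_filter, Finset.mem_univ, true_and, Set.mem_ofPred_eq] at hi ⊢
      by_contra! h
      have := hmono' i j h
      have : (σ.symm j : ℕ) < σ.symm i := this
      omega
    have h₂ := Set.ncard_le_ncard h₁ (Set.toFinite _)
    rw [Set.ncard_coe_finset, hcard _ (σ.symm j).2] at h₂
    omega

lemma le_ncard_orderStat_le {k : ℕ} (hk : k ≤ n) :
    k ≤ {i : Fin n | orderStat x k ≤ ‖x i‖}.ncard := by
  obtain ⟨s, -, hcard, htop, -⟩ := exists_top_sets x
  have h : ((s k : Finset (Fin n)) : Set (Fin n)) ⊆ {i : Fin n | orderStat x k ≤ ‖x i‖} :=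
    fun j hj => htop k j hj
  have := Set.ncard_le_ncard h (Set.toFinite _)
  rwa [Set.ncard_coe_finset, hcard k hk] at this

end OrderStat

namespace BiDigraph

/-! ### Types of right vertices -/

section Types

variable {L R : Type*} (G : BiDigraph L R)

lemma inNbr_mono {I J : Set R} (h : I ⊆ J) : G.inNbr I ⊆ G.inNbr J :=
  fun _ ⟨j, hj, hij⟩ => ⟨j, h hj, hij⟩

lemma typeUpTo_monotone (K : ℝ) : Monotone (G.typeUpTo K) :=
  monotone_nat_of_le_succ fun _ => Set.subset_union_left

lemma exists_typeUpTo_eq_finType [Finite R] (K : ℝ) :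
    ∃ ℓ, G.typeUpTo K ℓ = G.finType K := by
  obtain ⟨ℓ, hℓ⟩ := WellFoundedGT.monotone_chain_condition
    (⟨G.typeUpTo K, G.typeUpTo_monotone K⟩ : ℕ →o Set R)
  refine ⟨ℓ, Set.Subset.antisymm (Set.subset_iUnion (G.typeUpTo K) ℓ) ?_⟩
  refine Set.iUnion_subset fun k => ?_
  rcases le_total k ℓ with h | h
  · exact G.typeUpTo_monotone K h
  · exact (hℓ k h).ge

/-- The types stabilise on a finite vertex set, so a vertex with at most `K` remaining
out-neighbours relative to the stable set would join at the next level. -/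
lemma lt_ncard_of_notMem_finType [Finite R] {K : ℝ} {j : R} (hj : j ∉ G.finType K) :
    K < (G.outNbr j \ G.inNbr (G.finType K)).ncard := by
  obtain ⟨ℓ, hℓ⟩ := G.exists_typeUpTo_eq_finType K
  by_contra! h
  refine hj (Set.mem_iUnion.2 ⟨ℓ + 1, Or.inr ?_⟩)
  rw [← hℓ] at h
  exact h

lemma typeUpTo_subset_of_le [Finite L] {K K' : ℝ} (h : K ≤ K') (ℓ : ℕ) :
    G.typeUpTo K ℓ ⊆ G.typeUpTo K' ℓ := by
  induction ℓ with
  | zero => exact Set.Subset.rfl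
  | succ ℓ ih =>
    refine Set.union_subset_union ih fun j hj => ?_
    refine le_trans ?_ (le_trans hj h)
    exact_mod_cast Set.ncard_le_ncard (Set.sdiff_subset_sdiff_right (G.inNbr_mono ih))
      (Set.toFinite _)

lemma finType_mono [Finite L] {K K' : ℝ} (h : K ≤ K') : G.finType K ⊆ G.finType K' :=
  Set.iUnion_mono fun ℓ => G.typeUpTo_subset_of_le h ℓ

lemma glue_id : G.glue id = G := by
  cases G
  simp [glue]

end Types

lemma admissible_id {n : ℕ} (G : BiDigraph (Fin n) (Fin n)) (K : ℝ) :
    G.Admissible K (id : Fin n → Fin n) :=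
  ⟨Function.surjective_id, fun i => by simp, fun i₁ i₂ h h' => absurd h' h⟩

/-! ### Unique neighbours -/

/-- If the left neighbourhood of `J` is almost as large as the number of edges into `J`, then many
left vertices are adjacent to a single element of `J`. -/
lemma exists_unique_rows {L R : Type*} [Fintype L] [Fintype R] (G : BiDigraph L R) (X : Set L)
    {I J : Finset R} (hIJ : I ⊆ J) {d e : ℝ}
    (hJ : ∑ j ∈ J, ((G.inNbr {j}).ncard : ℝ) - e ≤ ((G.inNbr (J : Set R)).ncard : ℝ))
    (hI : ∀ j ∈ I, d ≤ ((G.outNbr j \ X).ncard : ℝ)) :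
    ∃ S : Finset L, d * I.card - 2 * e ≤ (S.card : ℝ) ∧
      ∀ i ∈ S, i ∉ X ∧ ∃ j ∈ I, i ∈ G.outNbr j ∧ ∀ j' ∈ J, G.toRight i j' → j' = j := by
  classical
  set N : L → ℕ := fun i => (J.filter fun j => G.toRight i j).card with hN
  set M : L → ℕ := fun i => (I.filter fun j => G.toLeft i j ∧ i ∉ X).card with hM
  have hMN : ∀ i, M i ≤ N i := by
    intro i
    refine Finset.card_le_card fun j hj => ?_
    simp only [Finset.mem_filter] at hj ⊢
    exact ⟨hIJ hj.1, G.toRight_of_toLeft _ _ hj.2.1⟩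
  have hN_sum : ∑ j ∈ J, ((G.inNbr {j}).ncard : ℝ) = ∑ i, (N i : ℝ) := by
    have h₁ : ∀ j, (G.inNbr {j}).ncard = (Finset.univ.filter fun i => G.toRight i j).card := by
      intro j
      rw [← Set.ncard_coe_finset]
      congr 1
      ext i
      simp [inNbr]
    simp only [h₁, hN]
    have := Finset.sum_card_bipartiteAbove_eq_sum_card_bipartiteBelow (s := Finset.univ) (t := J)
      (fun i j => G.toRight i j)
    simp only [Finset.bipartiteAbove, Finset.bipartiteBelow] at this
    exact_mod_cast this.symm
  have hM_sum : ∑ j ∈ I, ((G.outNbr j \ X).ncard : ℝ) = ∑ i, (M i : ℝ) := by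
    have h₁ : ∀ j, (G.outNbr j \ X).ncard
        = (Finset.univ.filter fun i => G.toLeft i j ∧ i ∉ X).card := by
      intro j
      rw [← Set.ncard_coe_finset]
      congr 1
      ext i
      simp [outNbr]
    simp only [h₁, hM]
    have := Finset.sum_card_bipartiteAbove_eq_sum_card_bipartiteBelow (s := Finset.univ) (t := I)
      (fun i j => G.toLeft i j ∧ i ∉ X)
    simp only [Finset.bipartiteAbove, Finset.bipartiteBelow] at this
    exact_mod_cast this.symm
  have hJ_card : ((G.inNbr (J : Set R)).ncard : ℝ) = ∑ i, if 1 ≤ N i then (1 : ℝ) else 0 := by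
    have h₁ : G.inNbr (J : Set R) = (Finset.univ.filter fun i => 1 ≤ N i : Finset L) := by
      ext i
      simp [inNbr, hN, Nat.one_le_iff_ne_zero]
    rw [h₁, Set.ncard_coe_finset]
    simp
  refine ⟨Finset.univ.filter fun i => N i = 1 ∧ 1 ≤ M i, ?_, ?_⟩
  -- Rows met at least twice are paid for by the overcount `N - 1`, since `M ≤ N ≤ 2(N - 1)` when `N
  -- ≥ 2`. The total overcount is at most `e`, whence the loss `2e`.
  · have h₁ : ∀ i, (M i : ℝ) ≤ (if N i = 1 ∧ 1 ≤ M i then (1 : ℝ) else 0)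
        + 2 * ((N i : ℝ) - if 1 ≤ N i then (1 : ℝ) else 0) := by
      intro i
      have h := hMN i
      rcases Nat.lt_or_ge (N i) 2 with h2 | h2
      · interval_cases hNi : N i
        · have : M i = 0 := by omega
          simp [this]
        · rcases Nat.eq_zero_or_pos (M i) with h0 | h0
          · simp [h0]
          · have : M i = 1 := by omega
            simp [this]
      · have h3 : N i ≠ 1 := by omega
        have h4 : 1 ≤ N i := by omega
        have h5 : (M i : ℝ) ≤ N i := by exact_mod_cast h
        have h6 : (2 : ℝ) ≤ N i := by exact_mod_cast h2
        simp only [h3, h4, false_and, if_true, if_false]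
        linarith
    have h₂ := Finset.sum_le_sum fun i (_ : i ∈ Finset.univ) => h₁ i
    rw [Finset.sum_add_distrib, ← Finset.mul_sum, Finset.sum_sub_distrib, ← hJ_card, ← hN_sum,
      ← hM_sum, Finset.sum_boole] at h₂
    have h₃ : d * I.card ≤ ∑ j ∈ I, ((G.outNbr j \ X).ncard : ℝ) := by
      calc d * I.card = ∑ j ∈ I, d := by simp [mul_comm]
        _ ≤ _ := Finset.sum_le_sum hI
    linarith
  · intro i hi
    simp only [Finset.mem_filter, Finset.mem_univ, true_and] at hi
    obtain ⟨hi₁, hi₂⟩ := hi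
    obtain ⟨j, hj⟩ := Finset.card_pos.1 hi₂
    simp only [Finset.mem_filter] at hj
    refine ⟨hj.2.2, j, hj.1, hj.2.1, fun j' hj' h' => ?_⟩
    exact Finset.card_le_one.1 hi₁.le j' (Finset.mem_filter.2 ⟨hj', h'⟩) j
      (Finset.mem_filter.2 ⟨hIJ hj.1, G.toRight_of_toLeft _ _ hj.2.1⟩)

/-! ### Propagation of large coordinates -/

/-- Following balanced rows through the diagonal, one arrives at a vertex of infinite type. -/
lemma exists_notMem_finType_of_chains {n : ℕ} (G : BiDigraph (Fin n) (Fin n)) {K : ℝ}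
    {w : Fin n → ℝ} {D w₀ : ℝ} (hD : 1 ≤ D) (hw₀ : 0 < w₀) {N : ℕ}
    (hrow : ∀ i j, i ∈ G.outNbr j → w₀ ≤ D ^ N * w j →
      ∃ j', j' ≠ j ∧ G.toRight i j' ∧ w j ≤ D * w j')
    (hdiag : ∀ j, j ∈ G.outNbr j)
    (hcyc : ∀ (k : ℕ) (j : Fin k → Fin n), G.IsChain id j → IsCyclic j →
      ¬ G.SelfBalancing K id j)
    (hlen : ∀ j : Fin N → Fin n, G.IsChain id j → Function.Injective j →
      ¬ G.SelfBalancing K id j)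
    {j₀ : Fin n} (hj₀ : w₀ ≤ w j₀) : ∃ j, j ∉ G.finType K ∧ w₀ ≤ D ^ N * w j := by
  classical
  by_contra! hcon
  have hpos : ∀ {k : ℕ} {j}, w₀ ≤ D ^ k * w j → 0 < w j := by
    intro k j h
    have : 0 < D ^ k := by positivity
    exact pos_of_mul_pos_right (hw₀.trans_le h) this.le
  have hmono : ∀ {k l : ℕ} {j}, k ≤ l → w₀ ≤ D ^ k * w j → w₀ ≤ D ^ l * w j := by
    intro k l j hkl h
    exact h.trans (mul_le_mul_of_nonneg_right (pow_le_pow_right₀ hD hkl) (hpos h).le)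
  have hstep : ∀ v, ∃ v', w₀ ≤ D ^ N * w v → v' ≠ v ∧ G.toRight v v' ∧ w v ≤ D * w v' := by
    intro v
    by_cases h : w₀ ≤ D ^ N * w v
    · obtain ⟨v', hv'⟩ := hrow v v (hdiag v) h
      exact ⟨v', fun _ => hv'⟩
    · exact ⟨v, fun h' => absurd h' h⟩
  choose f hf using hstep
  set s : ℕ → Fin n := fun a => f^[a] j₀ with hs
  have hs_succ : ∀ a, s (a + 1) = f (s a) := fun a => Function.iterate_succ_apply' f a j₀
  have hsw : ∀ a ≤ N, w₀ ≤ D ^ a * w (s a) := by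
    intro a
    induction a with
    | zero => intro _; simpa [hs] using hj₀
    | succ a ih =>
      intro ha
      have h₁ := ih (by omega)
      have h₂ := (hf (s a) (hmono (by omega) h₁)).2.2
      rw [hs_succ, pow_succ, mul_assoc]
      exact h₁.trans (mul_le_mul_of_nonneg_left h₂ (by positivity))
  -- Self-balance uses every out-neighbour, not just the diagonal one: each contains a second
  -- coordinate, one factor `D` smaller, which is still within the range where `hcon` forces finite
  -- type.
  have hbal : ∀ a < N, s a ∈ G.finType K ∧ G.outNbr (s a) ⊆ G.inNbr (G.finType K \ {s a}) := by
    intro a ha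
    have h₁ := hsw a ha.le
    have hF : ∀ j, w₀ ≤ D ^ N * w j → j ∈ G.finType K := by
      intro j hj
      by_contra h
      exact absurd hj (not_le.2 (hcon j h))
    refine ⟨hF _ (hmono ha.le h₁), fun i hi => ?_⟩
    obtain ⟨j', hj', hij', hw⟩ := hrow i (s a) hi (hmono ha.le h₁)
    refine ⟨j', ⟨hF j' (hmono (show a + 1 ≤ N from ha) ?_), hj'⟩, hij'⟩
    rw [pow_succ, mul_assoc]
    exact h₁.trans (mul_le_mul_of_nonneg_left hw (by positivity))
  have hsb : ∀ k ≤ N, G.SelfBalancing K id (fun a : Fin k => s a) := by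
    intro k hk a
    rw [glue_id]
    have := hbal a (by omega)
    exact ⟨fun h => h this.1, this.2⟩
  have hne : ∀ a < N, s (a + 1) ≠ s a ∧ G.toRight (s a) (s (a + 1)) := by
    intro a ha
    have := hf (s a) (hmono ha.le (hsw a ha.le))
    rw [hs_succ]
    exact ⟨this.1, this.2.1⟩
  have hchain : ∀ k ≤ N, G.IsChain id (fun a : Fin k => s a) := by
    intro k hk a b hab
    rw [glue_id]
    have := hne a (by omega)
    simp only [hab]
    exact ⟨this.1.symm, this.2⟩
  -- The first repetition closes a cyclic chain. Consecutive members differ, which supplies the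
  -- requirement `u < k - 1` of `IsCyclic`.
  have hinj : ∀ k ≤ N, ∀ a b, a < b → b < k → s a ≠ s b := by
    intro k
    induction k with
    | zero => intro _ a b _ hb; omega
    | succ k ih =>
      intro hk a b hab hb heq
      have ih' := ih (by omega)
      rcases Nat.lt_or_ge b k with hbk | hbk
      · exact ih' a b hab hbk heq
      · obtain rfl : b = k := by omega
        have ha : a + 1 < b := by
          by_contra h
          obtain rfl : b = a + 1 := by omega
          exact (hne a (by omega)).1 heq.symm
        refine hcyc (b + 1) (fun a : Fin (b + 1) => s a) (hchain _ hk) ⟨?_, ?_⟩ (hsb _ hk)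
        · intro c d hc hd hcd
          by_contra hne'
          rcases lt_or_gt_of_ne (fun h => hne' (Fin.ext h)) with h | h
          · exact ih' c d h (by omega) hcd
          · exact ih' d c h (by omega) hcd.symm
        · exact ⟨⟨a, by omega⟩, ⟨b, by omega⟩, by simp; omega, by simp, heq.symm⟩
  refine hlen (fun a : Fin N => s a) (hchain N le_rfl) ?_ (hsb N le_rfl)
  intro a b hab
  by_contra hne'
  rcases lt_or_gt_of_ne (fun h => hne' (Fin.ext h)) with h | h
  · exact hinj N le_rfl a b h b.2 hab
  · exact hinj N le_rfl b a h a.2 hab.symm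

/-- Expansion makes the number of large coordinates of infinite type grow geometrically. -/
lemma lt_card_of_expansion {n : ℕ} (G : BiDigraph (Fin n) (Fin n)) {K : ℝ}
    {w : Fin n → ℝ} {D w₀ e q : ℝ} (hD : 1 ≤ D) (hw₀ : 0 < w₀) (he : 0 < e) (hKe : 16 * e ≤ K)
    {a N : ℕ} (haN : n < 4 ^ N)
    (hrow : ∀ i j, i ∈ G.outNbr j → w₀ ≤ D ^ (a + N) * w j →
      ∃ j', j' ≠ j ∧ G.toRight i j' ∧ w j ≤ D * w j')
    (hexp : ∀ J : Finset (Fin n), J.Nonempty → (J.card : ℝ) ≤ q →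
      ∑ j ∈ J, ((G.inNbr {j}).ncard : ℝ) - e * J.card ≤ ((G.inNbr (J : Set (Fin n))).ncard : ℝ))
    {j₀ : Fin n} (hj₀ : j₀ ∉ G.finType K) (hwj₀ : w₀ ≤ D ^ a * w j₀) :
    q < {j | w₀ ≤ D ^ (a + N) * w j}.ncard := by
  classical
  set I : ℕ → Finset (Fin n) := fun t =>
    Finset.univ.filter fun j => j ∉ G.finType K ∧ w₀ ≤ D ^ (a + t) * w j with hI
  have hpos : ∀ {k : ℕ} {j}, w₀ ≤ D ^ k * w j → 0 < w j := by
    intro k j h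
    have : 0 < D ^ k := by positivity
    exact pos_of_mul_pos_right (hw₀.trans_le h) this.le
  have hmono : ∀ {k l : ℕ} {j}, k ≤ l → w₀ ≤ D ^ k * w j → w₀ ≤ D ^ l * w j := by
    intro k l j hkl h
    exact h.trans (mul_le_mul_of_nonneg_right (pow_le_pow_right₀ hD hkl) (hpos h).le)
  have hI_mono : ∀ t, I t ⊆ I (t + 1) := by
    intro t j hj
    simp only [hI, Finset.mem_filter, Finset.mem_univ, true_and] at hj ⊢
    exact ⟨hj.1, hmono (by omega) hj.2⟩
  -- If `I (t+1)` were at most `q` and at most four times `I t`, the number of rows starting at `I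
  -- t` and meeting `I (t+1)` once would be at least `16e|I t| - 2e·4|I t| > 0`. Balance in such a
  -- row yields a second coordinate, of infinite type because the row avoids the finite types, hence
  -- a second element of `I (t+1)`.
  have hmain : ∀ t ≤ N, q < (I t).card ∨ 4 ^ t ≤ (I t).card := by
    intro t
    induction t with
    | zero =>
      intro _
      right
      exact Finset.card_pos.2 ⟨j₀, by simp [hI, hj₀, hwj₀]⟩
    | succ t ih =>
      intro ht
      have hle : ((I t).card : ℝ) ≤ (I (t + 1)).card := by
        exact_mod_cast Finset.card_le_card (hI_mono t)
      rcases ih (by omega) with h | h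
      · exact Or.inl (h.trans_le hle)
      · by_contra! hcon
        have hpos_t : 0 < (I t).card := lt_of_lt_of_le (by positivity) h
        have h4 : ((I (t + 1)).card : ℝ) ≤ 4 * (I t).card := by
          have : (I (t + 1)).card ≤ 4 * (I t).card := by
            have := hcon.2
            rw [pow_succ] at this
            omega
          exact_mod_cast this
        obtain ⟨S, hS, hS'⟩ := G.exists_unique_rows (G.inNbr (G.finType K)) (hI_mono t)
          (hexp (I (t + 1)) ((Finset.card_pos.1 hpos_t).mono (hI_mono t)) hcon.1)
          (d := K) (fun j hj => (G.lt_ncard_of_notMem_finType (by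
            simp only [hI, Finset.mem_filter] at hj
            exact hj.2.1)).le)
        have hSpos : 0 < S.card := by
          have h₀ : (0 : ℝ) < (I t).card := by exact_mod_cast hpos_t
          have h₁ : 16 * e * (I t).card ≤ K * (I t).card := by gcongr
          have h₂ : e * (I (t + 1)).card ≤ e * (4 * (I t).card) := by gcongr
          have : (0 : ℝ) < S.card := by nlinarith [mul_pos he h₀]
          exact_mod_cast this
        obtain ⟨i, hi⟩ := Finset.card_pos.1 hSpos
        obtain ⟨hiX, j, hj, hij, huniq⟩ := hS' i hi
        have hj' := (Finset.mem_filter.1 hj).2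
        obtain ⟨j', hne, hij', hw⟩ := hrow i j hij (hmono (by omega) hj'.2)
        refine hne (huniq j' ?_ hij')
        refine Finset.mem_filter.2 ⟨Finset.mem_univ _, fun hF => hiX ⟨j', hF, hij'⟩, ?_⟩
        rw [← add_assoc, pow_succ, mul_assoc]
        exact hj'.2.trans (mul_le_mul_of_nonneg_left hw (by positivity))
  have hN := hmain N le_rfl
  have hcard : (I N).card ≤ n := by
    simpa using Finset.card_le_univ (I N)
  have h₁ : q < (I N).card := by
    rcases hN with h | h
    · exact h
    · omega
  refine h₁.trans_le ?_
  rw [← Set.ncard_coe_finset]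
  refine Nat.cast_le.2 (Set.ncard_le_ncard (fun j hj => ?_) (Set.toFinite _))
  simp only [hI, Finset.coe_filter, Finset.mem_univ, true_and, Set.mem_ofPred_eq] at hj
  exact hj.2

end BiDigraph

/-! ### Numerical consequences of the sparsity assumption -/

/-- With `q = n^{1/8}` the range reads `C ≤ pn` and `p ≤ q⁻⁷`, so `C ≤ pn ≤ q`; a large constant in
the sparsity range thereby makes `n` and `1/p` large as well. -/
lemma SparsityRange.bounds {C p : ℝ} {n : ℕ} (h : SparsityRange C n p) (hC : 2 ≤ C) :
    C ≤ p * n ∧ p * n ≤ (n : ℝ) ^ (1 / 8 : ℝ) ∧ C ^ 8 ≤ n ∧ C ^ 7 ≤ p⁻¹ ∧ 0 < p ∧ p ≤ 1 / 2 := by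
  obtain ⟨hn, h₁, h₂⟩ := h
  have hn' : (0 : ℝ) < n := by exact_mod_cast hn
  have hCP : C ≤ p * n := (div_le_iff₀ hn').1 h₁
  have hp : 0 < p := lt_of_lt_of_le (by positivity) h₁
  set q : ℝ := (n : ℝ) ^ (1 / 8 : ℝ) with hq
  have hq0 : 0 < q := by positivity
  have hq8 : q ^ 8 = n := by
    rw [hq, ← Real.rpow_natCast, ← Real.rpow_mul hn'.le]
    norm_num
  have hq7 : (n : ℝ) ^ (-(7 / 8) : ℝ) = (q ^ 7)⁻¹ := by
    rw [hq, ← Real.rpow_natCast, ← Real.rpow_mul hn'.le, ← Real.rpow_neg hn'.le]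
    norm_num
  rw [hq7] at h₂
  have hPq : p * n ≤ q := by
    calc p * n ≤ (q ^ 7)⁻¹ * q ^ 8 := by rw [hq8]; gcongr
      _ = q := by field_simp
  have hCq : C ≤ q := hCP.trans hPq
  have hC7 : C ^ 7 ≤ p⁻¹ := by
    calc C ^ 7 ≤ q ^ 7 := by gcongr
      _ ≤ p⁻¹ := by rw [le_inv_comm₀ (by positivity) hp]; exact h₂
  refine ⟨hCP, hPq, ?_, hC7, hp, ?_⟩
  · rw [← hq8]; gcongr
  · have h2 : (2 : ℝ) ≤ p⁻¹ := by
      calc (2 : ℝ) ≤ 2 ^ 7 := by norm_num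
        _ ≤ C ^ 7 := by gcongr
        _ ≤ p⁻¹ := hC7
    rw [le_inv_comm₀ (by norm_num) hp] at h2
    linarith

/-! ### Balanced rows -/

section Rows

variable {n : ℕ} {α : ℝ} {B : Matrix (Fin n) (Fin n) ℂ} {x : Fin n → ℂ}

/-- Isolate the term `B i j * x j` in row `i`. The truncation `max s 0` is there because `hs` can
hold vacuously with `s` negative. -/
lemma norm_div_le_of_row {i j : Fin n} (hij : 1 / α ≤ ‖B i j‖) {s : ℝ}
    (hs : ∀ j', j' ≠ j → B i j' ≠ 0 → ‖x j'‖ ≤ s) :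
    ‖x j‖ / α ≤ ‖(B *ᵥ x) i‖ + (∑ j', ‖B i j'‖) * max s 0 := by
  classical
  have h₁ : (B *ᵥ x) i = B i j * x j + ∑ j' ∈ Finset.univ.erase j, B i j' * x j' := by
    rw [Finset.add_sum_erase _ (fun j' => B i j' * x j') (Finset.mem_univ j)]
    rfl
  have h₂ : ‖∑ j' ∈ Finset.univ.erase j, B i j' * x j'‖ ≤ (∑ j', ‖B i j'‖) * max s 0 := by
    calc ‖∑ j' ∈ Finset.univ.erase j, B i j' * x j'‖
        ≤ ∑ j' ∈ Finset.univ.erase j, ‖B i j'‖ * max s 0 := by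
          refine norm_sum_le_of_le _ fun j' hj' => ?_
          rw [norm_mul]
          by_cases h0 : B i j' = 0
          · simp [h0]
          · exact mul_le_mul_of_nonneg_left
              ((hs j' (Finset.ne_of_mem_erase hj') h0).trans (le_max_left _ _)) (norm_nonneg _)
      _ = (∑ j' ∈ Finset.univ.erase j, ‖B i j'‖) * max s 0 := by rw [Finset.sum_mul]
      _ ≤ (∑ j', ‖B i j'‖) * max s 0 := by
          refine mul_le_mul_of_nonneg_right ?_ (le_max_right _ _)
          exact Finset.sum_le_sum_of_subset_of_nonneg (Finset.erase_subset _ _)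
            fun _ _ _ => norm_nonneg _
  have h₃ : ‖x j‖ / α ≤ ‖B i j * x j‖ := by
    rw [norm_mul, div_eq_mul_one_div, mul_comm]
    gcongr
  have h₄ : B i j * x j = (B *ᵥ x) i - ∑ j' ∈ Finset.univ.erase j, B i j' * x j' := by
    rw [h₁]; ring
  calc ‖x j‖ / α ≤ ‖B i j * x j‖ := h₃
    _ ≤ ‖(B *ᵥ x) i‖ + ‖∑ j' ∈ Finset.univ.erase j, B i j' * x j'‖ := by
        rw [h₄]; exact norm_sub_le _ _
    _ ≤ _ := by gcongr

/-- Otherwise the image and the remaining coordinates would each account for at most half of `‖x j‖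
/ α`, the image strictly less. -/
lemma exists_comparable_of_row (hα : 0 < α) {D : ℝ} (hD : 1 ≤ D) {i j : Fin n}
    (hij : 1 / α ≤ ‖B i j‖) (hrow : 2 * α * ∑ j', ‖B i j'‖ ≤ D)
    (hsmall : 2 * α * ‖(B *ᵥ x) i‖ < ‖x j‖) :
    ∃ j', j' ≠ j ∧ B i j' ≠ 0 ∧ ‖x j‖ ≤ D * ‖x j'‖ := by
  by_contra! h
  have hD0 : 0 < D := by linarith
  have h₁ := norm_div_le_of_row (x := x) hij (s := ‖x j‖ / D) fun j' hj' h0 => by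
    rw [le_div_iff₀ hD0, mul_comm]
    exact (h j' hj' h0).le
  rw [max_eq_left (by positivity), div_le_iff₀ hα] at h₁
  have h₂ : (∑ j', ‖B i j'‖) * (‖x j‖ / D) * (2 * α) ≤ ‖x j‖ := by
    calc (∑ j', ‖B i j'‖) * (‖x j‖ / D) * (2 * α)
        = (2 * α * ∑ j', ‖B i j'‖) * (‖x j‖ / D) := by ring
      _ ≤ D * (‖x j‖ / D) := by gcongr
      _ = ‖x j‖ := by field_simp
  linarith

end Rows

/-! ### Deterministic propagation on the good event -/

/-- The coercion to `ℕ` plays the role of the identity compression, as compressions take values in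
`ℕ`. -/
lemma compressNorm_val {n : ℕ} (B : Matrix (Fin n) (Fin n) ℂ) (x : Fin n → ℂ) :
    compressNorm (fun i : Fin n => (i : ℕ)) B x = ‖WithLp.toLp 2 (B *ᵥ x)‖ := by
  rw [EuclideanSpace.norm_eq, compressNorm]
  congr 1
  rw [Finset.sum_image (fun a _ b _ h => Fin.ext h)]
  refine Finset.sum_congr rfl fun i _ => ?_
  congr 2
  simp only [Matrix.mulVec, compress, dotProduct]
  refine Finset.sum_congr rfl fun j _ => ?_
  congr 1
  have : (Finset.univ.filter fun v : Fin n => (v : ℕ) = i) = {i} := by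
    ext v; simp [Fin.ext_iff]
  simp [this]

/-- On the almost proportional event, a vector with almost null image whose order statistic does
not drop around `m` has a large order statistic of almost proportional order. -/
lemma AlmostProportionalEvent.lt_orderStat {n m : ℕ} {p c c₁ c₂ : ℝ}
    {B : Matrix (Fin n) (Fin n) ℂ} (h : AlmostProportionalEvent p m c c₁ c₂ B) (hc : 0 ≤ c)
    {x : Fin n → ℂ} (hx : x ≠ 0)
    (hgap : Real.exp (-(c₁ * (p * n))) * orderStat x (m / 2) < orderStat x m)
    (hB : ‖WithLp.toLp 2 (B *ᵥ x)‖ ≤ c₂ * √n * orderStat x m) :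
    c / (p * n) * orderStat x m < orderStat x (spreadIndex c₁ n p) := by
  by_contra! hcon
  -- Apart from the normalisation all conditions are homogeneous in `x`, so the event is applied to
  -- `x / ‖x‖₂` with nothing glued.
  set y : EuclideanSpace ℂ (Fin n) := WithLp.toLp 2 x with hy
  have hy0 : 0 < ‖y‖ := norm_pos_iff.2 (by simpa [hy] using hx)
  have hs : 0 < ‖y‖⁻¹ := inv_pos.2 hy0
  have hφ : {i : Fin n | 2 ≤ {v : Fin n | (v : ℕ) = i}.ncard} = ∅ := by
    ext i
    have : {v : Fin n | (v : ℕ) = i} = {i} := by ext v; simp [Fin.ext_iff]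
    simp [this]
  have := h (fun i => (i : ℕ)) (by rw [hφ]; simp; positivity) (((‖y‖⁻¹ : ℝ) : ℂ) • x)
    (by
      rw [WithLp.toLp_smul, norm_smul, ← hy]
      simp [hy0.ne'])
    (by
      rw [orderStat_smul x hs, orderStat_smul x hs]
      calc _ = ‖y‖⁻¹ * (Real.exp (-(c₁ * (p * n))) * orderStat x (m / 2)) := by ring
        _ < _ := by gcongr)
    (by
      rw [orderStat_smul x hs, orderStat_smul x hs]
      calc _ ≤ ‖y‖⁻¹ * (c / (p * n) * orderStat x m) := by gcongr
        _ = _ := by ring)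
  rw [compressNorm_val, orderStat_smul x hs, Matrix.mulVec_smul, WithLp.toLp_smul, norm_smul] at this
  have h₁ : ‖((‖y‖⁻¹ : ℝ) : ℂ)‖ = ‖y‖⁻¹ := by simp
  rw [h₁] at this
  have h₂ : ‖y‖⁻¹ * ‖WithLp.toLp 2 (B *ᵥ x)‖ ≤ ‖y‖⁻¹ * (c₂ * √n * orderStat x m) := by gcongr
  linarith

/-- For singletons, which the event does not cover, the inequality holds trivially because the error
term is nonnegative. -/
lemma BiDigraph.ExpansionEvent.le_ncard {n : ℕ} {p ε cE : ℝ} {G : BiDigraph (Fin n) (Fin n)}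
    (h : G.ExpansionEvent p ε cE) (hε : 0 ≤ ε * (p * n)) {J : Finset (Fin n)} (hJ : J.Nonempty)
    (hcard : (J.card : ℝ) ≤ cE / p) :
    ∑ j ∈ J, ((G.inNbr {j}).ncard : ℝ) - ε * (p * n) * J.card
      ≤ ((G.inNbr (J : Set (Fin n))).ncard : ℝ) := by
  rcases Nat.lt_or_ge J.card 2 with h2 | h2
  · obtain ⟨j, rfl⟩ := Finset.card_eq_one.1 (show J.card = 1 by
      have := hJ.card_pos; omega)
    simpa using hε
  · exact h J h2 hcard

/-- A steep drop of the order statistics between `m / 2` and `m` forces many heavy rows. -/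
lemma exists_heavy_rows {n : ℕ} {α : ℝ} (hα : 0 < α) {B : Matrix (Fin n) (Fin n) ℂ}
    {x : Fin n → ℂ} {m : ℕ} (hm : 1 ≤ m) (hmn : m ≤ n) {K e E q : ℝ} (he : 0 ≤ e) (hKe : 16 * e ≤ K)
    (hexp : ∀ J : Finset (Fin n), J.Nonempty → (J.card : ℝ) ≤ q →
      ∑ j ∈ J, (((matrixGraph α B).inNbr {j}).ncard : ℝ) - e * J.card
        ≤ (((matrixGraph α B).inNbr (J : Set (Fin n))).ncard : ℝ))
    (hmq : (m : ℝ) ≤ q) (hE : 1 < E) (hx : 0 < orderStat x m)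
    (hF : (m : ℝ) / 4 ≤ (m / 2 : ℕ) - (((matrixGraph α B).finType K).ncard : ℝ))
    (hsmall : ∀ i, 2 * α * ‖(B *ᵥ x) i‖ ≤ orderStat x m)
    (hgap : E * orderStat x m ≤ orderStat x (m / 2)) :
    K * m / 8 ≤ {i | E / (2 * α) ≤ ∑ j, ‖B i j‖}.ncard := by
  classical
  set G := matrixGraph α B with hG
  set F := G.finType K with hFdef
  have hlt : orderStat x m < orderStat x (m / 2) := by nlinarith
  set I : Finset (Fin n) := Finset.univ.filter fun j => j ∉ F ∧ orderStat x (m / 2) ≤ ‖x j‖ with hI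
  set J : Finset (Fin n) := Finset.univ.filter fun j => j ∉ F ∧ orderStat x m < ‖x j‖ with hJ
  have hIJ : I ⊆ J := by
    intro j hj
    simp only [hI, hJ, Finset.mem_filter, Finset.mem_univ, true_and] at hj ⊢
    exact ⟨hj.1, hlt.trans_le hj.2⟩
  have hIcard : (m : ℝ) / 4 ≤ I.card := by
    have h₁ := le_ncard_orderStat_le x (show m / 2 ≤ n by omega)
    have h₂ : {i : Fin n | orderStat x (m / 2) ≤ ‖x i‖} ⊆ (I : Set (Fin n)) ∪ F := by
      intro j hj
      by_cases hjF : j ∈ F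
      · exact Or.inr hjF
      · exact Or.inl (by simpa [hI] using ⟨hjF, hj⟩)
    have h₃ := (Set.ncard_le_ncard h₂ (Set.toFinite _)).trans (Set.ncard_union_le _ _)
    rw [Set.ncard_coe_finset] at h₃
    have h₄ : ((m / 2 : ℕ) : ℝ) ≤ I.card + (F.ncard : ℝ) := by exact_mod_cast h₁.trans h₃
    linarith
  have hJcard : J.card ≤ m := by
    have h₁ := ncard_orderStat_lt_le x m
    have h₂ : (J : Set (Fin n)) ⊆ {i : Fin n | orderStat x m < ‖x i‖} := by
      intro j hj
      simp only [hJ, Finset.coe_filter, Finset.mem_univ, true_and, Set.mem_ofPred_eq] at hj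
      exact hj.2
    have h₃ := Set.ncard_le_ncard h₂ (Set.toFinite _)
    rw [Set.ncard_coe_finset] at h₃
    omega
  have hm0 : (0 : ℝ) < m := by exact_mod_cast hm
  have hIne : I.Nonempty := by
    refine Finset.card_pos.1 ?_
    have : (0 : ℝ) < I.card := by linarith
    exact_mod_cast this
  have hJm : (J.card : ℝ) ≤ m := by exact_mod_cast hJcard
  obtain ⟨S, hS, hS'⟩ := G.exists_unique_rows (G.inNbr F) hIJ
    (hexp J (hIne.mono hIJ) (hJm.trans hmq)) (d := K)
    (fun j hj => (G.lt_ncard_of_notMem_finType (by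
      simp only [hI, Finset.mem_filter] at hj
      exact hj.2.1)).le)
  -- `K|I| ≥ Km/4`, and the loss is `2e|J| ≤ 2em ≤ Km/8`.
  have hSK : K * m / 8 ≤ S.card := by
    have hK : 0 ≤ K := by linarith
    have h₁ : K * (m / 4) ≤ K * I.card := by gcongr
    have h₂ : e * J.card ≤ e * m := by gcongr
    have h₃ : 16 * e * m ≤ K * m := by gcongr
    linarith
  refine hSK.trans ?_
  rw [← Set.ncard_coe_finset]
  refine Nat.cast_le.2 (Set.ncard_le_ncard ?_ (Set.toFinite _))
  intro i hi
  obtain ⟨hiX, j, hj, hij, huniq⟩ := hS' i hi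
  simp only [hI, Finset.mem_filter, Finset.mem_univ, true_and] at hj
  -- Any other coordinate in this row is of infinite type, as the row avoids `F`, and lies outside
  -- `J`; so it is at most `x*_m`, and only a large row norm can balance `x j`.
  have h₁ := norm_div_le_of_row (x := x) hij.2 (s := orderStat x m) fun j' hj' h0 => by
    by_contra! hcon
    refine hj' (huniq j' ?_ h0)
    simp only [hJ, Finset.mem_filter, Finset.mem_univ, true_and]
    exact ⟨fun h => hiX ⟨j', h, h0⟩, hcon⟩
  rw [max_eq_left hx.le, div_le_iff₀ hα] at h₁
  have h₂ := hsmall i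
  change E / (2 * α) ≤ ∑ j, ‖B i j‖
  rw [div_le_iff₀ (by positivity)]
  have h₃ : E * orderStat x m ≤ ((∑ j, ‖B i j‖) * (2 * α)) * orderStat x m := by
    nlinarith
  exact le_of_mul_le_mul_right h₃ hx

lemma sum_norm_sub_smul_one_le {n : ℕ} (A : Matrix (Fin n) (Fin n) ℂ) (z : ℂ) (i : Fin n) :
    ∑ j, ‖(A - z • (1 : Matrix (Fin n) (Fin n) ℂ)) i j‖ ≤ (∑ j, ‖A i j‖) + ‖z‖ := by
  classical
  calc ∑ j, ‖(A - z • (1 : Matrix (Fin n) (Fin n) ℂ)) i j‖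
      ≤ ∑ j, (‖A i j‖ + if i = j then ‖z‖ else 0) := by
        refine Finset.sum_le_sum fun j _ => ?_
        rw [Matrix.sub_apply, Matrix.smul_apply, Matrix.one_apply]
        refine (norm_sub_le _ _).trans ?_
        gcongr
        split_ifs <;> simp
    _ = (∑ j, ‖A i j‖) + ‖z‖ := by simp [Finset.sum_add_distrib]

/-- At `r = n²` the permitted number of rows is `n^{1 - 1.8} < 1`, hence zero. -/
lemma EllOneEvent.sum_norm_lt {n : ℕ} {p : ℝ} {A : Matrix (Fin n) (Fin n) ℂ}
    (h : EllOneEvent p A) (hn : 2 ≤ n) (hp : p ≤ 1) (i : Fin n) :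
    ∑ j, ‖A i j‖ < (n : ℝ) ^ 2 * (p * n) := by
  have hn' : (2 : ℝ) ≤ n := by exact_mod_cast hn
  by_contra! hcon
  have h₁ := (h ((n : ℝ) ^ 2) (by nlinarith)).1
  have h₂ : 0 < {i : Fin n | (n : ℝ) ^ 2 * (p * n) ≤ ∑ j, ‖A i j‖}.ncard :=
    (Set.ncard_pos (Set.toFinite _)).2 ⟨i, hcon⟩
  have h₃ : (1 : ℝ) ≤ {i : Fin n | (n : ℝ) ^ 2 * (p * n) ≤ ∑ j, ‖A i j‖}.ncard := by
    exact_mod_cast h₂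
  have h₄ : (n : ℝ) < ((n : ℝ) ^ 2) ^ (0.9 : ℝ) := by
    rw [← Real.rpow_natCast, ← Real.rpow_mul (by positivity)]
    conv_lhs => rw [← Real.rpow_one (n : ℝ)]
    exact Real.rpow_lt_rpow_of_exponent_lt (by linarith) (by norm_num)
  have h₅ : (n : ℝ) / ((n : ℝ) ^ 2) ^ (0.9 : ℝ) < 1 := by
    rw [div_lt_one (by positivity)]; exact h₄
  linarith

/-- Each power of the loss factor `2 α n³` along `O(log n)` steps is absorbed by
`(2 α)^{log³ n}`. -/
lemma loss_le {α : ℝ} (hα : 1 ≤ α) {n : ℕ} (hn : 32 ≤ Real.log n) :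
    (2 * α * (n : ℝ) ^ 3) ^ (2 * (⌊Real.log n⌋₊ + 1)) ≤ (2 * α) ^ (Real.log n ^ 3) ∧
      (n : ℝ) ^ 2 ≤ (2 * α) ^ (Real.log n ^ 3) := by
  set Λ := Real.log n with hΛ
  have h2α : 2 ≤ 2 * α := by linarith
  have h1 : 1 ≤ 2 * α := by linarith
  have hn0 : (0 : ℝ) < n := by
    rcases Nat.eq_zero_or_pos n with h | h
    · rw [hΛ, h] at hn; norm_num at hn
    · exact_mod_cast h
  have hlog2 : 1 / 2 ≤ Real.log (2 * α) := by
    have := Real.log_le_log (by norm_num) h2α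
    linarith [Real.log_two_gt_d9]
  -- `log (2α) ≥ 1/2`, so `e ≤ (2α)²`. Then `D ≤ (2α)^{7Λ}`, and at most `4Λ` factors give exponent
  -- `28Λ² ≤ Λ³`.
  have hn1 : (n : ℝ) ≤ (2 * α) ^ (2 * Λ) := by
    rw [Real.le_rpow_iff_log_le hn0 (by linarith), ← hΛ]
    nlinarith
  have hD : 2 * α * (n : ℝ) ^ 3 ≤ (2 * α) ^ (7 * Λ) := by
    calc 2 * α * (n : ℝ) ^ 3 ≤ (2 * α) ^ (1 : ℝ) * ((2 * α) ^ (2 * Λ)) ^ 3 := by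
          rw [Real.rpow_one]; gcongr
      _ = (2 * α) ^ (1 + 2 * Λ * 3) := by
          rw [Real.rpow_add (by linarith), ← Real.rpow_natCast, ← Real.rpow_mul (by linarith)]
          norm_num
      _ ≤ (2 * α) ^ (7 * Λ) := Real.rpow_le_rpow_of_exponent_le h1 (by linarith)
  have hfloor : (⌊Λ⌋₊ : ℝ) ≤ Λ := Nat.floor_le (by linarith)
  constructor
  · calc (2 * α * (n : ℝ) ^ 3) ^ (2 * (⌊Λ⌋₊ + 1))
        ≤ ((2 * α) ^ (7 * Λ)) ^ (2 * (⌊Λ⌋₊ + 1)) := by gcongr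
      _ = (2 * α) ^ (7 * Λ * (2 * (⌊Λ⌋₊ + 1) : ℕ)) := by
          rw [← Real.rpow_natCast, ← Real.rpow_mul (by linarith)]
      _ ≤ (2 * α) ^ (Λ ^ 3) := by
          refine Real.rpow_le_rpow_of_exponent_le h1 ?_
          push_cast
          have h₁ : 2 * ((⌊Λ⌋₊ : ℝ) + 1) ≤ 4 * Λ := by linarith
          calc 7 * Λ * (2 * (⌊Λ⌋₊ + 1)) ≤ 7 * Λ * (4 * Λ) := by gcongr
            _ = 28 * Λ ^ 2 := by ring
            _ ≤ Λ * Λ ^ 2 := by gcongr; linarith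
            _ = Λ ^ 3 := by ring
  · calc (n : ℝ) ^ 2 ≤ ((2 * α) ^ (2 * Λ)) ^ 2 := by gcongr
      _ = (2 * α) ^ (2 * Λ * 2) := by
          rw [← Real.rpow_natCast, ← Real.rpow_mul (by linarith)]
          norm_num
      _ ≤ (2 * α) ^ (Λ ^ 3) := by
          refine Real.rpow_le_rpow_of_exponent_le h1 ?_
          calc 2 * Λ * 2 = 4 * Λ := by ring
            _ ≤ Λ ^ 2 * Λ := by gcongr; nlinarith
            _ = Λ ^ 3 := by ring

/-- The number of steps `⌊log n⌋ + 1` must be long enough for geometric growth to exceed `n`, yet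
within the range `k ≤ n^{1/4}` where chains are counted. -/
lemma floor_log_bounds {C p : ℝ} {n : ℕ} (h : SparsityRange C n p) (hC : 100 ≤ C) :
    32 ≤ Real.log n ∧ ((⌊Real.log n⌋₊ + 1 : ℕ) : ℝ) ≤ (n : ℝ) ^ (1 / 4 : ℝ) ∧
      n < 4 ^ (⌊Real.log n⌋₊ + 1) := by
  obtain ⟨-, h₁, h₂, -, -, -⟩ := h.bounds (by linarith)
  have hn : (100 : ℝ) ^ 8 ≤ n := by
    refine le_trans ?_ h₂
    gcongr
  have hn0 : (0 : ℝ) < n := by linarith [show (0 : ℝ) < 100 ^ 8 by norm_num]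
  have hlog : 32 ≤ Real.log n := by
    rw [Real.le_log_iff_exp_le hn0]
    calc Real.exp 32 = Real.exp 1 ^ (32 : ℕ) := by rw [← Real.exp_nat_mul]; norm_num
      _ ≤ 2.7182818286 ^ (32 : ℕ) := by gcongr; exact Real.exp_one_lt_d9.le
      _ ≤ 100 ^ 8 := by norm_num
      _ ≤ n := hn
  refine ⟨hlog, ?_, ?_⟩
  · set q : ℝ := (n : ℝ) ^ (1 / 8 : ℝ) with hq
    have hq100 : 100 ≤ q := by
      rw [hq, Real.le_rpow_iff_log_le (by norm_num) hn0]
      have := Real.log_le_log (by norm_num) hn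
      rw [Real.log_pow] at this
      push_cast at this
      linarith
    have hq2 : (n : ℝ) ^ (1 / 4 : ℝ) = q ^ 2 := by
      rw [hq, ← Real.rpow_natCast, ← Real.rpow_mul hn0.le]
      norm_num
    have hlogq : Real.log n = 8 * Real.log q := by
      rw [hq, Real.log_rpow hn0]; ring
    have h₃ : Real.log q ≤ q - 1 := Real.log_le_sub_one_of_pos (by linarith)
    have h₄ : (⌊Real.log n⌋₊ : ℝ) ≤ Real.log n := Nat.floor_le (by linarith)
    rw [hq2]
    push_cast
    nlinarith
  · have h₃ := Nat.lt_floor_add_one (Real.log n)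
    have h₄ : (n : ℝ) < (4 : ℝ) ^ (⌊Real.log n⌋₊ + 1) := by
      calc (n : ℝ) = Real.exp (Real.log n) := (Real.exp_log hn0).symm
        _ < Real.exp ((⌊Real.log n⌋₊ + 1 : ℕ) * 1) := by
            rw [Real.exp_lt_exp]; push_cast; linarith
        _ = Real.exp 1 ^ (⌊Real.log n⌋₊ + 1) := Real.exp_nat_mul _ _
        _ ≤ 4 ^ (⌊Real.log n⌋₊ + 1) := by
            gcongr
            linarith [Real.exp_one_lt_d9]
    exact_mod_cast h₄

/-- On the good event, the coordinates of infinite type reach the order `m` with a loss of at most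
`(2 α n³)^{O(log n)}`. -/
lemma GoodOneSide.norm_le_orderStat {n : ℕ} {α p cS cT cE c c₁ c₂ : ℝ} {m : ℕ}
    {B : Matrix (Fin n) (Fin n) ℂ} (hB : GoodOneSide α p cS cT cE m c c₁ c₂ B) {C : ℝ}
    (hr : SparsityRange C n p) (hα : 1 ≤ α) (hC : 100 ≤ C) (hCT : 1 ≤ cT * C)
    (hmE : (m : ℝ) ≤ cE / p) (hrow : ∀ i, ∑ j, ‖B i j‖ ≤ (n : ℝ) ^ 3)
    (hdiag : ∀ i, 1 / α ≤ ‖B i i‖) {x : Fin n → ℂ} (hx : x ≠ 0)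
    (hsmall : ∀ i, 2 * α * (2 * α * (n : ℝ) ^ 3) ^ (2 * (⌊Real.log n⌋₊ + 1)) * ‖(B *ᵥ x) i‖ < ‖x‖) :
    ‖x‖ ≤ (2 * α * (n : ℝ) ^ 3) ^ (2 * (⌊Real.log n⌋₊ + 1)) * orderStat x m := by
  obtain ⟨hCP, -, -, -, hp, -⟩ := hr.bounds (by linarith)
  obtain ⟨hlog, hL, h4⟩ := floor_log_bounds hr hC
  have hn1 : (1 : ℝ) ≤ n := by exact_mod_cast hr.1
  have hα0 : 0 < α := by linarith
  set N := ⌊Real.log n⌋₊ + 1 with hN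
  set D := 2 * α * (n : ℝ) ^ 3 with hD
  have hD1 : 1 ≤ D := by
    have : (1 : ℝ) ≤ (n : ℝ) ^ 3 := one_le_pow₀ hn1
    nlinarith
  have hx0 : 0 < ‖x‖ := norm_pos_iff.2 hx
  have hP0 : 0 < p * n := by linarith
  obtain ⟨-, ⟨hch₁, hch₂, hch₃⟩, hexp, -⟩ := hB
  set G := matrixGraph α B with hG
  set K := p * n / (2 * α) / 2 with hK
  -- The range `D ^ (2 * N)` serves two phases of `N` steps each: reaching a coordinate of infinite
  -- type, then growing the set of such coordinates.
  have hstep : ∀ i j, i ∈ G.outNbr j → ‖x‖ ≤ D ^ (2 * N) * ‖x j‖ →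
      ∃ j', j' ≠ j ∧ G.toRight i j' ∧ ‖x j‖ ≤ D * ‖x j'‖ := by
    intro i j hij hj
    refine exists_comparable_of_row hα0 hD1 hij.2 ?_ ?_
    · rw [hD]
      gcongr
      exact hrow i
    · have h₁ := (hsmall i).trans_le hj
      have h₂ : D ^ (2 * N) * (2 * α * ‖(B *ᵥ x) i‖) < D ^ (2 * N) * ‖x j‖ := by
        calc _ = 2 * α * D ^ (2 * N) * ‖(B *ᵥ x) i‖ := by ring
          _ < _ := h₁
      exact lt_of_mul_lt_mul_left h₂ (by positivity)
  have hpow : ∀ j, ‖x‖ ≤ D ^ N * ‖x j‖ → ‖x‖ ≤ D ^ (2 * N) * ‖x j‖ := by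
    intro j hj
    refine hj.trans ?_
    refine mul_le_mul_of_nonneg_right (pow_le_pow_right₀ hD1 (by omega)) (norm_nonneg _)
  obtain ⟨j₀, hj₀⟩ : ∃ j₀, ‖x‖ ≤ ‖x j₀‖ := by
    by_contra! h
    exact lt_irrefl _ ((pi_norm_lt_iff hx0).2 h)
  have hadm := G.admissible_id K
  obtain ⟨j₁, hj₁, hw₁⟩ := G.exists_notMem_finType_of_chains (K := K) (w := fun j => ‖x j‖)
    hD1 hx0 (N := N) (fun i j hij hj => hstep i j hij (hpow j hj))
    (fun j => ⟨by
      intro h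
      have h₁ := hdiag j
      rw [h, norm_zero] at h₁
      have : 0 < 1 / α := by positivity
      linarith, hdiag j⟩)
    (fun k j hj hc => hch₂ n id hadm k j hj hc)
    (by
      intro j hj hinj hsb
      have h₁ := hch₃ n id hadm N (by omega) hL
      have h₂ : 0 < {j : Fin N → Fin n | G.IsChain id j ∧ Function.Injective j ∧
          G.SelfBalancing K id j}.ncard :=
        (Set.ncard_pos (Set.toFinite _)).2 ⟨j, hj, hinj, hsb⟩
      have h₃ : (1 : ℝ) ≤ {j : Fin N → Fin n | G.IsChain id j ∧ Function.Injective j ∧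
          G.SelfBalancing K id j}.ncard := by exact_mod_cast h₂
      have h₄ : Real.log n < N := by
        rw [hN]; push_cast; exact Nat.lt_floor_add_one _
      -- The count bound drops below one since `cT * (p * n) ≥ 1` and `N > log n`; so no
      -- self-balancing chain of length `N` exists.
      have h₅ : (n : ℝ) * Real.exp (-(cT * (p * n) * N)) < 1 := by
        have hcT : 0 < cT := by
          by_contra! h
          nlinarith
        have h₆ : 1 ≤ cT * (p * n) := hCT.trans (by gcongr)
        have h₇ : (N : ℝ) ≤ cT * (p * n) * N := by
          have : (0 : ℝ) ≤ N := by positivity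
          nlinarith
        calc (n : ℝ) * Real.exp (-(cT * (p * n) * N))
            = Real.exp (Real.log n) * Real.exp (-(cT * (p * n) * N)) := by
              rw [Real.exp_log (by linarith)]
          _ = Real.exp (Real.log n - cT * (p * n) * N) := by rw [← Real.exp_add]; ring_nf
          _ < 1 := by rw [Real.exp_lt_one_iff]; linarith
      linarith)
    hj₀
  have hcard := G.lt_card_of_expansion (K := K) (w := fun j => ‖x j‖) (q := cE / p)
    (e := 1 / (512 * α) * (p * n)) (a := N) (N := N) hD1 hx0 (by positivity)
    (by
      rw [hK, div_div, div_mul_eq_mul_div, one_mul, ← mul_div_assoc, div_le_div_iff₀ (by positivity)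
        (by positivity)]
      nlinarith [mul_pos hP0 hα0])
    h4 (fun i j hij hj => hstep i j hij (by rwa [two_mul]))
    (fun J hJ hJq => hexp.le_ncard (by positivity) hJ hJq) hj₁ hw₁
  rw [← two_mul] at hcard
  have h₁ : m < {j | ‖x‖ ≤ D ^ (2 * N) * ‖x j‖}.ncard := by
    exact_mod_cast hmE.trans_lt hcard
  have h₂ : ‖x‖ / D ^ (2 * N) ≤ orderStat x m := by
    refine le_orderStat x (lt_of_le_of_lt (Nat.sub_le m 1) (h₁.trans_le ?_))
    refine Set.ncard_le_ncard (fun j hj => ?_) (Set.toFinite _)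
    change ‖x‖ / D ^ (2 * N) ≤ ‖x j‖
    rw [div_le_iff₀ (by positivity), mul_comm]
    exact hj
  rwa [div_le_iff₀ (by positivity), mul_comm] at h₂

/-- On the good event the order statistics of an almost null vector do not drop steeply between
`m / 2` and `m`. -/
lemma exp_mul_orderStat_half_lt {n : ℕ} {α p cS cT cE c c₁ c₂ τ P : ℝ} {m : ℕ}
    {A B : Matrix (Fin n) (Fin n) ℂ} {z : ℂ} (hBdef : B = A - z • (1 : Matrix (Fin n) (Fin n) ℂ))
    (hB : GoodOneSide α p cS cT cE m c c₁ c₂ B) (hell : EllOneEvent p A) (hPdef : P = p * n)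
    (hα : 1 ≤ α) (hcT : 0 < cT) (hc₁ : 0 < c₁) (hτ : 0 < τ) (hP100 : 100 ≤ P) (hn0 : (0 : ℝ) < n)
    (hC_F : 16 / (cT ^ 2 * τ) ≤ P) (hC_E : 24 * α / c₁ ^ 3 ≤ P) (hC_S : (32 * α / τ) ^ 2 < P)
    (hm16 : (16 : ℝ) ≤ m) (hmn : m ≤ n) (hmP : τ * n ≤ m * P) (hmE : (m : ℝ) ≤ cE / p)
    (hz : ‖z‖ ≤ P) (hBdiag : ∀ i, 1 / α ≤ ‖B i i‖) {x : Fin n → ℂ} (hstat : 0 < orderStat x m)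
    (hsmall : ∀ i, 2 * α * ‖(B *ᵥ x) i‖ ≤ orderStat x m) :
    Real.exp (-(c₁ * P)) * orderStat x (m / 2) < orderStat x m := by
  have hα0 : 0 < α := by linarith
  have hP0 : 0 < P := by linarith
  by_contra! hcon
  -- The cubic Taylor term of the exponential suffices once `P ≥ 24α/c₁³`. The resulting heavy rows
  -- of `B` have norm at least `2P²`, leaving at least `P²` for `A` after the shift.
  have hE : 4 * α * P ^ 2 ≤ Real.exp (c₁ * P) := by
    have h₁ := Real.pow_div_factorial_le_exp (c₁ * P) (by positivity) 3
    have h₂ : 24 * α ≤ c₁ ^ 3 * P := by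
      rw [div_le_iff₀ (by positivity)] at hC_E
      calc 24 * α ≤ P * c₁ ^ 3 := hC_E
        _ = _ := mul_comm _ _
    refine le_trans ?_ h₁
    rw [show ((Nat.factorial 3 : ℕ) : ℝ) = 6 by norm_num [Nat.factorial], le_div_iff₀ (by norm_num)]
    calc 4 * α * P ^ 2 * 6 = 24 * α * P ^ 2 := by ring
      _ ≤ c₁ ^ 3 * P * P ^ 2 := by gcongr
      _ = (c₁ * P) ^ 3 := by ring
  -- The event bounds in-neighbours, which are left vertices; through the nonzero diagonal every
  -- vertex of finite type is also one of its own in-neighbours. Types for `K₀/2` are contained in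
  -- those for `K₀`.
  have hFcard : (((matrixGraph α B).finType (P / (2 * α) / 2)).ncard : ℝ) ≤ m / 8 := by
    have h₁ : (matrixGraph α B).finType (P / (2 * α) / 2)
        ⊆ (matrixGraph α B).inNbr ((matrixGraph α B).finType (P / (2 * α))) := by
      intro j hj
      refine ⟨j, (matrixGraph α B).finType_mono (half_le_self (by positivity)) hj, ?_⟩
      intro h0
      have := hBdiag j
      rw [h0, norm_zero] at this
      have : 0 < 1 / α := by positivity
      linarith
    have h₂ : (((matrixGraph α B).finType (P / (2 * α) / 2)).ncard : ℝ)
        ≤ n * Real.exp (-(cT * P)) := by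
      have h₃ := hB.2.1.1
      rw [← hPdef] at h₃
      exact le_trans (Nat.cast_le.2 (Set.ncard_le_ncard h₁ (Set.toFinite _))) h₃
    refine h₂.trans ?_
    have h₃ := Real.pow_div_factorial_le_exp (cT * P) (by positivity) 2
    rw [show ((Nat.factorial 2 : ℕ) : ℝ) = 2 by norm_num [Nat.factorial]] at h₃
    rw [div_le_iff₀ (by positivity)] at hC_F
    have h₄ : 16 ≤ cT ^ 2 * τ * P := hC_F.trans_eq (mul_comm _ _)
    have h₅ : 8 * P ≤ τ * Real.exp (cT * P) := by
      calc 8 * P ≤ (cT ^ 2 * τ * P) * P / 2 := by nlinarith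
        _ = τ * ((cT * P) ^ 2 / 2) := by ring
        _ ≤ _ := by gcongr
    rw [Real.exp_neg, ← div_eq_mul_inv, div_le_iff₀ (Real.exp_pos _)]
    have h₆ : (n * 8 : ℝ) * P ≤ m * Real.exp (cT * P) * P := by
      calc (n * 8 : ℝ) * P = n * (8 * P) := by ring
        _ ≤ n * (τ * Real.exp (cT * P)) := by gcongr
        _ = τ * n * Real.exp (cT * P) := by ring
        _ ≤ m * P * Real.exp (cT * P) := by gcongr
        _ = _ := by ring
    have h₇ := le_of_mul_le_mul_right h₆ (by positivity)
    linarith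
  have hhalf : (m : ℝ) / 2 - 1 / 2 ≤ (m / 2 : ℕ) := by
    have : m ≤ 2 * (m / 2) + 1 := by omega
    have : (m : ℝ) ≤ 2 * (m / 2 : ℕ) + 1 := by exact_mod_cast this
    linarith
  have hEone : 1 < Real.exp (c₁ * P) := by
    rw [Real.one_lt_exp_iff]; positivity
  have hheavy := exists_heavy_rows (x := x) (α := α) hα0 (B := B) (m := m)
    (K := P / (2 * α) / 2) (e := 1 / (512 * α) * P) (E := Real.exp (c₁ * P)) (q := cE / p)
    (by
      have : (1 : ℝ) ≤ m := by linarith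
      exact_mod_cast this) hmn (by positivity)
    (by
      rw [div_div, div_mul_eq_mul_div, one_mul, ← mul_div_assoc, div_le_div_iff₀ (by positivity)
        (by positivity)]
      nlinarith [mul_pos (show 0 < P by linarith) hα0])
    (fun J hJ hJq => by
        have := hB.2.2.1.le_ncard (by rw [← hPdef]; positivity) hJ hJq
        rwa [← hPdef] at this) hmE hEone hstat (by linarith) hsmall
    (by
      rw [Real.exp_neg] at hcon
      rwa [← div_eq_inv_mul, le_div_iff₀ (Real.exp_pos _), mul_comm] at hcon)
  have h₁ := (hell P hPdef.ge).1
  have h₂ : {i | Real.exp (c₁ * P) / (2 * α) ≤ ∑ j, ‖B i j‖}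
      ⊆ {i | P * (p * n) ≤ ∑ j, ‖A i j‖} := by
    intro i hi
    have h₃ : Real.exp (c₁ * P) / (2 * α) ≤ ∑ j, ‖B i j‖ := hi
    have h₄ : ∑ j, ‖B i j‖ ≤ (∑ j, ‖A i j‖) + ‖z‖ := by
        rw [hBdef]; exact sum_norm_sub_smul_one_le A z i
    have h₅ : 2 * P ^ 2 ≤ Real.exp (c₁ * P) / (2 * α) := by
      rw [le_div_iff₀ (by positivity)]
      linarith
    change P * (p * n) ≤ ∑ j, ‖A i j‖
    rw [← hPdef]
    nlinarith
  have h₃ : (({i | Real.exp (c₁ * P) / (2 * α) ≤ ∑ j, ‖B i j‖}.ncard : ℕ) : ℝ)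
      ≤ n / P ^ (0.9 : ℝ) := le_trans (by
    exact_mod_cast Set.ncard_le_ncard h₂ (Set.toFinite _)) h₁
  -- The heavy rows number at least `Km/8 = mP/(32α)`, a fixed proportion of `n`, while the `ℓ¹`
  -- statistics at `r = P` allow only `n / P^{0.9}`. This is contradicted through `P^{0.9} ≥ √P`.
  have h₄ : τ * n / (32 * α) ≤ n / P ^ (0.9 : ℝ) := by
    refine le_trans ?_ (hheavy.trans h₃)
    calc τ * n / (32 * α) ≤ m * P / (32 * α) := by gcongr
      _ = P / (2 * α) / 2 * m / 8 := by field_simp; norm_num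
  have h₅ : 32 * α / τ < P ^ (0.9 : ℝ) := by
    calc 32 * α / τ = √((32 * α / τ) ^ 2) := (Real.sqrt_sq (by positivity)).symm
      _ < √P := Real.sqrt_lt_sqrt (by positivity) hC_S
      _ = P ^ (1 / 2 : ℝ) := Real.sqrt_eq_rpow P
      _ ≤ P ^ (0.9 : ℝ) := Real.rpow_le_rpow_of_exponent_le (by linarith) (by norm_num)
  have h₆ : (0 : ℝ) < P ^ (0.9 : ℝ) := by positivity
  rw [div_le_div_iff₀ (by positivity) h₆] at h₄
  rw [div_lt_iff₀ hτ] at h₅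
  nlinarith

/-- The almost null vectors on the good event, with explicit conditions on the sparsity. -/
lemma Good.norm_le {n : ℕ} {α p cS cT cE c c₁ c₂ τ C : ℝ} {m : ℕ}
    {A : Matrix (Fin n) (Fin n) ℂ} {z : ℂ} (hA : Good α p cS cT cE m c c₁ c₂ A z)
    (hr : SparsityRange C n p) (hα : 1 ≤ α) (hcT : 0 < cT) (hc : 0 < c) (hc₁ : 0 < c₁)
    (hc₂ : 0 < c₂) (hτ : 0 < τ) (hC : 100 ≤ C) (hC_T : 1 / cT ≤ C) (hC_c : 1 / c ≤ C)
    (hC_c₂ : 1 / c₂ ≤ C) (hC_τ : 16 / τ ≤ C) (hC_F : 16 / (cT ^ 2 * τ) ≤ C)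
    (hC_E : 24 * α / c₁ ^ 3 ≤ C) (hC_S : (32 * α / τ) ^ 2 < C)
    (hm : τ * p⁻¹ ≤ m) (hm₁ : (m : ℝ) ≤ p⁻¹) (hmE : (m : ℝ) ≤ cE / p) (hz : ‖z‖ ≤ p * n)
    (hdiag : ∀ i, 1 / α ≤ ‖A i i - z‖) {x : Fin n → ℂ}
    (hx : ‖WithLp.toLp 2 ((A - z • (1 : Matrix (Fin n) (Fin n) ℂ)) *ᵥ x)‖
      ≤ (2 * α) ^ (-(3 * Real.log n ^ 3)) * ‖x‖) :
    ‖x‖ ≤ (2 * α) ^ (3 * Real.log n ^ 3) * orderStat x (spreadIndex c₁ n p) := by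
  rcases eq_or_ne x 0 with rfl | hx0
  · rw [norm_zero]
    exact mul_nonneg (by positivity) (orderStat_nonneg _ _)
  obtain ⟨hB, -, hell⟩ := hA
  set B := A - z • (1 : Matrix (Fin n) (Fin n) ℂ) with hBdef
  obtain ⟨hCP, hPn, hC8, hC7, hp, hp2⟩ := hr.bounds (by linarith)
  obtain ⟨hlog, -, -⟩ := floor_log_bounds hr hC
  obtain ⟨hloss, hn2⟩ := loss_le hα hlog
  have hα0 : 0 < α := by linarith
  set P := p * n with hPdef
  have hP100 : 100 ≤ P := hC.trans hCP
  have hn0 : (0 : ℝ) < n := by exact_mod_cast hr.1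
  have hn1 : (1 : ℝ) ≤ n := by exact_mod_cast hr.1
  have hCn : C ≤ n := le_trans (by
    calc C = C ^ 1 := (pow_one C).symm
      _ ≤ C ^ 8 := pow_le_pow_right₀ (by linarith) (by norm_num)) hC8
  have hPn' : P ≤ n := by rw [hPdef]; nlinarith
  have hxpos : 0 < ‖x‖ := norm_pos_iff.2 hx0
  -- The unit of loss. Smallness `W⁻³` pays for `2α < W` and the propagation loss `U ≤ W`, with a
  -- factor to spare; in the conclusion `W` covers the passage to `x*_m` and another `W` covers `P/c
  -- ≤ n²`.
  set W : ℝ := (2 * α) ^ (Real.log n ^ 3) with hW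
  have hW0 : 0 < W := by positivity
  have hW3 : (2 * α) ^ (3 * Real.log n ^ 3) = W ^ 3 := by
    rw [hW, ← Real.rpow_mul_natCast (by positivity), mul_comm (3 : ℝ)]
    norm_num
  have hW2α : 2 * α < W := by
    calc 2 * α = (2 * α) ^ (1 : ℝ) := (Real.rpow_one _).symm
      _ < W := Real.rpow_lt_rpow_of_exponent_lt (by linarith) (by
          have : (32 : ℝ) ^ 3 ≤ Real.log n ^ 3 := by gcongr
          linarith [show (32 : ℝ) ^ 3 = 32768 by norm_num])
  rw [Real.rpow_neg (by positivity), hW3] at hx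
  rw [hW3]
  have hrow_norm : ∀ i, ‖(B *ᵥ x) i‖ ≤ (W ^ 3)⁻¹ * ‖x‖ := fun i =>
    (PiLp.norm_apply_le (WithLp.toLp 2 (B *ᵥ x)) i).trans hx
  have hrow : ∀ i, ∑ j, ‖B i j‖ ≤ (n : ℝ) ^ 3 := by
    intro i
    have h₁ := sum_norm_sub_smul_one_le A z i
    have h₂ := hell.sum_norm_lt (by
      have : (2 : ℝ) ≤ n := by linarith
      exact_mod_cast this) (by linarith) i
    have h₃ : (n : ℝ) ^ 2 * (p * n) ≤ (n : ℝ) ^ 3 / 2 := by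
      calc (n : ℝ) ^ 2 * (p * n) = (n : ℝ) ^ 3 * p := by ring
        _ ≤ (n : ℝ) ^ 3 * (1 / 2) := by gcongr
        _ = _ := by ring
    have h₄ : P ≤ (n : ℝ) ^ 3 / 2 := by
      have : (100 : ℝ) ≤ n := by linarith
      calc P ≤ n * 1 := by linarith
        _ ≤ n * ((n : ℝ) ^ 2 / 2) := by gcongr; nlinarith
        _ = (n : ℝ) ^ 3 / 2 := by ring
    linarith
  have hBdiag : ∀ i, 1 / α ≤ ‖B i i‖ := by
    intro i
    simpa [hBdef] using hdiag i
  set U := (2 * α * (n : ℝ) ^ 3) ^ (2 * (⌊Real.log n⌋₊ + 1)) with hU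
  have hU0 : 0 < U := by positivity
  have hbig : ‖x‖ ≤ U * orderStat x m := by
    refine hB.norm_le_orderStat hr hα hC ?_ hmE hrow hBdiag hx0 fun i => ?_
    · rwa [div_le_iff₀ hcT, mul_comm] at hC_T
    · calc 2 * α * U * ‖(B *ᵥ x) i‖ ≤ 2 * α * W * ((W ^ 3)⁻¹ * ‖x‖) := by
            gcongr
            exact hrow_norm i
        _ < W * W * ((W ^ 3)⁻¹ * ‖x‖) := by gcongr
        _ = W⁻¹ * ‖x‖ := by field_simp
        _ ≤ 1 * ‖x‖ := by
            gcongr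
            exact inv_le_one_of_one_le₀ (by linarith)
        _ = ‖x‖ := one_mul _
  have hbigW : ‖x‖ ≤ W * orderStat x m :=
    hbig.trans (mul_le_mul_of_nonneg_right hloss (orderStat_nonneg x m))
  have hstat : 0 < orderStat x m := by
    by_contra! h
    have := mul_nonpos_of_nonneg_of_nonpos hW0.le h
    linarith
  have hm16 : (16 : ℝ) ≤ m := by
    refine le_trans ?_ hm
    rw [div_le_iff₀ hτ] at hC_τ
    have h₁ : C ≤ p⁻¹ := le_trans (by
      calc C = C ^ 1 := (pow_one C).symm
        _ ≤ C ^ 7 := pow_le_pow_right₀ (by linarith) (by norm_num)) hC7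
    calc (16 : ℝ) ≤ C * τ := hC_τ
      _ = τ * C := mul_comm _ _
      _ ≤ τ * p⁻¹ := by gcongr
  have hmn : m ≤ n := by
    have : (m : ℝ) ≤ n := by
      refine hm₁.trans ?_
      rw [inv_le_iff_one_le_mul₀ hp, mul_comm]
      linarith
    exact_mod_cast this
  have hmP : τ * n ≤ m * P := by
    rw [hPdef]
    have : τ ≤ m * p := by
      rwa [← div_eq_mul_inv, div_le_iff₀ hp] at hm
    calc τ * n ≤ m * p * n := by gcongr
      _ = m * (p * n) := by ring
  have hgap : Real.exp (-(c₁ * P)) * orderStat x (m / 2) < orderStat x m := by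
    refine exp_mul_orderStat_half_lt hBdef hB hell hPdef hα hcT hc₁ hτ hP100 hn0
      (hC_F.trans hCP) (hC_E.trans hCP) (hC_S.trans_le hCP) hm16 hmn hmP hmE hz hBdiag hstat
      fun i => ?_
    calc 2 * α * ‖(B *ᵥ x) i‖ ≤ W * ((W ^ 3)⁻¹ * (W * orderStat x m)) := by
          gcongr
          exact (hrow_norm i).trans (by gcongr)
      _ = W⁻¹ * orderStat x m := by field_simp
      _ ≤ 1 * orderStat x m := by
          gcongr
          exact inv_le_one_of_one_le₀ (by linarith)
      _ = orderStat x m := one_mul _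
  have hfinal := hB.2.2.2.lt_orderStat hc.le hx0 hgap (by
    have h₁ : 1 ≤ c₂ * √n := by
      have h₂ : C ≤ √n := by
        refine Real.le_sqrt_of_sq_le (le_trans ?_ hC8)
        exact pow_le_pow_right₀ (by linarith) (by norm_num)
      rw [div_le_iff₀ hc₂, mul_comm] at hC_c₂
      exact hC_c₂.trans (by gcongr)
    calc _ ≤ (W ^ 3)⁻¹ * ‖x‖ := hx
      _ ≤ (W ^ 3)⁻¹ * (W * orderStat x m) := by gcongr
      _ = (W ^ 2)⁻¹ * orderStat x m := by field_simp
      _ ≤ 1 * orderStat x m := by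
          gcongr
          exact inv_le_one_of_one_le₀ (one_le_pow₀ (by linarith))
      _ ≤ c₂ * √n * orderStat x m := by gcongr)
  have hPc : P / c ≤ W := by
    refine le_trans ?_ hn2
    calc P / c = P * (1 / c) := by ring
      _ ≤ n * n := by
          gcongr
          exact hC_c.trans hCn
      _ = (n : ℝ) ^ 2 := by ring
  have h₁ : orderStat x m ≤ W * orderStat x (spreadIndex c₁ n p) := by
    calc orderStat x m = P / c * (c / P * orderStat x m) := by field_simp
      _ ≤ P / c * orderStat x (spreadIndex c₁ n p) := by gcongr
      _ ≤ _ := mul_le_mul_of_nonneg_right hPc (orderStat_nonneg _ _)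
  calc ‖x‖ ≤ W * orderStat x m := hbigW
    _ ≤ W * (W * orderStat x (spreadIndex c₁ n p)) := by gcongr
    _ = 1 * (W * W * orderStat x (spreadIndex c₁ n p)) := by ring
    _ ≤ W * (W * W * orderStat x (spreadIndex c₁ n p)) := by
        refine mul_le_mul_of_nonneg_right (by linarith) ?_
        exact mul_nonneg (by positivity) (orderStat_nonneg _ _)
    _ = W ^ 3 * orderStat x (spreadIndex c₁ n p) := by ring

/-- Choice of constants for `Good.norm_le`: `τ₀ ≤ cE` keeps `m` in the range of expansion, `c' = c₁`
matches the index `M` of the almost proportional event, and the sparsity constant is a sum so as to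
dominate every threshold. The exceptional null set comes from the diagonal entries. -/
theorem norm_le_orderStat_on_good : ∃ C : ℝ, 0 < C ∧
      ∀ α : ℝ, 1 ≤ α →
      ∀ cS cT cE : ℝ, 0 < cS → 0 < cT → 0 < cE →
      ∃ τ₀ : ℝ, 0 < τ₀ ∧ τ₀ < 1 ∧
      ∀ τ : ℝ, 0 < τ → τ < τ₀ →
      ∀ c c₁ c₂ : ℝ, 0 < c → 0 < c₁ → 0 < c₂ →
      ∃ Cα c' : ℝ, 0 < Cα ∧ 0 < c' ∧
      ∀ (n : ℕ) (p : ℝ), SparsityRange Cα n p →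
      ∀ (Ω : Type u) [MeasurableSpace Ω] (μ : Measure Ω)
        (A : Ω → Matrix (Fin n) (Fin n) ℂ) (z : ℂ), IsShift μ α p A z →
      ∀ m : ℕ, τ * p⁻¹ ≤ m → (m : ℝ) ≤ τ₀ * p⁻¹ →
      ∀ᵐ ω ∂μ, Good α p cS cT cE m c c₁ c₂ (A ω) z →
        ∀ x : Fin n → ℂ,
          ‖WithLp.toLp 2 ((A ω - z • (1 : Matrix (Fin n) (Fin n) ℂ)) *ᵥ x)‖
            ≤ (2 * α) ^ (-(C * Real.log n ^ 3)) * ‖x‖ →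
          ‖x‖ ≤ (2 * α) ^ (C * Real.log n ^ 3) * orderStat x (spreadIndex c' n p) := by
  refine ⟨3, by norm_num, fun α hα cS cT cE _ hcT hcE => ⟨min cE (1 / 2), by positivity,
    (min_le_right _ _).trans_lt (by norm_num), fun τ hτ _ c c₁ c₂ hc hc₁ hc₂ => ?_⟩⟩
  have hα0 : 0 < α := by linarith
  have a₁ : 0 < 1 / cT := by positivity
  have a₂ : 0 < 1 / c := by positivity
  have a₃ : 0 < 1 / c₂ := by positivity
  have a₄ : 0 < 16 / τ := by positivity
  have a₅ : 0 < 16 / (cT ^ 2 * τ) := by positivity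
  have a₆ : 0 < 24 * α / c₁ ^ 3 := by positivity
  have a₇ : 0 < (32 * α / τ) ^ 2 := by positivity
  refine ⟨100 + 1 / cT + 1 / c + 1 / c₂ + 16 / τ + 16 / (cT ^ 2 * τ) + 24 * α / c₁ ^ 3
    + (32 * α / τ) ^ 2, c₁, by positivity, hc₁, ?_⟩
  intro n p hr Ω _ μ A z hz m hm hm'
  have hp : 0 < p := (hr.bounds (by linarith)).2.2.2.2.1
  have hdiag : ∀ᵐ ω ∂μ, ∀ i, 1 / α ≤ ‖A ω i i - z‖ := ae_all_iff.2 fun i => hz.2 i i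
  filter_upwards [hdiag] with ω hω hgood x hx
  refine hgood.norm_le hr hα hcT hc hc₁ hc₂ hτ (by linarith) (by linarith) (by linarith)
    (by linarith) (by linarith) (by linarith) (by linarith) (by linarith) hm ?_ ?_ hz.1 hω hx
  · refine hm'.trans ?_
    have : min cE (1 / 2) ≤ 1 := (min_le_right _ _).trans (by norm_num)
    have := mul_le_mul_of_nonneg_right this (inv_pos.2 hp).le
    linarith
  · rw [div_eq_mul_inv]
    exact hm'.trans (by gcongr; exact min_le_left _ _)

/-! ### Independence of rows and exponential moments -/

section Independence

variable {Ω : Type*} [MeasurableSpace Ω] {μ : Measure Ω}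

/-- Fubini for the product law, keeping only the sections over `S`: a conditional lower bound that
is uniform on `S` integrates to a joint one. -/
lemma _root_.ProbabilityTheory.IndepFun.mul_le_measure_of_section {β γ : Type*}
    [MeasurableSpace β] [MeasurableSpace γ] [IsProbabilityMeasure μ] {X : Ω → β} {V : Ω → γ}
    (h : IndepFun X V μ) (hX : Measurable X) (hV : Measurable V) {S : Set γ}
    (hS : MeasurableSet S) {D : Set (β × γ)} (hD : MeasurableSet D) {b : ENNReal}
    (hb : ∀ v ∈ S, b ≤ μ {ω | (X ω, v) ∈ D}) :
    b * μ {ω | V ω ∈ S} ≤ μ {ω | (X ω, V ω) ∈ D} := by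
  have h₁ := (indepFun_iff_map_prod_eq_prod_map_map hX.aemeasurable hV.aemeasurable).1 h
  have : IsProbabilityMeasure (μ.map X) := Measure.isProbabilityMeasure_map hX.aemeasurable
  have : IsProbabilityMeasure (μ.map V) := Measure.isProbabilityMeasure_map hV.aemeasurable
  have h₂ : μ {ω | (X ω, V ω) ∈ D} = (μ.map X).prod (μ.map V) D := by
    rw [← h₁, Measure.map_apply (hX.prodMk hV) hD]
    rfl
  rw [h₂, Measure.prod_apply_symm hD]
  calc b * μ {ω | V ω ∈ S} = ∫⁻ _ in S, b ∂(μ.map V) := by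
        rw [setLIntegral_const, Measure.map_apply hV hS]
        rfl
    _ ≤ ∫⁻ v in S, μ.map X ((fun x => (x, v)) ⁻¹' D) ∂(μ.map V) := by
        refine setLIntegral_mono' hS fun v hv => ?_
        rw [Measure.map_apply hX (measurable_prodMk_right hD)]
        exact hb v hv
    _ ≤ _ := setLIntegral_le_lintegral _ _

/-- Functions of distinct rows of a matrix with independent entries are independent. -/
lemma lintegral_prod_rows {n : ℕ} {A : Ω → Matrix (Fin n) (Fin n) ℂ}
    (hA : ∀ i j, Measurable fun ω => A ω i j)
    (hind : iIndepFun (fun (ij : Fin n × Fin n) ω => A ω ij.1 ij.2) μ)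
    {g : Fin n → (Fin n → ℂ) → ENNReal} (hg : ∀ i, Measurable (g i)) (s : Finset (Fin n)) :
    ∫⁻ ω, ∏ i ∈ s, g i (A ω i) ∂μ = ∏ i ∈ s, ∫⁻ ω, g i (A ω i) ∂μ := by
  classical
  have : IsProbabilityMeasure μ := hind.isProbabilityMeasure
  have hrow : ∀ i, Measurable fun ω => A ω i := fun i => measurable_pi_lambda _ fun j => hA i j
  induction s using Finset.induction_on with
  | empty => simp
  | insert i₀ s hi₀ ih =>
    have hdisj : Disjoint (({i₀} : Finset (Fin n)) ×ˢ (Finset.univ : Finset (Fin n)))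
        (s ×ˢ (Finset.univ : Finset (Fin n))) := by
      rw [Finset.disjoint_left]
      rintro ⟨i, j⟩ h h'
      simp only [Finset.mem_product, Finset.mem_singleton, Finset.mem_univ, and_true] at h h'
      exact hi₀ (h ▸ h')
    have h₁ := hind.indepFun_finset _ _ hdisj fun ij => hA ij.1 ij.2
    -- Independence is available for blocks of entries; extension by zero recovers the rows
    -- contained in a block as measurable functions of it.
    set ext : (T : Finset (Fin n × Fin n)) → (T → ℂ) → Fin n → Fin n → ℂ := fun T v i j =>
      if h : (i, j) ∈ T then v ⟨(i, j), h⟩ else 0 with hext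
    have hext_meas : ∀ T i, Measurable fun v => ext T v i := by
      intro T i
      refine measurable_pi_lambda _ fun j => ?_
      by_cases h : (i, j) ∈ T
      · simpa [hext, h] using measurable_pi_apply _
      · simp [hext, h]
    have h₂ := h₁.comp (φ := fun v => g i₀ (ext _ v i₀))
      (ψ := fun v => ∏ i ∈ s, g i (ext _ v i)) ((hg i₀).comp (hext_meas _ i₀))
      (Finset.measurable_prod _ fun i _ => (hg i).comp (hext_meas _ i))
    have h₃ : IndepFun (fun ω => g i₀ (A ω i₀)) (fun ω => ∏ i ∈ s, g i (A ω i)) μ := by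
      convert h₂ using 1
      · ext ω
        simp only [Function.comp_apply, hext]
        congr 1
        ext j
        simp
      · ext ω
        simp only [Function.comp_apply, hext]
        refine Finset.prod_congr rfl fun i hi => ?_
        congr 1
        ext j
        simp [hi]
    simp only [Finset.prod_insert hi₀]
    rw [← ih]
    exact lintegral_mul_eq_lintegral_mul_lintegral_of_indepFun ((hg i₀).comp (hrow i₀))
      (Finset.measurable_prod _ fun i _ => (hg i).comp (hrow i)) h₃

/-- Exponential moments of the number of rows with a given property. -/
lemma lintegral_exp_card_rows_le {n : ℕ} {A : Ω → Matrix (Fin n) (Fin n) ℂ}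
    (hA : ∀ i j, Measurable fun ω => A ω i j)
    (hind : iIndepFun (fun (ij : Fin n × Fin n) ω => A ω ij.1 ij.2) μ)
    {G : Fin n → Set (Fin n → ℂ)} (hG : ∀ i, MeasurableSet (G i)) (s : Finset (Fin n)) (t : ℝ) :
    ∫⁻ ω, ENNReal.ofReal (Real.exp (t * {i | i ∈ s ∧ A ω i ∈ G i}.ncard)) ∂μ
      ≤ ENNReal.ofReal (Real.exp ((Real.exp t - 1) * ∑ i ∈ s, μ.real {ω | A ω i ∈ G i})) := by
  classical
  have : IsProbabilityMeasure μ := hind.isProbabilityMeasure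
  have hrow : ∀ i, Measurable fun ω => A ω i := fun i => measurable_pi_lambda _ fun j => hA i j
  set g : Fin n → (Fin n → ℂ) → ENNReal := fun i v =>
    if v ∈ G i then ENNReal.ofReal (Real.exp t) else 1 with hg
  have hg_meas : ∀ i, Measurable (g i) := fun i =>
    Measurable.ite (hG i) measurable_const measurable_const
  have h₁ : ∀ ω, ENNReal.ofReal (Real.exp (t * {i | i ∈ s ∧ A ω i ∈ G i}.ncard))
      = ∏ i ∈ s, g i (A ω i) := by
    intro ω
    have h₂ : {i | i ∈ s ∧ A ω i ∈ G i} = (s.filter fun i => A ω i ∈ G i : Finset (Fin n)) := by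
      ext i; simp
    rw [h₂, Set.ncard_coe_finset, Finset.prod_ite, Finset.prod_const_one, mul_one,
      Finset.prod_const, mul_comm, Real.exp_nat_mul, ENNReal.ofReal_pow (Real.exp_pos t).le]
  have h₂ : ∀ i, ∫⁻ ω, g i (A ω i) ∂μ
      ≤ ENNReal.ofReal (Real.exp ((Real.exp t - 1) * μ.real {ω | A ω i ∈ G i})) := by
    intro i
    set E : Set Ω := {ω | A ω i ∈ G i} with hE
    have hE_meas : MeasurableSet E := hrow i (hG i)
    have h₃ : ∀ ω, g i (A ω i)
        = E.indicator (fun _ => ENNReal.ofReal (Real.exp t)) ω + Eᶜ.indicator (fun _ => 1) ω := by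
      intro ω
      by_cases h : A ω i ∈ G i
      · simp [hg, hE, h]
      · simp [hg, hE, h]
    simp only [h₃]
    rw [lintegral_add_left (measurable_const.indicator hE_meas), lintegral_indicator_const hE_meas,
      lintegral_indicator_const hE_meas.compl, one_mul, ← ofReal_measureReal, ← ofReal_measureReal,
      ← ENNReal.ofReal_mul (Real.exp_pos t).le, ← ENNReal.ofReal_add (by positivity) (by positivity),
      probReal_compl_eq_one_sub hE_meas]
    refine ENNReal.ofReal_le_ofReal ?_
    have := Real.add_one_le_exp ((Real.exp t - 1) * μ.real E)
    linarith
  simp only [h₁]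
  rw [lintegral_prod_rows hA hind hg_meas, Finset.mul_sum, Real.exp_sum,
    ENNReal.ofReal_prod_of_nonneg fun i _ => (Real.exp_pos _).le]
  exact Finset.prod_le_prod' fun i _ => h₂ i

lemma measurable_exp_card_rows {n : ℕ} {A : Ω → Matrix (Fin n) (Fin n) ℂ}
    (hA : ∀ i j, Measurable fun ω => A ω i j)
    {G : Fin n → Set (Fin n → ℂ)} (hG : ∀ i, MeasurableSet (G i)) (s : Finset (Fin n)) (t : ℝ) :
    Measurable fun ω => ENNReal.ofReal (Real.exp (t * {i | i ∈ s ∧ A ω i ∈ G i}.ncard)) := by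
  classical
  have hrow : ∀ i, Measurable fun ω => A ω i := fun i => measurable_pi_lambda _ fun j => hA i j
  have h₁ : ∀ ω, ({i | i ∈ s ∧ A ω i ∈ G i}.ncard : ℝ)
      = ∑ i ∈ s, (G i).indicator (fun _ => (1 : ℝ)) (A ω i) := by
    intro ω
    have h₂ : {i | i ∈ s ∧ A ω i ∈ G i} = (s.filter fun i => A ω i ∈ G i : Finset (Fin n)) := by
      ext i; simp
    rw [h₂, Set.ncard_coe_finset]
    simp [Set.indicator_apply]
  simp only [h₁]
  refine ENNReal.measurable_ofReal.comp (Real.measurable_exp.comp (measurable_const.mul ?_))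
  exact Finset.measurable_sum _ fun i _ =>
    (measurable_const.indicator (hG i)).comp (hrow i)

/-- Lower tail of the number of rows with a given property. -/
lemma measure_card_rows_le {n : ℕ} {A : Ω → Matrix (Fin n) (Fin n) ℂ}
    (hA : ∀ i j, Measurable fun ω => A ω i j)
    (hind : iIndepFun (fun (ij : Fin n × Fin n) ω => A ω ij.1 ij.2) μ)
    {G : Fin n → Set (Fin n → ℂ)} (hG : ∀ i, MeasurableSet (G i)) (s : Finset (Fin n)) {q k : ℝ}
    (hq : ∀ i ∈ s, q ≤ μ.real {ω | A ω i ∈ G i}) :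
    μ {ω | ({i | i ∈ s ∧ A ω i ∈ G i}.ncard : ℝ) ≤ k}
      ≤ ENNReal.ofReal (Real.exp (k - q * s.card / 2)) := by
  have : IsProbabilityMeasure μ := hind.isProbabilityMeasure
  -- Chernoff's bound at parameter `-1`, where `1 - e⁻¹ ≥ 1/2`. The upper tail uses parameter `1`,
  -- where `e - 1 ≤ 2`.
  have h₁ := lintegral_exp_card_rows_le hA hind hG s (-1)
  have h₂ := mul_meas_ge_le_lintegral (μ := μ) (measurable_exp_card_rows hA hG s (-1))
    (ENNReal.ofReal (Real.exp (-k)))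
  have h₃ : (Real.exp (-1) - 1) * ∑ i ∈ s, μ.real {ω | A ω i ∈ G i} ≤ - (q * s.card / 2) := by
    have h₄ : q * s.card ≤ ∑ i ∈ s, μ.real {ω | A ω i ∈ G i} := by
      calc q * s.card = ∑ i ∈ s, q := by simp [mul_comm]
        _ ≤ _ := Finset.sum_le_sum hq
    have h₅ : 0 ≤ ∑ i ∈ s, μ.real {ω | A ω i ∈ G i} :=
      Finset.sum_nonneg fun i _ => measureReal_nonneg
    have h₆ : Real.exp (-1) ≤ 1 / 2 := by
      rw [Real.exp_neg, ← one_div]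
      exact one_div_le_one_div_of_le (by norm_num) (by linarith [Real.exp_one_gt_d9])
    nlinarith
  have h₄ : ENNReal.ofReal (Real.exp (-k)) * μ {ω | ({i | i ∈ s ∧ A ω i ∈ G i}.ncard : ℝ) ≤ k}
      ≤ ENNReal.ofReal (Real.exp (-(q * s.card / 2))) := by
    refine le_trans ?_ ((h₂.trans h₁).trans (ENNReal.ofReal_le_ofReal (Real.exp_le_exp.2 h₃)))
    refine mul_le_mul_right (measure_mono fun ω hω => ?_) _
    have hω' : ({i | i ∈ s ∧ A ω i ∈ G i}.ncard : ℝ) ≤ k := hω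
    exact ENNReal.ofReal_le_ofReal (Real.exp_le_exp.2 (by linarith))
  calc μ {ω | ({i | i ∈ s ∧ A ω i ∈ G i}.ncard : ℝ) ≤ k}
      = ENNReal.ofReal (Real.exp k) * (ENNReal.ofReal (Real.exp (-k)) *
          μ {ω | ({i | i ∈ s ∧ A ω i ∈ G i}.ncard : ℝ) ≤ k}) := by
        rw [← mul_assoc, ← ENNReal.ofReal_mul (Real.exp_pos k).le, ← Real.exp_add]
        simp
    _ ≤ ENNReal.ofReal (Real.exp k) * ENNReal.ofReal (Real.exp (-(q * s.card / 2))) := by gcongr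
    _ = _ := by
        rw [← ENNReal.ofReal_mul (Real.exp_pos k).le, ← Real.exp_add, sub_eq_add_neg]

/-- Upper tail of the number of rows with a given property. -/
lemma measure_le_card_rows {n : ℕ} {A : Ω → Matrix (Fin n) (Fin n) ℂ}
    (hA : ∀ i j, Measurable fun ω => A ω i j)
    (hind : iIndepFun (fun (ij : Fin n × Fin n) ω => A ω ij.1 ij.2) μ)
    {G : Fin n → Set (Fin n → ℂ)} (hG : ∀ i, MeasurableSet (G i)) (s : Finset (Fin n)) {q k : ℝ}
    (hq : ∀ i ∈ s, μ.real {ω | A ω i ∈ G i} ≤ q) :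
    μ {ω | k ≤ ({i | i ∈ s ∧ A ω i ∈ G i}.ncard : ℝ)}
      ≤ ENNReal.ofReal (Real.exp (2 * q * s.card - k)) := by
  have : IsProbabilityMeasure μ := hind.isProbabilityMeasure
  have h₁ := lintegral_exp_card_rows_le hA hind hG s 1
  have h₂ := mul_meas_ge_le_lintegral (μ := μ) (measurable_exp_card_rows hA hG s 1)
    (ENNReal.ofReal (Real.exp k))
  have h₃ : (Real.exp 1 - 1) * ∑ i ∈ s, μ.real {ω | A ω i ∈ G i} ≤ 2 * q * s.card := by
    have h₄ : ∑ i ∈ s, μ.real {ω | A ω i ∈ G i} ≤ q * s.card := by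
      calc _ ≤ ∑ i ∈ s, q := Finset.sum_le_sum hq
        _ = q * s.card := by simp [mul_comm]
    have h₅ : 0 ≤ ∑ i ∈ s, μ.real {ω | A ω i ∈ G i} :=
      Finset.sum_nonneg fun i _ => measureReal_nonneg
    have h₆ := Real.exp_one_lt_d9
    nlinarith
  have h₄ : ENNReal.ofReal (Real.exp k) * μ {ω | k ≤ ({i | i ∈ s ∧ A ω i ∈ G i}.ncard : ℝ)}
      ≤ ENNReal.ofReal (Real.exp (2 * q * s.card)) := by
    refine le_trans ?_ ((h₂.trans h₁).trans (ENNReal.ofReal_le_ofReal (Real.exp_le_exp.2 h₃)))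
    refine mul_le_mul_right (measure_mono fun ω hω => ?_) _
    have hω' : k ≤ ({i | i ∈ s ∧ A ω i ∈ G i}.ncard : ℝ) := hω
    exact ENNReal.ofReal_le_ofReal (Real.exp_le_exp.2 (by linarith))
  calc μ {ω | k ≤ ({i | i ∈ s ∧ A ω i ∈ G i}.ncard : ℝ)}
      = ENNReal.ofReal (Real.exp (-k)) * (ENNReal.ofReal (Real.exp k) *
          μ {ω | k ≤ ({i | i ∈ s ∧ A ω i ∈ G i}.ncard : ℝ)}) := by
        rw [← mul_assoc, ← ENNReal.ofReal_mul (Real.exp_pos (-k)).le, ← Real.exp_add]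
        simp
    _ ≤ ENNReal.ofReal (Real.exp (-k)) * ENNReal.ofReal (Real.exp (2 * q * s.card)) := by gcongr
    _ = _ := by
        rw [← ENNReal.ofReal_mul (Real.exp_pos (-k)).le, ← Real.exp_add]
        ring_nf

end Independence

/-! ### Anti-concentration of sparse linear combinations -/

/-- If independent variables vanish with probability at least `1 - p` and are non-zero and away
from any given point with probability at least `b`, then a linear combination with many large
coefficients is spread out. -/
lemma le_measure_spread {Ω ι : Type*} [MeasurableSpace Ω] {μ : Measure Ω} [IsProbabilityMeasure μ]
    [Fintype ι] [DecidableEq ι] {X : ι → Ω → ℂ} (hX : ∀ j, Measurable (X j)) (hind : iIndepFun X μ)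
    {p b r : ℝ} (hp : p ≤ 1) (hb : 0 ≤ b) (hr : 0 ≤ r)
    (hzero : ∀ j, 1 - p ≤ μ.real {ω | X j ω = 0})
    (hspread : ∀ j t, b ≤ μ.real {ω | X j ω ≠ 0 ∧ r < ‖X j ω - t‖})
    {Z J : Finset ι} (hZJ : Disjoint Z J) {y : ι → ℂ} (hy : ∀ j ∈ J, 1 / 2 ≤ ‖y j‖) (w : ℂ) :
    J.card * (b * (1 - p) ^ (Z.card + J.card))
      ≤ μ.real {ω | (∀ j ∈ Z, X j ω = 0) ∧ r / 2 < ‖∑ j, X j ω * y j - w‖} := by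
  -- Here `j` is the only index of `Z ∪ J` with a non-zero variable. For different `j ∈ J` these
  -- events are disjoint, so their probabilities add and produce the factor `J.card`.
  set D : ι → Set Ω := fun j => {ω | (X j ω ≠ 0 ∧ ∀ k ∈ (Z ∪ J).erase j, X k ω = 0) ∧
    r / 2 < ‖∑ j, X j ω * y j - w‖} with hD
  have hsum_meas : Measurable fun ω => ‖∑ j, X j ω * y j - w‖ :=
    ((Finset.measurable_sum _ fun j _ => (hX j).mul_const _).sub_const _).norm
  have hzero_meas : ∀ j, MeasurableSet {ω | X j ω = 0} := fun j =>
    hX j (measurableSet_singleton 0)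
  have hD_meas : ∀ j, MeasurableSet (D j) := by
    intro j
    have : {ω | ∀ k ∈ (Z ∪ J).erase j, X k ω = 0}
        = ⋂ k ∈ (Z ∪ J).erase j, {ω | X k ω = 0} := by ext ω; simp
    have h₁ : MeasurableSet {ω | ∀ k ∈ (Z ∪ J).erase j, X k ω = 0} := by
      rw [this]
      exact Finset.measurableSet_biInter _ fun k _ => hzero_meas k
    exact ((hzero_meas j).compl.inter h₁).inter (measurableSet_lt measurable_const hsum_meas)
  have hD_disj : Set.PairwiseDisjoint (J : Set ι) D := by
    intro j hj k hk hjk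
    rw [Function.onFun, Set.disjoint_left]
    intro ω h₁ h₂
    exact h₂.1.1 (h₁.1.2 k (Finset.mem_erase.2 ⟨hjk.symm, Finset.mem_union_right _ hk⟩))
  have hD_prob : ∀ j ∈ J, b * (1 - p) ^ (Z.card + J.card) ≤ μ.real (D j) := by
    intro j hj
    set T : Finset ι := Finset.univ.erase j with hT
    have hdisj : Disjoint ({j} : Finset ι) T := by simp [hT]
    have hm : Measurable fun v : ({j} : Finset ι) → ℂ => v ⟨j, Finset.mem_singleton_self j⟩ :=
      measurable_pi_apply _
    have h₁ := (hind.indepFun_finset {j} T hdisj hX).comp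
      (φ := fun v : ({j} : Finset ι) → ℂ => v ⟨j, Finset.mem_singleton_self j⟩) (ψ := id)
      hm measurable_id
    set V : Ω → (T → ℂ) := fun ω k => X k ω with hV
    have h₁' : IndepFun (X j) V μ := h₁
    have hV_meas : Measurable V := measurable_pi_lambda _ fun k => hX k
    set S : Set (T → ℂ) := {v | ∀ k : T, (k : ι) ∈ Z ∪ J → v k = 0} with hS
    have hS_meas : MeasurableSet S := by
      have : S = ⋂ k : T, {v : T → ℂ | (k : ι) ∈ Z ∪ J → v k = 0} := by ext v; simp [hS]
      rw [this]
      refine MeasurableSet.iInter fun k => ?_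
      by_cases h : (k : ι) ∈ Z ∪ J
      · simp only [h, true_imp_iff]
        exact measurable_pi_apply k (measurableSet_singleton 0)
      · simp [h]
    set E : Set (ℂ × (T → ℂ)) := {av | (av.1 ≠ 0 ∧ av.2 ∈ S) ∧
      r / 2 < ‖av.1 * y j + ∑ k : T, av.2 k * y k - w‖} with hE
    have hE_meas : MeasurableSet E := by
      have h₂ : Measurable fun av : ℂ × (T → ℂ) => ‖av.1 * y j + ∑ k : T, av.2 k * y k - w‖ := by
        refine (((measurable_fst.mul_const _).add (Finset.measurable_sum _ fun k _ => ?_)).sub_const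
          _).norm
        exact ((measurable_pi_apply k).comp measurable_snd).mul_const _
      have h₃ : MeasurableSet {av : ℂ × (T → ℂ) | av.1 ≠ 0} :=
        (measurable_fst (measurableSet_singleton (0 : ℂ))).compl
      exact (h₃.inter (measurable_snd hS_meas)).inter (measurableSet_lt measurable_const h₂)
    have h₂ := h₁'.mul_le_measure_of_section (hX j) hV_meas hS_meas hE_meas
      (b := ENNReal.ofReal b) (by
        intro v hv
        -- With the other variables frozen, the sum is within a given distance of `w` iff `X j` is
        -- near this point; the coefficient bound `1/2` turns radius `r` into `r / 2`.
        have h₃ := hspread j ((w - ∑ k : T, v k * y k) / y j)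
        have hyj := hy j hj
        have hyj0 : y j ≠ 0 := by
          intro h
          rw [h, norm_zero] at hyj
          norm_num at hyj
        rw [← ENNReal.ofReal_le_ofReal_iff (by positivity), ofReal_measureReal] at h₃
        refine h₃.trans (measure_mono ?_)
        rintro ω ⟨hω₁, hω₂⟩
        refine ⟨⟨hω₁, hv⟩, ?_⟩
        have h₄ : X j ω * y j + ∑ k : T, v k * y k - w
            = (X j ω - (w - ∑ k : T, v k * y k) / y j) * y j := by
          field_simp
          ring
        rw [h₄, norm_mul]
        nlinarith)
    have h₃ : {ω | (X j ω, V ω) ∈ E} = D j := by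
      ext ω
      have h₄ : ∑ k, X k ω * y k = X j ω * y j + ∑ k : T, V ω k * y k := by
        rw [← Finset.add_sum_erase _ _ (Finset.mem_univ j)]
        congr 1
        exact (Finset.sum_coe_sort T fun k => X k ω * y k).symm
      have h₅ : V ω ∈ S ↔ ∀ k ∈ (Z ∪ J).erase j, X k ω = 0 := by
        simp only [hS, hV, Finset.mem_erase]
        constructor
        · intro h k hk
          exact h ⟨k, Finset.mem_erase.2 ⟨hk.1, Finset.mem_univ k⟩⟩ hk.2
        · intro h k hk
          exact h k ⟨(Finset.mem_erase.1 k.2).1, hk⟩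
      change ((X j ω ≠ 0 ∧ V ω ∈ S) ∧ _) ↔ _
      rw [h₅]
      simp only [hD]
      rw [← h₄]
      rfl
    have h₄ : (1 - p) ^ (Z.card + J.card) ≤ μ.real {ω | V ω ∈ S} := by
      have h₅ : {ω | V ω ∈ S} = ⋂ k ∈ (Z ∪ J).erase j, X k ⁻¹' {0} := by
        ext ω
        simp only [hS, hV, Set.mem_iInter, Finset.mem_erase]
        constructor
        · intro h k hk
          exact h ⟨k, Finset.mem_erase.2 ⟨hk.1, Finset.mem_univ k⟩⟩ hk.2
        · intro h k hk
          exact h k ⟨(Finset.mem_erase.1 k.2).1, hk⟩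
      have h₆ := hind.measure_inter_preimage_eq_mul ((Z ∪ J).erase j)
        (sets := fun _ => {0}) fun k _ => measurableSet_singleton 0
      rw [h₅, measureReal_def, h₆, ENNReal.toReal_prod]
      have h₇ : ((Z ∪ J).erase j).card ≤ Z.card + J.card :=
        (Finset.card_erase_le).trans (Finset.card_union_le _ _)
      have hp0 : 0 ≤ p := by
        have := hzero j
        have := measureReal_le_one (μ := μ) (s := {ω | X j ω = 0})
        linarith
      calc (1 - p) ^ (Z.card + J.card) ≤ (1 - p) ^ ((Z ∪ J).erase j).card :=
            pow_le_pow_of_le_one (by linarith) (by linarith) h₇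
        _ = ∏ k ∈ (Z ∪ J).erase j, (1 - p) := by simp
        _ ≤ _ := Finset.prod_le_prod (fun _ _ => by linarith) fun k _ => hzero k
    rw [h₃] at h₂
    have h₅ := ENNReal.toReal_mono (measure_ne_top μ _) h₂
    rw [ENNReal.toReal_mul, ENNReal.toReal_ofReal hb] at h₅
    exact (mul_le_mul_of_nonneg_left h₄ hb).trans h₅
  calc J.card * (b * (1 - p) ^ (Z.card + J.card))
      = ∑ j ∈ J, b * (1 - p) ^ (Z.card + J.card) := by simp
    _ ≤ ∑ j ∈ J, μ.real (D j) := Finset.sum_le_sum hD_prob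
    _ = μ.real (⋃ j ∈ J, D j) :=
        (measureReal_biUnion_finset hD_disj fun j _ => hD_meas j).symm
    _ ≤ _ := by
        refine measureReal_mono (Set.iUnion₂_subset fun j hj ω hω => ⟨fun k hk => ?_, hω.2⟩)
        refine hω.1.2 k (Finset.mem_erase.2 ⟨?_, Finset.mem_union_left _ hk⟩)
        rintro rfl
        exact Finset.disjoint_left.1 hZJ hk hj

/-! ### Entries of the sparse model -/

namespace IsSparseModel

variable {Ω : Type*} [MeasurableSpace Ω] {μ : Measure Ω} {n : ℕ} {α p : ℝ}
  {A : Ω → Matrix (Fin n) (Fin n) ℂ} {δ ξ : Fin n → Fin n → Ω → ℂ}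

lemma measurable_entry (h : IsSparseModel μ α p A δ ξ) (i j : Fin n) :
    Measurable fun ω => A ω i j := by
  simp only [h.entry]
  exact (h.measurable_δ i j).mul (h.measurable_ξ i j)

variable [IsProbabilityMeasure μ]

lemma one_sub_le_entry_eq_zero (h : IsSparseModel μ α p A δ ξ) (i j : Fin n) :
    1 - p ≤ μ.real {ω | A ω i j = 0} := by
  have h₁ : MeasurableSet {ω | δ i j ω = 1} := h.measurable_δ i j (measurableSet_singleton 1)
  rw [← h.δ_prob i j, ← probReal_compl_eq_one_sub h₁]
  refine measureReal_mono fun ω hω => ?_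
  have h₂ : ¬ δ i j ω = 1 := hω
  have h₃ := (h.δ_zero_one i j ω).resolve_right h₂
  change A ω i j = 0
  rw [h.entry, h₃, zero_mul]

/-- On `δ = 1` the entry equals `ξ`, which is almost surely non-zero and misses any disc of radius
`1/α` with probability at least `1/α`; independence multiplies this by `p`. -/
lemma le_entry_spread (h : IsSparseModel μ α p A δ ξ) (hp : 0 ≤ p) (i j : Fin n) (t : ℂ) :
    p / α ≤ μ.real {ω | A ω i j ≠ 0 ∧ 1 / α < ‖A ω i j - t‖} := by
  set E : Set ℂ := {a | 1 / α < ‖a - t‖} with hE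
  have hE_meas : MeasurableSet E :=
    measurableSet_lt measurable_const (measurable_id.sub_const t).norm
  have h₁ := (h.indep i j).measure_inter_preimage_eq_mul {1} E (measurableSet_singleton 1) hE_meas
  have h₂ : 1 / α ≤ μ.real (ξ i j ⁻¹' E) := by
    have h₃ : μ.real {ω | ‖ξ i j ω - t‖ ≤ 1 / α} ≤ 1 - 1 / α := by
      refine le_trans ?_ (h.ξ_levy i j)
      exact le_ciSup (f := fun τ : ℂ => μ.real {ω | ‖ξ i j ω - τ‖ ≤ 1 / α})
        ⟨1, by rintro _ ⟨τ, rfl⟩; exact measureReal_le_one⟩ t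
    have h₄ : ξ i j ⁻¹' E = {ω | ‖ξ i j ω - t‖ ≤ 1 / α}ᶜ := by
      ext ω
      simp [hE]
    have h₅ : MeasurableSet {ω | ‖ξ i j ω - t‖ ≤ 1 / α} :=
      measurableSet_le ((h.measurable_ξ i j).sub_const t).norm measurable_const
    rw [h₄, probReal_compl_eq_one_sub h₅]
    linarith
  have h₃ : μ.real (δ i j ⁻¹' {1} ∩ ξ i j ⁻¹' E) = p * μ.real (ξ i j ⁻¹' E) := by
    rw [measureReal_def, h₁, ENNReal.toReal_mul, ← h.δ_prob i j]
    rfl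
  calc p / α = p * (1 / α) := by ring
    _ ≤ p * μ.real (ξ i j ⁻¹' E) := by gcongr
    _ = μ.real (δ i j ⁻¹' {1} ∩ ξ i j ⁻¹' E) := h₃.symm
    _ ≤ _ := by
        refine ENNReal.toReal_mono (measure_ne_top μ _) (measure_mono_ae ?_)
        filter_upwards [h.ξ_ne_zero i j] with ω hω hmem
        obtain ⟨h₁, h₂⟩ := hmem
        have h₁' : δ i j ω = 1 := h₁
        have h₂' : 1 / α < ‖ξ i j ω - t‖ := h₂
        change A ω i j ≠ 0 ∧ 1 / α < ‖A ω i j - t‖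
        rw [h.entry, h₁', one_mul]
        exact ⟨hω, h₂'⟩

lemma integrable_norm_entry (h : IsSparseModel μ α p A δ ξ) (i j : Fin n) :
    Integrable (fun ω => ‖A ω i j‖) μ ∧ ∫ ω, ‖A ω i j‖ ∂μ ≤ p := by
  have hδ : (fun ω => ‖δ i j ω‖) = {ω | δ i j ω = 1}.indicator 1 := by
    ext ω
    rcases h.δ_zero_one i j ω with h0 | h1
    · simp [h0]
    · simp [h1]
  have hδ_meas : MeasurableSet {ω | δ i j ω = 1} :=
    h.measurable_δ i j (measurableSet_singleton 1)
  have hδ_int : Integrable (fun ω => ‖δ i j ω‖) μ := by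
    rw [hδ]
    exact (integrable_const (1 : ℝ)).indicator hδ_meas
  have hξ_int : Integrable (fun ω => ‖ξ i j ω‖) μ :=
    ((h.ξ_memLp i j).integrable (by norm_num)).norm
  have hξ_sq : Integrable (fun ω => ‖ξ i j ω‖ ^ 2) μ := (h.ξ_memLp i j).integrable_norm_pow two_ne_zero
  have hind : IndepFun (fun ω => ‖δ i j ω‖) (fun ω => ‖ξ i j ω‖) μ :=
    (h.indep i j).comp measurable_norm measurable_norm
  have hA : (fun ω => ‖A ω i j‖) = fun ω => ‖δ i j ω‖ * ‖ξ i j ω‖ := by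
    ext ω
    rw [h.entry, norm_mul]
  have hξ : ∫ ω, ‖ξ i j ω‖ ∂μ ≤ 1 := by
    have h₁ : ∫ ω, ‖ξ i j ω‖ ∂μ ≤ ∫ ω, (1 + ‖ξ i j ω‖ ^ 2) / 2 ∂μ := by
      refine integral_mono hξ_int (((integrable_const 1).add hξ_sq).div_const 2) fun ω => ?_
      have := sq_nonneg (‖ξ i j ω‖ - 1)
      change ‖ξ i j ω‖ ≤ (1 + ‖ξ i j ω‖ ^ 2) / 2
      linarith
    rw [integral_div, integral_add (integrable_const 1) hξ_sq, h.ξ_variance i j] at h₁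
    simpa using h₁
  have hp : ∫ ω, ‖δ i j ω‖ ∂μ = p := by
    rw [hδ, integral_indicator_one hδ_meas, h.δ_prob]
  have hp0 : 0 ≤ p := by rw [← h.δ_prob i j]; exact measureReal_nonneg
  rw [hA]
  refine ⟨hind.integrable_mul hδ_int hξ_int, ?_⟩
  rw [hind.integral_fun_mul_eq_mul_integral hδ_int.1 hξ_int.1, hp]
  exact mul_le_of_le_one_right hp0 hξ

lemma measure_heavy_row_le (h : IsSparseModel μ α p A δ ξ) {K : ℝ} (hK : 0 < K)
    (hp : 0 < p * n) (i : Fin n) :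
    μ.real {ω | K * (p * n) ≤ ∑ j, ‖A ω i j‖} ≤ 1 / K := by
  have h₁ : Integrable (fun ω => ∑ j, ‖A ω i j‖) μ :=
    integrable_finsetSum _ fun j _ => (h.integrable_norm_entry i j).1
  have h₂ := mul_meas_ge_le_integral_of_nonneg (μ := μ) (f := fun ω => ∑ j, ‖A ω i j‖)
    (Filter.Eventually.of_forall fun ω => Finset.sum_nonneg fun j _ => norm_nonneg _) h₁
    (K * (p * n))
  rw [integral_finsetSum _ fun j _ => (h.integrable_norm_entry i j).1] at h₂
  have h₃ : ∑ j, ∫ ω, ‖A ω i j‖ ∂μ ≤ p * n := by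
    calc ∑ j, ∫ ω, ‖A ω i j‖ ∂μ ≤ ∑ _j : Fin n, p :=
          Finset.sum_le_sum fun j _ => (h.integrable_norm_entry i j).2
      _ = p * n := by simp [mul_comm]
  rw [le_div_iff₀ hK]
  have h₄ := h₂.trans h₃
  have h₅ : (μ.real {ω | K * (p * n) ≤ ∑ j, ‖A ω i j‖} * K) * (p * n) ≤ 1 * (p * n) := by
    linarith
  exact le_of_mul_le_mul_right h₅ hp

end IsSparseModel

/-! ### Counting discretized vectors -/

/-- The number of words with bounded total cost. -/
lemma card_words_le {ι S : Type*} [Fintype ι] [Fintype S] [DecidableEq ι] (κ : S → ℝ) (Q : ℝ) :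
    ({θ : ι → S | ∑ j, κ (θ j) ≤ Q}.ncard : ℝ)
      ≤ Real.exp Q * (∑ s, Real.exp (-κ s)) ^ Fintype.card ι := by
  classical
  have h₁ : (∑ s, Real.exp (-κ s)) ^ Fintype.card ι
      = ∑ θ : ι → S, Real.exp (-∑ j, κ (θ j)) := by
    rw [← Finset.card_univ, ← Finset.prod_const, Finset.prod_univ_sum, Fintype.piFinset_univ]
    refine Finset.sum_congr rfl fun θ _ => ?_
    rw [← Finset.sum_neg_distrib, Real.exp_sum]
  have h₂ : {θ : ι → S | ∑ j, κ (θ j) ≤ Q}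
      = (Finset.univ.filter fun θ : ι → S => ∑ j, κ (θ j) ≤ Q : Finset (ι → S)) := by
    ext θ; simp
  rw [h₁, h₂, Set.ncard_coe_finset, Finset.mul_sum]
  calc (((Finset.univ.filter fun θ : ι → S => ∑ j, κ (θ j) ≤ Q).card : ℕ) : ℝ)
      = ∑ θ ∈ Finset.univ.filter fun θ : ι → S => ∑ j, κ (θ j) ≤ Q, (1 : ℝ) := by simp
    _ ≤ ∑ θ ∈ Finset.univ.filter fun θ : ι → S => ∑ j, κ (θ j) ≤ Q,
          Real.exp Q * Real.exp (-∑ j, κ (θ j)) := by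
        -- Exponential Markov inequality for counting: each admissible word has weight `e^{Q - cost}
        -- ≥ 1`, and the sum over all words factorises over positions.
        refine Finset.sum_le_sum fun θ hθ => ?_
        rw [← Real.exp_add]
        refine Real.one_le_exp ?_
        have := (Finset.mem_filter.1 hθ).2
        linarith
    _ ≤ _ := Finset.sum_le_sum_of_subset_of_nonneg (Finset.filter_subset _ _)
        fun θ _ _ => by positivity

/-- Pairs of integers of absolute value at most `R`. -/
abbrev Grid (R : ℕ) : Type := ↥(Finset.Icc (-(R : ℤ)) R ×ˢ Finset.Icc (-(R : ℤ)) R)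

lemma card_grid (R : ℕ) : Fintype.card (Grid R) = (2 * R + 1) ^ 2 := by
  rw [Fintype.card_coe, Finset.card_product, Int.card_Icc, sq]
  congr 1 <;> omega

/-- The point of the lattice `ε ℤ[i]` with given coordinates. -/
noncomputable def gridPoint (ε : ℝ) {R : ℕ} (g : Grid R) : ℂ := ⟨ε * (g.1.1 : ℝ), ε * (g.1.2 : ℝ)⟩

lemma exists_gridPoint {ε : ℝ} (hε : 0 < ε) {R : ℕ} {w : ℂ} (hw : ‖w‖ ≤ R * ε) :
    ∃ g : Grid R, ‖w - gridPoint ε g‖ ≤ 2 * ε := by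
  have hfloor : ∀ t : ℝ, |t| ≤ R * ε →
      ⌊t / ε⌋ ∈ Finset.Icc (-(R : ℤ)) R ∧ |t - ε * (⌊t / ε⌋ : ℝ)| ≤ ε := by
    intro t ht
    obtain ⟨h₁, h₂⟩ := abs_le.1 ht
    refine ⟨Finset.mem_Icc.2 ⟨?_, ?_⟩, ?_⟩
    · rw [Int.le_floor, le_div_iff₀ hε]
      push_cast
      linarith
    · have h₃ : t / ε ≤ R := by rwa [div_le_iff₀ hε]
      have h₄ : (⌊t / ε⌋ : ℝ) ≤ R := (Int.floor_le _).trans h₃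
      exact_mod_cast h₄
    · have h₃ := Int.floor_le (t / ε)
      have h₄ := Int.lt_floor_add_one (t / ε)
      rw [le_div_iff₀ hε] at h₃
      rw [div_lt_iff₀ hε] at h₄
      rw [abs_le]
      constructor <;> nlinarith
  have h₁ := hfloor w.re ((Complex.abs_re_le_norm w).trans hw)
  have h₂ := hfloor w.im ((Complex.abs_im_le_norm w).trans hw)
  refine ⟨⟨(⌊w.re / ε⌋, ⌊w.im / ε⌋), Finset.mem_product.2 ⟨h₁.1, h₂.1⟩⟩, ?_⟩
  refine (Complex.norm_le_abs_re_add_abs_im _).trans ?_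
  rw [Complex.sub_re, Complex.sub_im]
  have h₃ := h₁.2
  have h₄ := h₂.2
  change |w.re - ε * (⌊w.re / ε⌋ : ℝ)| + |w.im - ε * (⌊w.im / ε⌋ : ℝ)| ≤ 2 * ε
  linarith

/-- Labels of the coordinates of a discretized vector: `none` for a negligible coordinate,
`some none` for a coordinate of unrestricted size, and grid points of two sizes. -/
abbrev Label (R₁ R₂ : ℕ) : Type := Option (Option (Grid R₁ ⊕ Grid R₂))

section Label

variable {R₁ R₂ : ℕ}

/-- The value of a label. -/
noncomputable def Label.value (ε : ℝ) : Label R₁ R₂ → ℂ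
  | some (some (Sum.inl g)) => gridPoint ε g
  | some (some (Sum.inr g)) => gridPoint ε g
  | _ => 0

/-- The cost of a label, with `L` for the choice of a position. -/
noncomputable def Label.cost (L : ℝ) : Label R₁ R₂ → ℝ
  | none => 0
  | some none => L
  | some (some (Sum.inl _)) => L + Real.log (Fintype.card (Grid R₁))
  | some (some (Sum.inr _)) => L + Real.log (Fintype.card (Grid R₂))

/-- The logarithmic terms in the cost are chosen so that each of the three non-negligible classes
has total weight `e^{-L}`, whatever the size of its grid. -/
lemma sum_exp_neg_cost (L : ℝ) :
    ∑ s : Label R₁ R₂, Real.exp (-Label.cost L s) = 1 + 3 * Real.exp (-L) := by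
  have h : ∀ R : ℕ, (Fintype.card (Grid R) : ℝ)
      * Real.exp (-(L + Real.log (Fintype.card (Grid R)))) = Real.exp (-L) := by
    intro R
    have h₁ : (0 : ℝ) < Fintype.card (Grid R) := by rw [card_grid]; positivity
    rw [neg_add, Real.exp_add, Real.exp_neg (Real.log _), Real.exp_log h₁]
    field_simp
  rw [Fintype.sum_option, Fintype.sum_option, Fintype.sum_sum_type]
  simp only [Label.cost, Finset.sum_const, Finset.card_univ, nsmul_eq_mul, h]
  simp
  ring

/-- The positions of unrestricted coordinates. -/
noncomputable def freeSet {n : ℕ} (θ : Fin n → Label R₁ R₂) : Finset (Fin n) :=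
  Finset.univ.filter fun j => θ j = some none

/-- The positions of coordinates from the first grid. -/
noncomputable def levelSet {n : ℕ} (θ : Fin n → Label R₁ R₂) : Finset (Fin n) :=
  Finset.univ.filter fun j => ∃ g, θ j = some (some (Sum.inl g))

lemma disjoint_freeSet_levelSet {n : ℕ} (θ : Fin n → Label R₁ R₂) :
    Disjoint (freeSet θ) (levelSet θ) := by
  rw [Finset.disjoint_left]
  intro j h₁ h₂
  obtain ⟨g, hg⟩ := (Finset.mem_filter.1 h₂).2
  have := (Finset.mem_filter.1 h₁).2
  rw [hg] at this
  simp at this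

/-- Labellings used to discretize vectors with controlled order statistics. -/
def netSet (R₁ R₂ n m : ℕ) (ε L Q : ℝ) : Set (Fin n → Label R₁ R₂) :=
  {θ | (freeSet θ).card = m / 2 ∧ (levelSet θ).card = m - m / 2 ∧
    (∀ j ∈ levelSet θ, 1 / 2 ≤ ‖(θ j).value ε‖) ∧ ∑ j, (θ j).cost L ≤ Q}

lemma ncard_netSet_le (n m : ℕ) (ε L Q : ℝ) :
    ((netSet R₁ R₂ n m ε L Q).ncard : ℝ) ≤ Real.exp (Q + 3 * Real.exp (-L) * n) := by
  have h₁ := card_words_le (ι := Fin n) (S := Label R₁ R₂) (Label.cost L) Q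
  rw [sum_exp_neg_cost, Fintype.card_fin] at h₁
  have h₂ : ((netSet R₁ R₂ n m ε L Q).ncard : ℝ)
      ≤ ({θ : Fin n → Label R₁ R₂ | ∑ j, Label.cost L (θ j) ≤ Q}.ncard : ℝ) := by
    have h₃ : netSet R₁ R₂ n m ε L Q ⊆ {θ | ∑ j, Label.cost L (θ j) ≤ Q} := fun θ hθ => hθ.2.2.2
    exact_mod_cast Set.ncard_le_ncard h₃ (Set.toFinite _)
  refine (h₂.trans h₁).trans ?_
  rw [Real.exp_add, mul_comm _ (n : ℝ), Real.exp_nat_mul]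
  gcongr
  linarith [Real.add_one_le_exp (3 * Real.exp (-L))]

/-- Every vector with controlled order statistics is close to a labelling. -/
lemma exists_mem_netSet {n m M : ℕ} (hmM : m ≤ M) (hMn : M ≤ n) {ε H s L : ℝ} (hε : 0 < ε)
    (hε' : ε ≤ 1 / 4) {x : Fin n → ℂ} (hm : orderStat x m = 1)
    (hH : orderStat x (m / 2) ≤ H) (hs : orderStat x M ≤ s) (hR₁ : H ≤ R₁ * ε) (hR₂ : 1 ≤ R₂ * ε) :
    ∃ θ ∈ netSet R₁ R₂ n m ε L (M * L + m * Real.log (Fintype.card (Grid R₁))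
        + M * Real.log (Fintype.card (Grid R₂))),
      ∀ j ∉ freeSet θ, ‖x j - (θ j).value ε‖ ≤ max (2 * ε) s := by
  classical
  obtain ⟨t, ht_mono, ht_card, ht_mem, ht_notMem⟩ := exists_top_sets x
  have hlevel : ∀ j, ∃ g : Grid R₁, j ∉ t (m / 2) → ‖x j - gridPoint ε g‖ ≤ 2 * ε := by
    intro j
    by_cases hj : j ∈ t (m / 2)
    · exact ⟨⟨(0, 0), by simp⟩, fun h => absurd hj h⟩
    · obtain ⟨g, hg⟩ := exists_gridPoint hε (((ht_notMem _ j hj).trans hH).trans hR₁)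
      exact ⟨g, fun _ => hg⟩
  have hlow : ∀ j, ∃ g : Grid R₂, j ∉ t m → ‖x j - gridPoint ε g‖ ≤ 2 * ε := by
    intro j
    by_cases hj : j ∈ t m
    · exact ⟨⟨(0, 0), by simp⟩, fun h => absurd hj h⟩
    · obtain ⟨g, hg⟩ := exists_gridPoint hε (((ht_notMem _ j hj).trans hm.le).trans hR₂)
      exact ⟨g, fun _ => hg⟩
  choose g₁ hg₁ using hlevel
  choose g₂ hg₂ using hlow
  -- Four layers of the ordered coordinates, cut at `m / 2`, `m` and `M`. The top layer needs no
  -- value, as good rows vanish there; the large grid is spent on at most `m` positions only.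
  set θ : Fin n → Label R₁ R₂ := fun j =>
    if j ∈ t (m / 2) then some none
    else if j ∈ t m then some (some (Sum.inl (g₁ j)))
    else if j ∈ t M then some (some (Sum.inr (g₂ j))) else none with hθ
  have hsub₁ : t (m / 2) ⊆ t m := ht_mono (Nat.div_le_self m 2)
  have hsub₂ : t m ⊆ t M := ht_mono hmM
  have hfree : freeSet θ = t (m / 2) := by
    ext j
    simp only [freeSet, Finset.mem_filter, Finset.mem_univ, true_and, hθ]
    split_ifs <;> simp_all
  have hlev : levelSet θ = t m \ t (m / 2) := by
    ext j
    simp only [levelSet, Finset.mem_filter, Finset.mem_univ, true_and, hθ, Finset.mem_sdiff]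
    split_ifs <;> simp_all
  refine ⟨θ, ⟨?_, ?_, ?_, ?_⟩, ?_⟩
  · rw [hfree, ht_card _ (by omega)]
  · rw [hlev, Finset.card_sdiff_of_subset hsub₁, ht_card _ (by omega), ht_card _ (by omega)]
  · intro j hj
    rw [hlev, Finset.mem_sdiff] at hj
    have h₁ : (θ j).value ε = gridPoint ε (g₁ j) := by
      simp [hθ, hj.1, hj.2, Label.value]
    rw [h₁]
    have h₂ := hg₁ j hj.2
    have h₃ := ht_mem m j hj.1
    rw [hm] at h₃
    have h₄ := norm_sub_norm_le (x j) (gridPoint ε (g₁ j))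
    linarith
  · have hlog : ∀ R : ℕ, 0 ≤ Real.log (Fintype.card (Grid R)) := fun R =>
      Real.log_natCast_nonneg _
    have h₁ : ∀ j, (θ j).cost L ≤ (if j ∈ t M then L + Real.log (Fintype.card (Grid R₂)) else 0)
        + if j ∈ t m then Real.log (Fintype.card (Grid R₁)) else 0 := by
      intro j
      have := hlog R₁
      have := hlog R₂
      by_cases hj₁ : j ∈ t (m / 2)
      · have hj₂ := hsub₁ hj₁
        simp only [hθ, hj₁, hj₂, hsub₂ hj₂, if_true, Label.cost]
        linarith
      · by_cases hj₂ : j ∈ t m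
        · simp only [hθ, hj₁, hj₂, hsub₂ hj₂, if_true, if_false, Label.cost]
          linarith
        · by_cases hj₃ : j ∈ t M
          · simp only [hθ, hj₁, hj₂, hj₃, if_true, if_false, Label.cost]
            linarith
          · simp [hθ, hj₁, hj₂, hj₃, Label.cost]
    refine (Finset.sum_le_sum fun j _ => h₁ j).trans (le_of_eq ?_)
    rw [Finset.sum_add_distrib, Finset.sum_ite_mem, Finset.sum_ite_mem]
    simp only [Finset.univ_inter, Finset.sum_const, nsmul_eq_mul, ht_card M hMn,
      ht_card m (hmM.trans hMn)]
    ring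
  · intro j hj
    rw [hfree] at hj
    by_cases hj₂ : j ∈ t m
    · have h₁ : (θ j).value ε = gridPoint ε (g₁ j) := by simp [hθ, hj, hj₂, Label.value]
      rw [h₁]
      exact (hg₁ j hj).trans (le_max_left _ _)
    · by_cases hj₃ : j ∈ t M
      · have h₁ : (θ j).value ε = gridPoint ε (g₂ j) := by simp [hθ, hj, hj₂, hj₃, Label.value]
        rw [h₁]
        exact (hg₂ j hj₂).trans (le_max_left _ _)
      · have h₁ : (θ j).value ε = 0 := by simp [hθ, hj, hj₂, hj₃, Label.value]
        rw [h₁, sub_zero]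
        exact ((ht_notMem M j hj₃).trans hs).trans (le_max_right _ _)

end Label

/-! ### Vectors without a steep drop of order statistics -/

/-- A row whose index is alone in its fibre survives compression unchanged, so only such rows are
counted. -/
lemma sqrt_card_mul_le_compressNorm {n : ℕ} {φ : Fin n → ℕ} {B : Matrix (Fin n) (Fin n) ℂ}
    {x : Fin n → ℂ} {U : Finset (Fin n)} (hU : ∀ i ∈ U, ∀ v, φ v = φ i → v = i) {t : ℝ}
    (ht : 0 ≤ t) (hB : ∀ i ∈ U, t ≤ ‖(B *ᵥ x) i‖) : √U.card * t ≤ compressNorm φ B x := by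
  classical
  have h₁ : ∀ i ∈ U, (compress φ B *ᵥ x) (φ i) = (B *ᵥ x) i := by
    intro i hi
    have h₂ : (Finset.univ.filter fun v => φ v = φ i) = {i} := by
      ext v
      simp only [Finset.mem_filter, Finset.mem_univ, true_and, Finset.mem_singleton]
      exact ⟨hU i hi v, fun h => h ▸ rfl⟩
    simp [Matrix.mulVec, compress, dotProduct, h₂]
  rw [compressNorm]
  refine Real.le_sqrt_of_sq_le ?_
  rw [mul_pow, Real.sq_sqrt (Nat.cast_nonneg _)]
  calc (U.card : ℝ) * t ^ 2 = ∑ i ∈ U, t ^ 2 := by simp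
    _ ≤ ∑ i ∈ U, ‖(compress φ B *ᵥ x) (φ i)‖ ^ 2 := by
        refine Finset.sum_le_sum fun i hi => ?_
        rw [h₁ i hi]
        have := hB i hi
        gcongr
    _ = ∑ i' ∈ U.image φ, ‖(compress φ B *ᵥ x) i'‖ ^ 2 := by
        rw [Finset.sum_image fun a _ b hb h => hU b hb a h]
    _ ≤ _ := Finset.sum_le_sum_of_subset_of_nonneg
        (Finset.image_subset_image (Finset.subset_univ U)) fun _ _ _ => by positivity

lemma compressNorm_smul {n : ℕ} (φ : Fin n → ℕ) (B : Matrix (Fin n) (Fin n) ℂ) {a : ℝ}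
    (ha : 0 ≤ a) (x : Fin n → ℂ) : compressNorm φ B ((a : ℂ) • x) = a * compressNorm φ B x := by
  rw [compressNorm, compressNorm, Matrix.mulVec_smul]
  simp only [Pi.smul_apply, norm_smul, mul_pow, ← Finset.mul_sum, Complex.norm_real,
    Real.norm_eq_abs, sq_abs]
  rw [Real.sqrt_mul (sq_nonneg a), Real.sqrt_sq ha]

lemma sub_smul_one_mulVec {n : ℕ} (A : Matrix (Fin n) (Fin n) ℂ) (z : ℂ) (x : Fin n → ℂ)
    (i : Fin n) :
    ((A - z • (1 : Matrix (Fin n) (Fin n) ℂ)) *ᵥ x) i = ∑ j, A i j * x j - z * x i := by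
  rw [Matrix.sub_mulVec, Matrix.smul_mulVec, Matrix.one_mulVec]
  rfl

/-- The rows on which a discretized vector has a large image. -/
def goodRows {R₁ R₂ n : ℕ} (α ε : ℝ) (z : ℂ) (θ : Fin n → Label R₁ R₂) (i : Fin n) :
    Set (Fin n → ℂ) :=
  {v | (∀ j ∈ freeSet θ, v j = 0) ∧
    1 / α / 2 < ‖∑ j, v j * (θ j).value ε - z * (θ i).value ε‖}

/-- The rows of large `ℓ¹` norm. -/
def heavyRows (n : ℕ) (T : ℝ) : Set (Fin n → ℂ) := {v | T ≤ ∑ j, ‖v j‖}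

lemma le_norm_mulVec_of_goodRows {R₁ R₂ n : ℕ} {α ε e T P : ℝ} {z : ℂ}
    {θ : Fin n → Label R₁ R₂} {A : Matrix (Fin n) (Fin n) ℂ} {x : Fin n → ℂ} {i : Fin n}
    (hi : i ∉ freeSet θ) (hgood : A i ∈ goodRows α ε z θ i) (hheavy : A i ∉ heavyRows n T)
    (hz : ‖z‖ ≤ P) (he : 0 ≤ e) (hx : ∀ j ∉ freeSet θ, ‖x j - (θ j).value ε‖ ≤ e)
    (hTe : (T + P) * e ≤ 1 / α / 4) :
    1 / α / 4 ≤ ‖((A - z • (1 : Matrix (Fin n) (Fin n) ℂ)) *ᵥ x) i‖ := by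
  rw [sub_smul_one_mulVec]
  have hT : ∑ j, ‖A i j‖ ≤ T := (not_le.1 hheavy).le
  have h₁ : ‖∑ j, A i j * (x j - (θ j).value ε) - z * (x i - (θ i).value ε)‖ ≤ (T + P) * e := by
    refine (norm_sub_le _ _).trans ?_
    rw [add_mul]
    refine add_le_add ?_ ?_
    · calc ‖∑ j, A i j * (x j - (θ j).value ε)‖ ≤ ∑ j, ‖A i j‖ * e := by
            refine norm_sum_le_of_le _ fun j _ => ?_
            rw [norm_mul]
            by_cases hj : j ∈ freeSet θ
            · rw [hgood.1 j hj]
              simp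
            · exact mul_le_mul_of_nonneg_left (hx j hj) (norm_nonneg _)
        _ = (∑ j, ‖A i j‖) * e := by rw [Finset.sum_mul]
        _ ≤ T * e := by gcongr
    · rw [norm_mul]
      exact mul_le_mul hz (hx i hi) (norm_nonneg _) ((norm_nonneg z).trans hz)
  have h₂ : ∑ j, A i j * (θ j).value ε - z * (θ i).value ε
      = (∑ j, A i j * x j - z * x i)
        - (∑ j, A i j * (x j - (θ j).value ε) - z * (x i - (θ i).value ε)) := by
    simp only [mul_sub, Finset.sum_sub_distrib]
    ring
  have h₃ := hgood.2
  rw [h₂] at h₃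
  have h₄ := norm_sub_le (∑ j, A i j * x j - z * x i)
    (∑ j, A i j * (x j - (θ j).value ε) - z * (x i - (θ i).value ε))
  linarith

/-- If all discretized vectors have many good rows and there are few heavy rows, then the almost
proportional event occurs. -/
lemma almostProportionalEvent_of_goodRows {n m R₁ R₂ : ℕ} {α p c c₁ c₂ ε L Q T k h : ℝ} {z : ℂ}
    {A : Matrix (Fin n) (Fin n) ℂ} (hα : 0 < α) (hz : ‖z‖ ≤ p * n)
    (hmM : m ≤ spreadIndex c₁ n p) (hMn : spreadIndex c₁ n p ≤ n) (hε : 0 < ε) (hε' : ε ≤ 1 / 4)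
    (hR₁ : Real.exp (c₁ * (p * n)) ≤ R₁ * ε) (hR₂ : 1 ≤ R₂ * ε)
    (hQ : spreadIndex c₁ n p * L + m * Real.log (Fintype.card (Grid R₁))
      + spreadIndex c₁ n p * Real.log (Fintype.card (Grid R₂)) ≤ Q)
    (hTe : (T + p * n) * max (2 * ε) (c / (p * n)) ≤ 1 / α / 4)
    (hgood : ∀ θ ∈ netSet R₁ R₂ n m ε L Q,
      k < {i | i ∈ (freeSet θ)ᶜ ∧ A i ∈ goodRows α ε z θ i}.ncard)
    (hheavy : ({i | i ∈ Finset.univ ∧ A i ∈ heavyRows n T}.ncard : ℝ) < h)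
    (hc₂ : c₂ * √n < √(k - h - c * n) * (1 / α / 4)) :
    AlmostProportionalEvent p m c c₁ c₂ (A - z • (1 : Matrix (Fin n) (Fin n) ℂ)) := by
  classical
  intro φ hφ x _ hgap hspread
  have ha : 0 < orderStat x m :=
    lt_of_le_of_lt (mul_nonneg (Real.exp_pos _).le (orderStat_nonneg x _)) hgap
  set a := orderStat x m with hadef
  -- The net is adapted to `x*_m = 1`, so this replaces the unit normalisation; the claim is
  -- homogeneous.
  set x' : Fin n → ℂ := ((a⁻¹ : ℝ) : ℂ) • x with hx'
  have hstat : ∀ l, orderStat x' l = a⁻¹ * orderStat x l := fun l =>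
    orderStat_smul x (inv_pos.2 ha) l
  have hxx' : x = (a : ℂ) • x' := by
    have : (a : ℂ) ≠ 0 := by exact_mod_cast ha.ne'
    rw [hx', smul_smul, Complex.ofReal_inv, mul_inv_cancel₀ this, one_smul]
  have h₁ : orderStat x' m = 1 := by rw [hstat, ← hadef, inv_mul_cancel₀ ha.ne']
  have h₂ : orderStat x' (m / 2) ≤ Real.exp (c₁ * (p * n)) := by
    rw [hstat, inv_mul_le_iff₀ ha]
    rw [Real.exp_neg, inv_mul_lt_iff₀ (Real.exp_pos _)] at hgap
    linarith
  have h₃ : orderStat x' (spreadIndex c₁ n p) ≤ c / (p * n) := by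
    rw [hstat, inv_mul_le_iff₀ ha]
    linarith
  obtain ⟨θ, hθ, hθ_close⟩ := exists_mem_netSet (L := L) hmM hMn hε hε' h₁ h₂ h₃ hR₁ hR₂
  have hθ' : θ ∈ netSet R₁ R₂ n m ε L Q := ⟨hθ.1, hθ.2.1, hθ.2.2.1, hθ.2.2.2.trans hQ⟩
  have hk := hgood θ hθ'
  set S₁ : Set (Fin n) := {i | i ∈ (freeSet θ)ᶜ ∧ A i ∈ goodRows α ε z θ i} with hS₁
  set S₂ : Set (Fin n) := {i | i ∈ Finset.univ ∧ A i ∈ heavyRows n T} with hS₂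
  set S₃ : Set (Fin n) := {i : Fin n | 2 ≤ {v : Fin n | φ v = φ i}.ncard} with hS₃
  set U : Finset (Fin n) := Finset.univ.filter fun i => i ∈ S₁ ∧ i ∉ S₂ ∧ i ∉ S₃ with hU
  have hUcard : k - h - c * n ≤ U.card := by
    have h₄ : S₁ ⊆ (U : Set (Fin n)) ∪ (S₂ ∪ S₃) := by
      intro i hi
      by_cases hi₂ : i ∈ S₂
      · exact Or.inr (Or.inl hi₂)
      · by_cases hi₃ : i ∈ S₃
        · exact Or.inr (Or.inr hi₃)
        · exact Or.inl (Finset.mem_coe.2 (Finset.mem_filter.2 ⟨Finset.mem_univ i, hi, hi₂, hi₃⟩))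
    have h₅ := (Set.ncard_le_ncard h₄ (Set.toFinite _)).trans
      ((Set.ncard_union_le _ _).trans (Nat.add_le_add_left (Set.ncard_union_le _ _) _))
    rw [Set.ncard_coe_finset] at h₅
    have h₆ : (S₁.ncard : ℝ) ≤ U.card + (S₂.ncard + S₃.ncard) := by exact_mod_cast h₅
    linarith
  have hUφ : ∀ i ∈ U, ∀ v, φ v = φ i → v = i := by
    intro i hi v hv
    have hi₃ : i ∉ S₃ := (Finset.mem_filter.1 hi).2.2.2
    have h₄ : {v : Fin n | φ v = φ i}.ncard ≤ 1 := by
      have : ¬ 2 ≤ {v : Fin n | φ v = φ i}.ncard := hi₃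
      omega
    exact (Set.ncard_le_one (Set.toFinite _)).1 h₄ v hv i rfl
  have hmain := sqrt_card_mul_le_compressNorm (x := x') (t := 1 / α / 4)
    (B := A - z • (1 : Matrix (Fin n) (Fin n) ℂ)) hUφ (by positivity) (by
      intro i hi
      obtain ⟨hi₁, hi₂, -⟩ := (Finset.mem_filter.1 hi).2
      refine le_norm_mulVec_of_goodRows (Finset.mem_compl.1 hi₁.1) hi₁.2
        (fun hh => hi₂ ⟨Finset.mem_univ i, hh⟩) hz (by positivity) hθ_close hTe)
  have h₄ : √(k - h - c * n) * (1 / α / 4) ≤ √U.card * (1 / α / 4) := by gcongr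
  have h₅ : c₂ * √n < compressNorm φ (A - z • (1 : Matrix (Fin n) (Fin n) ℂ)) x' :=
    hc₂.trans_le (h₄.trans hmain)
  have h₆ : compressNorm φ (A - z • (1 : Matrix (Fin n) (Fin n) ℂ)) x
      = a * compressNorm φ (A - z • (1 : Matrix (Fin n) (Fin n) ℂ)) x' := by
    conv_lhs => rw [hxx']
    exact compressNorm_smul _ _ ha.le _
  rw [h₆, mul_comm]
  exact mul_lt_mul_of_pos_left h₅ ha

/-- The almost proportional event is vacuous if `M` does not exceed `m`. -/
lemma almostProportionalEvent_of_spreadIndex_le {n m : ℕ} {p c c₁ c₂ : ℝ}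
    (B : Matrix (Fin n) (Fin n) ℂ) (hM : spreadIndex c₁ n p ≤ m) (hc : c / (p * n) < 1) :
    AlmostProportionalEvent p m c c₁ c₂ B := by
  intro φ _ x _ hgap hspread
  have ha : 0 < orderStat x m :=
    lt_of_le_of_lt (mul_nonneg (Real.exp_pos _).le (orderStat_nonneg x _)) hgap
  have h₁ := orderStat_anti x hM
  nlinarith

/-! ### Probability that a row is good for a discretized vector -/

section Probability

variable {Ω : Type*} [MeasurableSpace Ω] {μ : Measure Ω} [IsProbabilityMeasure μ] {n : ℕ} {α p : ℝ}
  {A : Ω → Matrix (Fin n) (Fin n) ℂ} {δ ξ : Fin n → Fin n → Ω → ℂ}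

lemma measurableSet_goodRows {R₁ R₂ : ℕ} (α ε : ℝ) (z : ℂ) (θ : Fin n → Label R₁ R₂) (i : Fin n) :
    MeasurableSet (goodRows α ε z θ i) := by
  have h₁ : {v : Fin n → ℂ | ∀ j ∈ freeSet θ, v j = 0} = ⋂ j ∈ freeSet θ, {v | v j = 0} := by
    ext v; simp
  have h₂ : MeasurableSet {v : Fin n → ℂ | ∀ j ∈ freeSet θ, v j = 0} := by
    rw [h₁]
    exact Finset.measurableSet_biInter _ fun j _ => measurable_pi_apply j (measurableSet_singleton 0)
  have h₃ : Measurable fun v : Fin n → ℂ =>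
      ‖∑ j, v j * (θ j).value ε - z * (θ i).value ε‖ :=
    ((Finset.measurable_sum _ fun j _ => (measurable_pi_apply j).mul_const _).sub_const _).norm
  exact h₂.inter (measurableSet_lt measurable_const h₃)

lemma measurableSet_heavyRows (T : ℝ) : MeasurableSet (heavyRows n T) :=
  measurableSet_le measurable_const
    (Finset.measurable_sum _ fun j _ => (measurable_pi_apply j).norm)

/-- `le_measure_spread` with the free positions as `Z` and the level positions as `J`. Since `J` has
at least `m / 2` elements and `mp ≥ τ`, the bound is of order `τ/α`, and `mp ≤ 1` keeps `(1 - p) ^ m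
≥ e⁻²`. -/
lemma IsSparseModel.le_measure_goodRows (h : IsSparseModel μ α p A δ ξ) {R₁ R₂ m : ℕ} {ε L Q τ : ℝ}
    (z : ℂ) (hα : 0 < α) (hp : 0 < p) (hp2 : p ≤ 1 / 2) (hm : τ * p⁻¹ ≤ m) (hm₁ : (m : ℝ) ≤ p⁻¹)
    {θ : Fin n → Label R₁ R₂} (hθ : θ ∈ netSet R₁ R₂ n m ε L Q) (i : Fin n) :
    τ / (16 * α) ≤ μ.real {ω | A ω i ∈ goodRows α ε z θ i} := by
  obtain ⟨hZ, hJ, hy, -⟩ := hθ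
  have hind : iIndepFun (fun j ω => A ω i j) μ :=
    h.iIndep.precomp (g := fun j => (i, j)) fun j j' hjj' => (Prod.ext_iff.1 hjj').2
  have h₁ := le_measure_spread (fun j => h.measurable_entry i j) hind (p := p) (b := p / α)
    (r := 1 / α) (by linarith) (by positivity) (by positivity)
    (h.one_sub_le_entry_eq_zero i) (h.le_entry_spread hp.le i) (disjoint_freeSet_levelSet θ)
    (y := fun j => (θ j).value ε) hy (z * (θ i).value ε)
  rw [hZ, hJ] at h₁
  refine le_trans ?_ h₁
  have h₂ : m / 2 + (m - m / 2) = m := by omega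
  have h₃ : (m : ℝ) / 2 ≤ (m - m / 2 : ℕ) := by
    have : m ≤ 2 * (m - m / 2) := by omega
    have : (m : ℝ) ≤ 2 * (m - m / 2 : ℕ) := by exact_mod_cast this
    linarith
  have hmp : (m : ℝ) * p ≤ 1 := by
    calc (m : ℝ) * p ≤ p⁻¹ * p := by gcongr
      _ = 1 := inv_mul_cancel₀ hp.ne'
  have hτm : τ ≤ m * p := by rwa [← div_eq_mul_inv, div_le_iff₀ hp] at hm
  have h₄ : 1 / 8 ≤ (1 - p) ^ m := by
    have h₅ : -(2 * p) ≤ Real.log (1 - p) := by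
      refine le_trans ?_ (Real.one_sub_inv_le_log_of_pos (by linarith))
      have h₆ : (1 - p)⁻¹ ≤ 1 + 2 * p := by
        rw [inv_le_iff_one_le_mul₀ (by linarith)]
        nlinarith
      linarith
    have h₆ : Real.exp (-2) ≤ (1 - p) ^ m := by
      rw [← Real.exp_log (show 0 < 1 - p by linarith), ← Real.exp_nat_mul, Real.exp_le_exp]
      nlinarith [Nat.cast_nonneg (α := ℝ) m]
    refine le_trans ?_ h₆
    rw [Real.exp_neg, one_div]
    refine inv_anti₀ (Real.exp_pos _) ?_
    calc Real.exp 2 = Real.exp 1 ^ 2 := by rw [← Real.exp_nat_mul]; norm_num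
      _ ≤ 2.7182818286 ^ 2 := by gcongr; exact Real.exp_one_lt_d9.le
      _ ≤ 8 := by norm_num
  rw [h₂]
  calc τ / (16 * α) ≤ m * p / (16 * α) := by gcongr
    _ = m / 2 * (p / α * (1 / 8)) := by field_simp; ring
    _ ≤ _ := by gcongr

end Probability

/-! ### Union bound over the net and choice of constants -/

lemma log_card_grid_ceil_le {t : ℝ} (ht : 1 ≤ t) :
    Real.log (Fintype.card (Grid ⌈t⌉₊)) ≤ 2 * Real.log (5 * t) := by
  rw [card_grid]
  push_cast
  rw [Real.log_pow]
  push_cast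
  have h := Nat.ceil_lt_add_one (show 0 ≤ t by linarith)
  gcongr
  linarith

/-- A union bound over the discretized vectors. -/
lemma IsSparseModel.measure_not_almostProportionalEvent_le {Ω : Type*} [MeasurableSpace Ω]
    {μ : Measure Ω} [IsProbabilityMeasure μ] {n m R₁ R₂ : ℕ} {α p τ q c c₁ c₂ ε L Q : ℝ}
    {A : Ω → Matrix (Fin n) (Fin n) ℂ} {δ ξ : Fin n → Fin n → Ω → ℂ} {z : ℂ}
    (hA : IsSparseModel μ α p A δ ξ) (hz : ‖z‖ ≤ p * n) (hα : 0 < α) (hp : 0 < p)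
    (hp2 : p ≤ 1 / 2) (hPn : 1 ≤ p * n) (hm : τ * p⁻¹ ≤ m) (hm₁ : (m : ℝ) ≤ p⁻¹) (hq : 0 < q)
    (hqτ : q = τ / (16 * α))
    (hmM : m ≤ spreadIndex c₁ n p) (hMn : spreadIndex c₁ n p ≤ n) (hε : 0 < ε) (hε' : ε ≤ 1 / 4)
    (hR₁ : Real.exp (c₁ * (p * n)) ≤ R₁ * ε) (hR₂ : 1 ≤ R₂ * ε)
    (hQ : spreadIndex c₁ n p * L + m * Real.log (Fintype.card (Grid R₁))
      + spreadIndex c₁ n p * Real.log (Fintype.card (Grid R₂)) ≤ Q)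
    (hTe : (128 / q * (p * n) + p * n) * max (2 * ε) (c / (p * n)) ≤ 1 / α / 4)
    (hc₂ : c₂ * √n < √(q * n / 8 - q * n / 32 - c * n) * (1 / α / 4))
    (hQL : Q + 3 * Real.exp (-L) * n ≤ q * n / 32) (hqn : 1 ≤ q / 128 * n) :
    μ {ω | ¬ AlmostProportionalEvent p m c c₁ c₂ (A ω - z • (1 : Matrix (Fin n) (Fin n) ℂ))}
      ≤ ENNReal.ofReal (Real.exp (-(q / 128 * n))) := by
  classical
  have hP : 0 < p * n := by linarith
  have hn : 0 < (n : ℝ) := by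
    by_contra! h
    nlinarith
  set net := (netSet R₁ R₂ n m ε L Q).toFinite.toFinset with hnet
  set bad : (Fin n → Label R₁ R₂) → Set Ω := fun θ =>
    {ω | ({i | i ∈ (freeSet θ)ᶜ ∧ A ω i ∈ goodRows α ε z θ i}.ncard : ℝ) ≤ q * n / 8} with hbad
  set heavy : Set Ω := {ω | q * n / 32
    ≤ ({i | i ∈ Finset.univ ∧ A ω i ∈ heavyRows n (128 / q * (p * n))}.ncard : ℝ)} with hheavy
  have hsub : {ω | ¬ AlmostProportionalEvent p m c c₁ c₂
      (A ω - z • (1 : Matrix (Fin n) (Fin n) ℂ))} ⊆ (⋃ θ ∈ net, bad θ) ∪ heavy := by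
    intro ω hω
    by_contra hcon
    rw [Set.mem_union, not_or] at hcon
    obtain ⟨h₁, h₂⟩ := hcon
    refine hω (almostProportionalEvent_of_goodRows hα hz hmM hMn hε hε' hR₁ hR₂ hQ hTe
      (fun θ hθ => ?_) (not_le.1 h₂) hc₂)
    by_contra! h₃
    exact h₁ (Set.mem_iUnion₂.2 ⟨θ, by simpa [hnet] using hθ, h₃⟩)
  have hbad_le : ∀ θ ∈ net, μ (bad θ) ≤ ENNReal.ofReal (Real.exp (-(q * n / 8))) := by
    intro θ hθ
    have hθ' : θ ∈ netSet R₁ R₂ n m ε L Q := by simpa [hnet] using hθ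
    have h₁ := measure_card_rows_le (fun i j => hA.measurable_entry i j) hA.iIndep
      (fun i => measurableSet_goodRows α ε z θ i) (freeSet θ)ᶜ (q := q) (k := q * n / 8)
      fun i _ => hqτ ▸ hA.le_measure_goodRows z hα hp hp2 hm hm₁ hθ' i
    refine h₁.trans (ENNReal.ofReal_le_ofReal (Real.exp_le_exp.2 ?_))
    -- Free indices are excluded as rows because the diagonal term `z * x i` is uncontrolled there.
    -- At least `n / 2` rows remain, so the threshold `qn/8` leaves the exponent `qn/8 - qn/4`.
    have h₂ : (n : ℝ) / 2 ≤ ((freeSet θ)ᶜ.card : ℝ) := by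
      have h₃ : m ≤ n := hmM.trans hMn
      rw [Finset.card_compl, Fintype.card_fin, hθ'.1]
      have h₄ : n ≤ 2 * (n - m / 2) := by omega
      have h₅ : (n : ℝ) ≤ 2 * (n - m / 2 : ℕ) := by exact_mod_cast h₄
      linarith
    nlinarith
  have hheavy_le : μ heavy ≤ ENNReal.ofReal (Real.exp (-(q * n / 64))) := by
    have h₁ := measure_le_card_rows (fun i j => hA.measurable_entry i j) hA.iIndep
      (fun _ => measurableSet_heavyRows (128 / q * (p * n))) Finset.univ (q := 1 / (128 / q))
      (k := q * n / 32) fun i _ => hA.measure_heavy_row_le (by positivity) hP i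
    refine h₁.trans (ENNReal.ofReal_le_ofReal (Real.exp_le_exp.2 ?_))
    rw [Finset.card_univ, Fintype.card_fin, one_div_div]
    linarith
  have hnet_card : (net.card : ℝ) ≤ Real.exp (q * n / 32) := by
    rw [hnet, ← Set.ncard_eq_toFinset_card _ (Set.toFinite _)]
    exact (ncard_netSet_le n m ε L Q).trans (Real.exp_le_exp.2 hQL)
  have hunion : μ (⋃ θ ∈ net, bad θ) ≤ ENNReal.ofReal (Real.exp (-(q * n / 64))) := by
    calc μ (⋃ θ ∈ net, bad θ) ≤ ∑ θ ∈ net, μ (bad θ) := measure_biUnion_finset_le _ _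
      _ ≤ ∑ θ ∈ net, ENNReal.ofReal (Real.exp (-(q * n / 8))) := Finset.sum_le_sum hbad_le
      _ = ENNReal.ofReal (net.card * Real.exp (-(q * n / 8))) := by
          rw [Finset.sum_const, nsmul_eq_mul, ENNReal.ofReal_mul (Nat.cast_nonneg _),
            ENNReal.ofReal_natCast]
      _ ≤ ENNReal.ofReal (Real.exp (q * n / 32) * Real.exp (-(q * n / 8))) := by gcongr
      _ ≤ _ := by
          rw [← Real.exp_add]
          refine ENNReal.ofReal_le_ofReal (Real.exp_le_exp.2 ?_)
          have : 0 < q * n := by positivity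
          linarith
  calc _ ≤ μ ((⋃ θ ∈ net, bad θ) ∪ heavy) := measure_mono hsub
    _ ≤ μ (⋃ θ ∈ net, bad θ) + μ heavy := measure_union_le _ _
    _ ≤ ENNReal.ofReal (Real.exp (-(q * n / 64))) + ENNReal.ofReal (Real.exp (-(q * n / 64))) :=
        add_le_add hunion hheavy_le
    _ = ENNReal.ofReal (2 * Real.exp (-(q * n / 64))) := by
        rw [← ENNReal.ofReal_add (by positivity) (by positivity), two_mul]
    _ ≤ _ := by
        refine ENNReal.ofReal_le_ofReal ?_
        calc 2 * Real.exp (-(q * n / 64))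
            ≤ Real.exp (q / 128 * n) * Real.exp (-(q * n / 64)) := by
              gcongr
              have := Real.add_one_le_exp (q / 128 * n)
              linarith
          _ = Real.exp (-(q / 128 * n)) := by rw [← Real.exp_add]; ring_nf

lemma row_error_eq {α r P : ℝ} (hα : α ≠ 0) (hr : r + 1 ≠ 0) (hP : P ≠ 0) :
    (r * P + P) * (2 * (1 / (8 * α * (r + 1))) / P) = 1 / α / 4 := by
  field_simp
  norm_num

/-- The number of discretized vectors is exponentially small in the dimension. -/
lemma net_exponent_le {n : ℕ} {p τ c₁ d L : ℝ} {m : ℕ} (hτ : 0 < τ) (hp : 0 < p) (hc₁ : 0 < c₁)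
    (hd : 0 < d) (hdP : d ≤ p * n) (hL : 0 ≤ L) (hℓ : 0 ≤ Real.log (5 / d))
    (hlog : 1 ≤ Real.log (p * n)) (hm : τ * p⁻¹ ≤ m) (hm₁ : (m : ℝ) ≤ p⁻¹)
    (hmM : m ≤ spreadIndex c₁ n p) :
    spreadIndex c₁ n p * L
      + m * Real.log (Fintype.card (Grid ⌈Real.exp (c₁ * (p * n)) / (d / (p * n))⌉₊))
      + spreadIndex c₁ n p * Real.log (Fintype.card (Grid ⌈1 / (d / (p * n))⌉₊))
    ≤ c₁ * (L + 2 * Real.log (5 / d) + 2 + 2 * ((Real.log (5 / d) + 1) / τ + 1)) * n := by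
  set ℓ : ℝ := Real.log (5 / d) with hℓdef
  set P := p * n with hP
  have hP0 : 0 < P := hd.trans_le hdP
  have hn0 : 0 < (n : ℝ) := by
    by_contra! h
    nlinarith
  have hM : (spreadIndex c₁ n p : ℝ) ≤ c₁ * n / Real.log P := by
    rw [spreadIndex, ← hP]
    exact Nat.floor_le (by positivity)
  -- The assumption `m ≤ M` compares `τ/p` with `c₁n / log P`. It lets the term `m log P` be charged
  -- to `m·c₁P/τ ≤ c₁n/τ`, so that the whole exponent carries the factor `c₁`.
  have hlogP : τ * Real.log P ≤ c₁ * P := by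
    have h₁ : τ * p⁻¹ ≤ c₁ * n / Real.log P :=
      (hm.trans (by exact_mod_cast hmM)).trans hM
    rw [le_div_iff₀ (by linarith)] at h₁
    calc τ * Real.log P = (τ * p⁻¹ * Real.log P) * p := by field_simp
      _ ≤ (c₁ * n) * p := by gcongr
      _ = c₁ * P := by rw [hP]; ring
  set ε : ℝ := d / P with hε
  have hε0 : 0 < ε := by positivity
  set H : ℝ := Real.exp (c₁ * P) with hH
  have hH1 : 1 ≤ H := Real.one_le_exp (by positivity)
  have hε1 : ε ≤ 1 := div_le_one_of_le₀ hdP hP0.le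
  have hinv : 1 ≤ 1 / ε := by rw [le_div_iff₀ hε0]; linarith
  have hHε : 1 ≤ H / ε := by rw [le_div_iff₀ hε0]; linarith
  have hlog₁ : Real.log (Fintype.card (Grid ⌈H / ε⌉₊)) ≤ 2 * (ℓ + Real.log P + c₁ * P) := by
    refine (log_card_grid_ceil_le hHε).trans (le_of_eq ?_)
    have h₁ : 5 * (H / ε) = 5 / d * P * H := by rw [hε]; field_simp
    rw [h₁, Real.log_mul (by positivity) (by positivity),
      Real.log_mul (by positivity) (by positivity), hH, Real.log_exp]
  have hlog₂ : Real.log (Fintype.card (Grid ⌈1 / ε⌉₊)) ≤ 2 * (ℓ + Real.log P) := by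
    refine (log_card_grid_ceil_le hinv).trans (le_of_eq ?_)
    have h₁ : 5 * (1 / ε) = 5 / d * P := by rw [hε]; field_simp
    rw [h₁, Real.log_mul (by positivity) (by positivity)]
  have hm_le : (m : ℝ) * P ≤ n := by
    calc (m : ℝ) * P ≤ p⁻¹ * P := by gcongr
      _ = n := by rw [hP]; field_simp
  have hQ₁ : (m : ℝ) * (2 * (ℓ + Real.log P + c₁ * P)) ≤ c₁ * n * (2 * ((ℓ + 1) / τ + 1)) := by
    have h₁ : ℓ + Real.log P ≤ (ℓ + 1) / τ * (c₁ * P) := by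
      calc ℓ + Real.log P ≤ (ℓ + 1) * Real.log P := by nlinarith
        _ = (ℓ + 1) / τ * (τ * Real.log P) := by field_simp
        _ ≤ (ℓ + 1) / τ * (c₁ * P) := by gcongr
    calc (m : ℝ) * (2 * (ℓ + Real.log P + c₁ * P))
        ≤ m * (2 * ((ℓ + 1) / τ * (c₁ * P) + c₁ * P)) := by gcongr
      _ = c₁ * (m * P) * (2 * ((ℓ + 1) / τ + 1)) := by ring
      _ ≤ c₁ * n * (2 * ((ℓ + 1) / τ + 1)) := by gcongr
  have hQ₂ : (spreadIndex c₁ n p : ℝ) * (L + 2 * (ℓ + Real.log P))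
      ≤ c₁ * n * (L + 2 * ℓ + 2) := by
    have hlogpos : 0 < Real.log P := by linarith
    calc (spreadIndex c₁ n p : ℝ) * (L + 2 * (ℓ + Real.log P))
        ≤ c₁ * n / Real.log P * (L + 2 * (ℓ + Real.log P)) := by gcongr
      _ ≤ c₁ * n / Real.log P * ((L + 2 * ℓ + 2) * Real.log P) := by
          gcongr
          nlinarith
      _ = c₁ * n * (L + 2 * ℓ + 2) := by field_simp
  have h₁ : (m : ℝ) * Real.log (Fintype.card (Grid ⌈H / ε⌉₊))
      ≤ m * (2 * (ℓ + Real.log P + c₁ * P)) := by gcongr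
  have h₂ : (spreadIndex c₁ n p : ℝ) * Real.log (Fintype.card (Grid ⌈1 / ε⌉₊))
      ≤ spreadIndex c₁ n p * (2 * (ℓ + Real.log P)) := by gcongr
  linarith

/-- The sparsity constant `3 > e`, needed for `log P ≥ 1`, works for every `τ`: if `M ≤ m` the event
holds vacuously, and `m < M` itself supplies the largeness of `n` and of `P / log P` that depends on
`τ`. -/
theorem measure_not_almostProportionalEvent_le : ∀ α : ℝ, 1 ≤ α → ∃ Cα : ℝ, 0 < Cα ∧
      ∀ τ : ℝ, 0 < τ → τ < 1 →
      ∃ C c c₁ c₂ : ℝ, 0 < C ∧ 0 < c ∧ 0 < c₁ ∧ 0 < c₂ ∧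
      ∀ (n : ℕ) (p : ℝ), SparsityRange Cα n p →
      ∀ (Ω : Type u) [MeasurableSpace Ω] (μ : Measure Ω) [IsProbabilityMeasure μ]
        (A : Ω → Matrix (Fin n) (Fin n) ℂ) (δ ξ : Fin n → Fin n → Ω → ℂ) (z : ℂ),
        IsSparseModel μ α p A δ ξ → IsShift μ α p A z →
      ∀ m : ℕ, τ * p⁻¹ ≤ m → (m : ℝ) ≤ p⁻¹ →
        μ {ω | ¬ AlmostProportionalEvent p m c c₁ c₂
            (A ω - z • (1 : Matrix (Fin n) (Fin n) ℂ))}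
          ≤ ENNReal.ofReal (Real.exp (-(C * n))) := by
  intro α hα
  refine ⟨3, by norm_num, fun τ hτ hτ1 => ?_⟩
  have hα0 : 0 < α := by linarith
  set q : ℝ := τ / (16 * α) with hq
  have hq0 : 0 < q := by positivity
  have hq1 : q ≤ 1 / 16 := by
    rw [hq, div_le_div_iff₀ (by positivity) (by norm_num)]
    linarith
  -- The mesh is `d / P`; this `d` makes the discretization error in a row of norm at most `128P/q`,
  -- shift included, equal to at most `1/(4α)`, half of the spread `1/(2α)`.
  set d : ℝ := 1 / (8 * α * (128 / q + 1)) with hd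
  have hd0 : 0 < d := by positivity
  have hd1 : d ≤ 1 / 8 := by
    rw [hd]
    refine one_div_le_one_div_of_le (by norm_num) ?_
    have : 0 < 128 / q := by positivity
    nlinarith
  -- Chosen so that `3e^{-L} = q/64`.
  set L : ℝ := Real.log (192 / q) with hL
  set ℓ : ℝ := Real.log (5 / d) with hℓ
  have hL0 : 0 ≤ L := by
    refine Real.log_nonneg ?_
    rw [le_div_iff₀ hq0]; linarith
  have hℓ0 : 0 ≤ ℓ := by
    refine Real.log_nonneg ?_
    rw [le_div_iff₀ hd0]; linarith
  set D : ℝ := L + 2 * ℓ + 2 + 2 * ((ℓ + 1) / τ + 1) with hD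
  have hD1 : 1 ≤ D := by
    have : 0 ≤ (ℓ + 1) / τ := by positivity
    linarith
  -- `c₁Dn` is the net exponent from `net_exponent_le`. With `q/128 + q/64 ≤ q/32` the net stays
  -- well below the decay `e^{-qn/8}`.
  set c₁ : ℝ := q / (128 * D) with hc₁
  have hc₁0 : 0 < c₁ := by positivity
  have hc₁q : c₁ ≤ q / 128 := by
    rw [hc₁]
    gcongr
    linarith
  have hc₁D : c₁ * D = q / 128 := by
    rw [hc₁]; field_simp
  -- Coordinates beyond `M` must be below twice the mesh, and the `cn` glued rows may use up only
  -- part of the `qn/8` good ones.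
  set c : ℝ := min d (q / 64) with hc
  have hc0 : 0 < c := by positivity
  refine ⟨q / 128, c, c₁, q / (32 * α), by positivity, hc0, hc₁0, by positivity, ?_⟩
  intro n p hr Ω _ μ _ A δ ξ z hA hz m hm hm₁
  obtain ⟨hCP, -, -, -, hp, hp2⟩ := hr.bounds (by norm_num)
  set P := p * n with hP
  have hP0 : 0 < P := by linarith
  have hn0 : (0 : ℝ) < n := by exact_mod_cast hr.1
  rcases Nat.lt_or_ge m (spreadIndex c₁ n p) with hmM | hmM
  swap
  · have h₁ : {ω | ¬ AlmostProportionalEvent p m c c₁ (q / (32 * α))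
        (A ω - z • (1 : Matrix (Fin n) (Fin n) ℂ))} = ∅ := by
      rw [Set.eq_empty_iff_forall_notMem]
      intro ω hω
      refine hω (almostProportionalEvent_of_spreadIndex_le _ hmM ?_)
      rw [← hP, div_lt_one hP0]
      have : c ≤ d := min_le_left _ _
      linarith
    rw [h₁, measure_empty]
    exact zero_le
  have hlog : 1 ≤ Real.log P := by
    rw [Real.le_log_iff_exp_le hP0]
    linarith [Real.exp_one_lt_d9]
  have hM : (spreadIndex c₁ n p : ℝ) ≤ c₁ * n / Real.log P := by
    rw [spreadIndex, ← hP]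
    exact Nat.floor_le (by positivity)
  have hM' : (spreadIndex c₁ n p : ℝ) ≤ c₁ * n :=
    hM.trans (div_le_self (by positivity) hlog)
  have hM1 : (1 : ℝ) ≤ spreadIndex c₁ n p := by
    exact_mod_cast (show 1 ≤ spreadIndex c₁ n p by omega)
  -- `M ≥ 1` already forces `n` to be large; this absorbs the factor `2` of the final union bound.
  have hqn : 1 ≤ q / 128 * n := by
    calc (1 : ℝ) ≤ c₁ * n := hM1.trans hM'
      _ ≤ q / 128 * n := by gcongr
  set ε : ℝ := d / P with hε
  have hε0 : 0 < ε := by positivity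
  have hε1 : ε ≤ 1 / 4 := by
    rw [hε, div_le_iff₀ hP0]; linarith
  set H : ℝ := Real.exp (c₁ * P) with hH
  have hH1 : 1 ≤ H := Real.one_le_exp (by positivity)
  have hinv : 1 ≤ 1 / ε := by rw [le_div_iff₀ hε0]; linarith
  have hHε : 1 ≤ H / ε := by rw [le_div_iff₀ hε0]; linarith
  refine hA.measure_not_almostProportionalEvent_le (τ := τ) (ε := ε) (L := L) (Q := q / 128 * n)
    (R₁ := ⌈H / ε⌉₊) (R₂ := ⌈1 / ε⌉₊) hz.1 hα0 hp hp2 (by linarith) hm hm₁ hq0 hq hmM.le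
    ?_ hε0 hε1 ?_ ?_ ?_ ?_ ?_ ?_ hqn
  · have : (spreadIndex c₁ n p : ℝ) ≤ n := by nlinarith
    exact_mod_cast this
  · rw [← div_le_iff₀ hε0]
    exact Nat.le_ceil _
  · rw [← div_le_iff₀ hε0]
    exact Nat.le_ceil _
  · rw [← hc₁D]
    exact net_exponent_le hτ hp hc₁0 hd0 (by linarith) hL0 hℓ0 hlog hm hm₁ hmM.le
  · rw [← hP]
    have h₁ : max (2 * ε) (c / P) ≤ 2 * d / P := by
      refine max_le (le_of_eq ?_) ?_
      · rw [hε]; ring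
      · gcongr
        have : c ≤ d := min_le_left _ _
        linarith
    calc (128 / q * P + P) * max (2 * ε) (c / P) ≤ (128 / q * P + P) * (2 * d / P) := by gcongr
      _ = 1 / α / 4 := row_error_eq hα0.ne' (by positivity) hP0.ne'
  · have h₁ : c ≤ q / 64 := min_le_right _ _
    have h₂ : (q * √n / 4) ^ 2 ≤ q * n / 8 - q * n / 32 - c * n := by
      rw [div_pow, mul_pow, Real.sq_sqrt hn0.le]
      have h₃ : q ^ 2 * n ≤ q * n * (1 / 16) := by nlinarith [mul_pos hq0 hn0]
      have h₄ : c * n ≤ q / 64 * n := by gcongr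
      have h₅ : 0 < q * n := by positivity
      linarith
    have h₃ := Real.le_sqrt_of_sq_le h₂
    calc q / (32 * α) * √n < q * √n / 4 * (1 / α / 4) := by
          have h₄ : q * √n / 4 * (1 / α / 4) = 2 * (q / (32 * α) * √n) := by field_simp; norm_num
          have h₅ : 0 < q / (32 * α) * √n := by positivity
          linarith
      _ ≤ _ := by gcongr
  · have h₁ : Real.exp (-L) = q / 192 := by
      rw [hL, Real.exp_neg, Real.exp_log (by positivity), inv_div]
    rw [h₁]
    have : 0 < q * n := by positivity
    linarith

end SparseCircular

theorem proposition6p3 :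
    -- Unit vectors with comparable `x*_{⌊m/2⌋}`, `x*_m` and small `x*_M` are not almost null.
    (∀ α : ℝ, 1 ≤ α → ∃ Cα : ℝ, 0 < Cα ∧
      ∀ τ : ℝ, 0 < τ → τ < 1 →
      ∃ C c c₁ c₂ : ℝ, 0 < C ∧ 0 < c ∧ 0 < c₁ ∧ 0 < c₂ ∧
      ∀ (n : ℕ) (p : ℝ), SparseCircular.SparsityRange Cα n p →
      ∀ (Ω : Type u) [MeasurableSpace Ω] (μ : Measure Ω) [IsProbabilityMeasure μ]
        (A : Ω → Matrix (Fin n) (Fin n) ℂ) (δ ξ : Fin n → Fin n → Ω → ℂ) (z : ℂ),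
        SparseCircular.IsSparseModel μ α p A δ ξ → SparseCircular.IsShift μ α p A z →
      ∀ m : ℕ, τ * p⁻¹ ≤ m → (m : ℝ) ≤ p⁻¹ →
        -- The complement is measured, so that nothing depends on the measurability of the event.
        μ {ω | ¬ SparseCircular.AlmostProportionalEvent p m c c₁ c₂
            (A ω - z • (1 : Matrix (Fin n) (Fin n) ℂ))}
          ≤ ENNReal.ofReal (Real.exp (-(C * n)))) ∧
    -- On the good event, almost null vectors are not moderately sparse.
    (∃ C : ℝ, 0 < C ∧
      ∀ α : ℝ, 1 ≤ α →
      ∀ cS cT cE : ℝ, 0 < cS → 0 < cT → 0 < cE →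
      ∃ τ₀ : ℝ, 0 < τ₀ ∧ τ₀ < 1 ∧
      ∀ τ : ℝ, 0 < τ → τ < τ₀ →
      ∀ c c₁ c₂ : ℝ, 0 < c → 0 < c₁ → 0 < c₂ →
      ∃ Cα c' : ℝ, 0 < Cα ∧ 0 < c' ∧
      ∀ (n : ℕ) (p : ℝ), SparseCircular.SparsityRange Cα n p →
      ∀ (Ω : Type u) [MeasurableSpace Ω] (μ : Measure Ω) [IsProbabilityMeasure μ]
        (A : Ω → Matrix (Fin n) (Fin n) ℂ) (δ ξ : Fin n → Fin n → Ω → ℂ) (z : ℂ),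
        SparseCircular.IsSparseModel μ α p A δ ξ → SparseCircular.IsShift μ α p A z →
      ∀ m : ℕ, τ * p⁻¹ ≤ m → (m : ℝ) ≤ τ₀ * p⁻¹ →
      ∀ᵐ ω ∂μ, SparseCircular.Good α p cS cT cE m c c₁ c₂ (A ω) z →
        ∀ x : Fin n → ℂ,
          ‖WithLp.toLp 2 ((A ω - z • (1 : Matrix (Fin n) (Fin n) ℂ)) *ᵥ x)‖
            ≤ (2 * α) ^ (-(C * Real.log n ^ 3)) * ‖x‖ →
          ‖x‖ ≤ (2 * α) ^ (C * Real.log n ^ 3)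
            * SparseCircular.orderStat x (SparseCircular.spreadIndex c' n p)) := by
  refine ⟨SparseCircular.measure_not_almostProportionalEvent_le, ?_⟩
  obtain ⟨C, hC, h⟩ := SparseCircular.norm_le_orderStat_on_good
  refine ⟨C, hC, fun α hα cS cT cE hcS hcT hcE => ?_⟩
  obtain ⟨τ₀, hτ₀, hτ₀', h⟩ := h α hα cS cT cE hcS hcT hcE
  refine ⟨τ₀, hτ₀, hτ₀', fun τ hτ hτ' c c₁ c₂ hc hc₁ hc₂ => ?_⟩
  obtain ⟨Cα, c', hCα, hc', h⟩ := h τ hτ hτ' c c₁ c₂ hc hc₁ hc₂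
  exact ⟨Cα, c', hCα, hc', fun n p hr Ω _ μ _ A _ _ z _ hz m hm hm' =>
    h n p hr Ω μ A z hz m hm hm'⟩
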